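/- Let $n\ge 3$, $\delta\in(\tfrac12,1)$ and $\lambda>0$. There is a constant $c$ depending only on $\delta$, $\lambda$ and $n$ with the following property. Let $T>0$, $\boldsymbol m_\infty\in\mathbb S^2$, and let $\boldsymbol m:[0,T]\times\mathbb R^n\to\mathbb S^2$ be a classical solution, smooth in $(0,T)\times\mathbb R^n$, of the Landau-Lifshitz-Gilbert equation $$\partial_t\boldsymbol m=-\boldsymbol m\times\Delta\boldsymbol m-\lambda\,\boldsymbol m\times(\boldsymbol m\times\Delta\boldsymbol m)$$ with $\boldsymbol m-\boldsymbol m_\infty\in C^0([0,T];H^\infty(\mathbb R^n;\mathbb R^3))$ and $\partial_t\boldsymbol m\in C^0([0,T];H^\infty(\mathbb R^n;\mathbb R^3))$, where $H^\infty=\bigcap_{\sigma\in\mathbb N}H^\sigma$. Let $X,Y:[0,T]\times\mathbb R^n\to\mathbb R^3$ be a moving orthonormal tangent frame along $\boldsymbol m$, smooth in $(0,T)\times\mathbb R^n$, that is, $|X|=|Y|=1$ and $\boldsymbol m=X\times Y$, such that $\partial_\alpha X,\partial_\alpha Y\in C^0([0,T];H^\infty(\mathbb R^n;\mathbb R^3))$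 for $\alpha=0,\dots,n$, where $\partial_0=\partial_t$. Put $$u_k=\langle\partial_k\boldsymbol m,X\rangle+i\langle\partial_k\boldsymbol m,Y\rangle\quad(k=1,\dots,n),\qquad a_\alpha=\langle\partial_\alpha X,Y\rangle\quad(\alpha=0,\dots,n),$$ $u=(u_1,\dots,u_n)$, $a=(a_1,\dots,a_n)$, and assume the Coulomb gauge condition $\operatorname{div}a=\sum_{k=1}^n\partial_k a_k=0$ on $[0,T]\times\mathbb R^n$. Then for all $t\in[0,T]$ we have $a(t)\in L^{\frac n{2\delta-1}}(\mathbb R^n)$ and $$\|a(t)\|_{L^{\frac n{2\delta-1}}}\le c\,\|u(t)\|_{L^{\frac n\delta}}^2 .$$ Moreover, there is a decomposition $a_0=a_0^{(1)}+a_0^{(2)}$ with $$a_0^{(1)}\in C^0([0,T];L^{\frac n\delta}(\mathbb R^n)),\qquad a_0^{(2)}\in C^0([0,T];L^{\frac n{4\delta-2}}(\mathbb R^n))$$ such that for all $t\in[0,T]$ $$\|a_0^{(1)}(t)\|_{L^{\frac n\delta}}\le c\,\|u(t)\|_{L^{\frac n\delta}}\,\|\nabla u(t)\|_{L^n}\qquad\text{and}\qquad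 \|a_0^{(2)}(t)\|_{L^{\frac n{4\delta-2}}}\le c\,\|u(t)\|_{L^{\frac n\delta}}^4 .$$ -/

import Mathlib

open Set Filter Topology MeasureTheory
open scoped NNReal ENNReal ContDiff

noncomputable section

/-- The space `ℝⁿ` with its Euclidean norm. -/
abbrev Space (n : ℕ) := EuclideanSpace ℝ (Fin n)

/-- The target space `ℝ³` with its Euclidean norm. -/
abbrev Vec := EuclideanSpace ℝ (Fin 3)

/-- The vector product on `ℝ³`. -/
def cross (v w : Vec) : Vec := WithLp.toLp 2 (crossProduct v.ofLp w.ofLp)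

/-- The partial derivative `∂ₖ f (x)` of a function on `ℝⁿ`. -/
def partialDeriv {n : ℕ} {F : Type*} [NormedAddCommGroup F] [NormedSpace ℝ F]
    (k : Fin n) (f : Space n → F) (x : Space n) : F :=
  fderiv ℝ f x (EuclideanSpace.single k 1)

/-- The time derivative `∂₀ f (t, x)` on the time interval `[0, T]` (one-sided at `0` and `T`). -/
def timeDeriv {n : ℕ} {F : Type*} [NormedAddCommGroup F] [NormedSpace ℝ F]
    (T : ℝ) (f : ℝ → Space n → F) (t : ℝ) (x : Space n) : F :=
  derivWithin (fun s => f s x) (Icc 0 T) t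

/-- `f ∈ C⁰([0, T]; L^p(ℝⁿ; F))`. -/
def ContInLp {n : ℕ} {F : Type*} [NormedAddCommGroup F]
    (T : ℝ) (p : ℝ≥0∞) (f : ℝ → Space n → F) : Prop :=
  (∀ t ∈ Icc 0 T, MemLp (f t) p volume) ∧
  ∀ t₀ ∈ Icc 0 T,
    Tendsto (fun t => eLpNorm (fun x => f t x - f t₀ x) p volume) (𝓝[Icc 0 T] t₀) (𝓝 0)

/-- `f ∈ C⁰([0, T]; H^∞(ℝⁿ; F))`, where `H^∞ = ⋂ H^σ` is the space of smooth functions all of whose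
derivatives (of order `0, 1, 2, …`) are square integrable, with the topology given by the `L²` norms
of all derivatives. The smooth representative is used throughout. -/
def ContInHInfty {n : ℕ} {F : Type*} [NormedAddCommGroup F] [NormedSpace ℝ F]
    (T : ℝ) (f : ℝ → Space n → F) : Prop :=
  (∀ t ∈ Icc 0 T, ContDiff ℝ ∞ (f t)) ∧
  ∀ k : ℕ, ContInLp T 2 (fun t => iteratedFDeriv ℝ k (f t))

/-- `m : [0, T] × ℝⁿ → 𝕊²` is a classical solution of the Landau-Lifshitz-Gilbert equation
`∂ₜ m = - m × Δm - lam m × (m × Δm)`, smooth in `(0, T) × ℝⁿ`, with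
`m - m_∞ ∈ C⁰([0, T]; H^∞)` and `∂ₜ m ∈ C⁰([0, T]; H^∞)`. -/
structure IsLLGSolution {n : ℕ} (lam T : ℝ) (mInf : Vec) (m : ℝ → Space n → Vec) : Prop where
  norm_inf : ‖mInf‖ = 1
  norm_eq_one : ∀ t ∈ Icc 0 T, ∀ x, ‖m t x‖ = 1
  smooth : ContDiffOn ℝ ∞ (fun p : ℝ × Space n => m p.1 p.2) (Ioo 0 T ×ˢ univ)
  time_differentiable : ∀ x, DifferentiableOn ℝ (fun t => m t x) (Icc 0 T)
  regular : ContInHInfty T (fun t x => m t x - mInf)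
  regular_time : ContInHInfty T (timeDeriv T m)
  equation : ∀ t ∈ Ioo 0 T, ∀ x,
    timeDeriv T m t x =
      - cross (m t x) (Laplacian.laplacian (m t) x)
        - lam • cross (m t x) (cross (m t x) (Laplacian.laplacian (m t) x))

/-- `{X, Y}` is a moving orthonormal tangent frame along `m : [0, T] × ℝⁿ → 𝕊²`, smooth in
`(0, T) × ℝⁿ`, whose space-time derivatives all belong to `C⁰([0, T]; H^∞)`. -/
structure IsMovingFrame {n : ℕ} (T : ℝ) (m X Y : ℝ → Space n → Vec) : Prop where
  norm_X : ∀ t ∈ Icc 0 T, ∀ x, ‖X t x‖ = 1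
  norm_Y : ∀ t ∈ Icc 0 T, ∀ x, ‖Y t x‖ = 1
  eq_cross : ∀ t ∈ Icc 0 T, ∀ x, m t x = cross (X t x) (Y t x)
  smooth_X : ContDiffOn ℝ ∞ (fun p : ℝ × Space n => X p.1 p.2) (Ioo 0 T ×ˢ univ)
  smooth_Y : ContDiffOn ℝ ∞ (fun p : ℝ × Space n => Y p.1 p.2) (Ioo 0 T ×ˢ univ)
  space_smooth_X : ∀ t ∈ Icc 0 T, ContDiff ℝ ∞ (X t)
  space_smooth_Y : ∀ t ∈ Icc 0 T, ContDiff ℝ ∞ (Y t)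
  time_differentiable_X : ∀ x, DifferentiableOn ℝ (fun t => X t x) (Icc 0 T)
  time_differentiable_Y : ∀ x, DifferentiableOn ℝ (fun t => Y t x) (Icc 0 T)
  regular_X : ∀ k, ContInHInfty T (fun t => partialDeriv k (X t))
  regular_Y : ∀ k, ContInHInfty T (fun t => partialDeriv k (Y t))
  regular_time_X : ContInHInfty T (timeDeriv T X)
  regular_time_Y : ContInHInfty T (timeDeriv T Y)

/-- The spatial coefficients `uₖ = ⟨∂ₖ m, X⟩ + i ⟨∂ₖ m, Y⟩`, `k = 1, …, n`, of the gradient of `m`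
in the frame `{X, Y}`. -/
def derivField {n : ℕ} (m X Y : ℝ → Space n → Vec) (t : ℝ) (x : Space n) :
    EuclideanSpace ℂ (Fin n) :=
  WithLp.toLp 2 fun k =>
    ((inner ℝ (partialDeriv k (m t) x) (X t x) : ℝ) : ℂ)
      + Complex.I * ((inner ℝ (partialDeriv k (m t) x) (Y t x) : ℝ) : ℂ)

/-- The spatial gradient `∇u = (∂ₖ u_ℓ)` of a vector field `u : ℝⁿ → ℂⁿ`, with the Euclidean
(Frobenius) norm on matrices. -/
def vecGradient {n : ℕ} (u : Space n → EuclideanSpace ℂ (Fin n)) (x : Space n) :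
    EuclideanSpace ℂ (Fin n × Fin n) :=
  WithLp.toLp 2 fun kl => partialDeriv kl.1 (fun y => u y kl.2) x

/-- The spatial potential `a = (a₁, …, aₙ)`, `aₖ = ⟨∂ₖ X, Y⟩`. -/
def spatialPotential {n : ℕ} (X Y : ℝ → Space n → Vec) (t : ℝ) (x : Space n) : Space n :=
  WithLp.toLp 2 fun k => inner ℝ (partialDeriv k (X t) x) (Y t x)

/-- The temporal potential `a₀ = ⟨∂₀ X, Y⟩`. -/
def temporalPotential {n : ℕ} (T : ℝ) (X Y : ℝ → Space n → Vec) (t : ℝ) (x : Space n) : ℝ :=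
  inner ℝ (timeDeriv T X t x) (Y t x)

/-- The Coulomb gauge condition `div a = 0` on `[0, T] × ℝⁿ`. -/
def IsCoulombGauge {n : ℕ} (T : ℝ) (X Y : ℝ → Space n → Vec) : Prop :=
  ∀ t ∈ Icc 0 T, ∀ x : Space n,
    ∑ l : Fin n, partialDeriv l (fun y => spatialPotential X Y t y l) x = 0

end

/-! The potentials are recovered from the curvature of the connection they define. In the frame `{X,
Y}` the Gauss equation expresses ∂_α a_β - ∂_β a_α through products of the frame components of ∂_α m
and ∂_β m, with no derivative of a. So for φ = a_l, and for φ = a_0 at interior times, the gradient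
splits as ∂_k φ = V_k + F_k, where V_k is ∂_l a_k or ∂_t a_k and F is the curvature
(`partialDeriv_frameCoeff_XY`, `partialDeriv_temporalPotential_eq`). The Coulomb condition,
differentiated in x_l or t, says precisely that V is divergence free. Convolving with the gradient
of the Newtonian kernel kills V and leaves φ(x) = c ∫ |x-y|^(-n) ⟨x-y, F(y)⟩ dy, hence |φ| ≤ c
I(|F|) with I the Riesz potential of order one (`enorm_sub_newtonConv_le`). The
Hardy-Littlewood-Sobolev inequality `exists_eLpNorm_rieszPotential_le` maps L^p to L^q with 1/q =
1/p - 1/n, for 1 < p < n.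

For a_l one has |F| ≲ |u|², which lies in L^(n/2δ), and the bound on a follows. For a_0 the equation
replaces ∂_t m by Δm, rotated and damped, and the frame components of Δm are the covariant
divergence of u. Thus F is a sum of `derivCurvature`, of size |u||∇u|, and `cubicCurvature`, of size
|a||u|². Hölder puts the first in L^(n/(1+δ)), which I sends to L^(n/δ); the second is in
L^(n/(4δ-1)) by the bound on a, and I sends it to L^(n/(4δ-2)). The second part of a_0 is
`newtonConv` of the cubic curvature, the first is whatever remains.

Two technical points shape the argument. The representation formula is proved by integration by
parts against the smooth kernel (|z|²+s)^(-n/2) z, everything being square integrable when n ≥ 3,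
and then s tends to 0. The curvature identity for a_0 is available only for 0 < t < T, so the bound
on the first part of a_0 reaches the end points by continuity of all norms involved. That continuity
comes from the embedding of H^∞ into every L^r with 2 ≤ r < ∞ (`ContInHInfty.contInLp`), propagated
through products by the class `RegLp`. -/

/-! ### Integrals of powers of the norm, and the layer-cake formula. -/

theorem lintegral_comp_smul_space {n : ℕ} {f : Space n → ℝ≥0∞} (hf : Measurable f) {r : ℝ}
    (hr : 0 < r) : ∫⁻ z, f z = ENNReal.ofReal (r ^ n) * ∫⁻ z, f (r • z) := by
  have h := lintegral_map (μ := volume) hf (measurable_const_smul (α := Space n) r)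
  rw [Measure.map_addHaar_smul volume hr.ne', lintegral_smul_measure] at h
  rw [← h, smul_eq_mul, ← mul_assoc, ← ENNReal.ofReal_mul (by positivity)]
  have h0 : r ^ n ≠ 0 := by positivity
  have : r ^ n * |(r ^ Module.finrank ℝ (Space n))⁻¹| = 1 := by
    rw [finrank_euclideanSpace_fin, abs_of_pos (by positivity), mul_inv_cancel₀ h0]
  rw [this]; simp

theorem enorm_smul_rpow {n : ℕ} {r : ℝ} (hr : 0 < r) (s : ℝ) (z : Space n) :
    ‖r • z‖ₑ ^ s = ENNReal.ofReal (r ^ s) * ‖z‖ₑ ^ s := by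
  rw [enorm_smul, ENNReal.mul_rpow_of_ne_top enorm_ne_top enorm_ne_top,
    Real.enorm_eq_ofReal hr.le, ENNReal.ofReal_rpow_of_pos hr]

theorem lintegral_ball_enorm_rpow {n : ℕ} (s : ℝ) {r : ℝ} (hr : 0 < r) :
    ∫⁻ z : Space n, (Metric.ball 0 r).indicator (fun z => ‖z‖ₑ ^ s) z
      = ENNReal.ofReal (r ^ (n + s)) *
        ∫⁻ z : Space n, (Metric.ball 0 1).indicator (fun z => ‖z‖ₑ ^ s) z := by
  rw [lintegral_comp_smul_space (Measurable.indicator (by fun_prop) measurableSet_ball) hr]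
  have : ∀ z : Space n, (Metric.ball 0 r).indicator (fun z => ‖z‖ₑ ^ s) (r • z)
      = ENNReal.ofReal (r ^ s) * (Metric.ball 0 1).indicator (fun z => ‖z‖ₑ ^ s) z := by
    intro z
    have h : r • z ∈ Metric.ball (0 : Space n) r ↔ z ∈ Metric.ball (0 : Space n) 1 := by
      rw [mem_ball_zero_iff, mem_ball_zero_iff, norm_smul, Real.norm_of_nonneg hr.le]
      constructor
      · intro h; by_contra! h'; nlinarith
      · intro h; nlinarith
    by_cases hz : z ∈ Metric.ball (0 : Space n) 1
    · rw [indicator_of_mem (h.2 hz), indicator_of_mem hz, enorm_smul_rpow hr]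
    · rw [indicator_of_notMem (fun h' => hz (h.1 h')), indicator_of_notMem hz, mul_zero]
  simp_rw [this]
  rw [lintegral_const_mul' _ _ ENNReal.ofReal_ne_top, ← mul_assoc,
    ← ENNReal.ofReal_mul (by positivity), Real.rpow_add hr, Real.rpow_natCast]

theorem lintegral_compl_ball_enorm_rpow {n : ℕ} (s : ℝ) {r : ℝ} (hr : 0 < r) :
    ∫⁻ z : Space n, (Metric.ball 0 r)ᶜ.indicator (fun z => ‖z‖ₑ ^ s) z
      = ENNReal.ofReal (r ^ (n + s)) *
        ∫⁻ z : Space n, (Metric.ball 0 1)ᶜ.indicator (fun z => ‖z‖ₑ ^ s) z := by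
  rw [lintegral_comp_smul_space (Measurable.indicator (by fun_prop) measurableSet_ball.compl) hr]
  have : ∀ z : Space n, (Metric.ball 0 r)ᶜ.indicator (fun z => ‖z‖ₑ ^ s) (r • z)
      = ENNReal.ofReal (r ^ s) * (Metric.ball 0 1)ᶜ.indicator (fun z => ‖z‖ₑ ^ s) z := by
    intro z
    have h : r • z ∈ (Metric.ball (0 : Space n) r)ᶜ ↔ z ∈ (Metric.ball (0 : Space n) 1)ᶜ := by
      rw [mem_compl_iff, mem_compl_iff, mem_ball_zero_iff, mem_ball_zero_iff, norm_smul,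
        Real.norm_of_nonneg hr.le, not_lt, not_lt]
      constructor
      · intro h; by_contra! h'; nlinarith
      · intro h; nlinarith
    by_cases hz : z ∈ (Metric.ball (0 : Space n) 1)ᶜ
    · rw [indicator_of_mem (h.2 hz), indicator_of_mem hz, enorm_smul_rpow hr]
    · rw [indicator_of_notMem (fun h' => hz (h.1 h')), indicator_of_notMem hz, mul_zero]
  simp_rw [this]
  rw [lintegral_const_mul' _ _ ENNReal.ofReal_ne_top, ← mul_assoc,
    ← ENNReal.ofReal_mul (by positivity), Real.rpow_add hr, Real.rpow_natCast]

theorem lintegral_unit_ball_enorm_rpow_ne_top {n : ℕ} (hn : 1 ≤ n) {s : ℝ} (hs : s < n) :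
    ∫⁻ z : Space n, (Metric.ball 0 1).indicator (fun z => ‖z‖ₑ ^ (-s)) z ≠ ⊤ := by
  have h := integrableOn_ball_of_norm_le_rpow (μ := (volume : Measure (Space n)))
    (f := fun z : Space n => ‖z‖ ^ (-s)) (C := 1) (α := s) (r := 1) (by simpa using hn)
    (by simpa using hs)
    (Eventually.of_forall fun z => by rw [one_mul, Real.norm_of_nonneg (by positivity)])
    (Measurable.aestronglyMeasurable (by fun_prop))
  rw [lintegral_indicator measurableSet_ball]
  have h2 := h.2
  rw [HasFiniteIntegral] at h2
  refine ne_of_lt (lt_of_eq_of_lt (lintegral_congr_ae ?_) h2)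
  -- The origin must be discarded: there the negative real power is 0 by convention, while the power
  -- in `ℝ≥0∞` can be `⊤`.
  have hne : ∀ᵐ z : Space n ∂(volume.restrict (Metric.ball 0 1)), z ≠ 0 := by
    have : Nonempty (Fin n) := ⟨⟨0, hn⟩⟩
    exact ae_restrict_of_ae (Measure.ae_ne volume 0)
  filter_upwards [hne] with z hz
  rw [Real.enorm_eq_ofReal (by positivity), ← ENNReal.ofReal_rpow_of_pos (norm_pos_iff.2 hz),
    ofReal_norm]

theorem lintegral_compl_unit_ball_enorm_rpow_ne_top {n : ℕ} {s : ℝ} (hs : n < s) :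
    ∫⁻ z : Space n, (Metric.ball 0 1)ᶜ.indicator (fun z => ‖z‖ₑ ^ (-s)) z ≠ ⊤ := by
  have hs0 : 0 ≤ s := (Nat.cast_nonneg n).trans hs.le
  have h := (integrable_one_add_norm (E := Space n) (μ := volume) (r := s) (by simpa using hs))
  have h2 := (h.const_mul (2 ^ s)).2
  rw [HasFiniteIntegral] at h2
  refine ne_of_lt (lt_of_le_of_lt (lintegral_mono fun z => ?_) h2)
  by_cases hz : z ∈ (Metric.ball (0 : Space n) 1)ᶜ
  · rw [indicator_of_mem hz]
    have hz1 : 1 ≤ ‖z‖ := by simpa using hz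
    rw [Real.enorm_eq_ofReal (by positivity), ← ofReal_norm,
      ENNReal.ofReal_rpow_of_pos (by linarith)]
    refine ENNReal.ofReal_le_ofReal ?_
    rw [Real.rpow_neg (by positivity), Real.rpow_neg (by positivity), ← div_eq_mul_inv,
      ← Real.div_rpow (by positivity) (by positivity), ← Real.inv_rpow (by positivity)]
    refine Real.rpow_le_rpow (by positivity) ?_ hs0
    rw [inv_eq_one_div, div_le_div_iff₀ (by linarith) (by linarith)]
    linarith
  · rw [indicator_of_notMem hz]; exact zero_le

/-- Layer-cake formula for a single value: integrate the derivative of τ^s up to b. The value b =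
`⊤` is included so that no finiteness of the Riesz potential has to be known beforehand. -/
theorem lintegral_Ioi_indicator_lt {s : ℝ} (hs : 0 < s) (b : ℝ≥0∞) :
    ∫⁻ τ in Ioi (0 : ℝ), {τ : ℝ | ENNReal.ofReal τ < b}.indicator
      (fun τ => ENNReal.ofReal (s * τ ^ (s - 1))) τ = b ^ s := by
  have key : ∀ β : ℝ, 0 ≤ β → ∫⁻ τ in Ioo 0 β, ENNReal.ofReal (s * τ ^ (s - 1))
      = ENNReal.ofReal (β ^ s) := by
    intro β hβ
    have hi : IntervalIntegrable (fun τ : ℝ => s * τ ^ (s - 1)) volume 0 β :=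
      (intervalIntegral.intervalIntegrable_rpow' (by linarith)).const_mul s
    rw [restrict_Ioo_eq_restrict_Ioc, ← ofReal_integral_eq_lintegral_ofReal]
    · rw [← intervalIntegral.integral_of_le hβ, intervalIntegral.integral_const_mul,
        integral_rpow (Or.inl (by linarith))]
      congr 1
      rw [sub_add_cancel, Real.zero_rpow hs.ne', sub_zero, mul_div_cancel₀ _ hs.ne']
    · exact (intervalIntegrable_iff_integrableOn_Ioc_of_le hβ).1 hi
    · refine (ae_restrict_mem measurableSet_Ioc).mono fun τ hτ => ?_
      have := hτ.1
      simp only [Pi.zero_apply]; positivity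
  have hm : MeasurableSet {τ : ℝ | ENNReal.ofReal τ < b} :=
    measurableSet_lt ENNReal.measurable_ofReal measurable_const
  rw [setLIntegral_indicator hm]
  induction b with
  | top =>
    rw [ENNReal.top_rpow_of_pos hs]
    refine ENNReal.eq_top_of_forall_nnreal_le fun r => ?_
    have h1 : (r : ℝ≥0∞) = ENNReal.ofReal (((r : ℝ) ^ s⁻¹) ^ s) := by
      rw [← Real.rpow_mul r.coe_nonneg, inv_mul_cancel₀ hs.ne', Real.rpow_one, ENNReal.ofReal_coe_nnreal]
    rw [h1, ← key _ (by positivity)]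
    refine lintegral_mono_set fun τ hτ => ⟨ENNReal.ofReal_lt_top, hτ.1⟩
  | coe β =>
    have : {τ : ℝ | ENNReal.ofReal τ < (β : ℝ≥0∞)} ∩ Ioi 0 = Ioo 0 (β : ℝ) := by
      ext τ
      simp only [mem_inter_iff, mem_ofPred_eq, mem_Ioi, mem_Ioo]
      rw [and_comm, and_congr_right_iff]
      intro hτ
      rw [← ENNReal.ofReal_coe_nnreal, ENNReal.ofReal_lt_ofReal_iff_of_nonneg hτ.le]
    rw [this, key _ β.coe_nonneg, ← ENNReal.ofReal_rpow_of_nonneg β.coe_nonneg hs.le, ENNReal.ofReal_coe_nnreal]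

/-! ### Riesz potential of order one and the Hardy-Littlewood-Sobolev inequality. -/

/-- The Riesz potential of order one, up to normalisation. -/
noncomputable def rieszPotential {n : ℕ} (f : Space n → ℝ≥0∞) (x : Space n) : ℝ≥0∞ :=
  ∫⁻ y, ‖x - y‖ₑ ^ (1 - n : ℝ) * f y

theorem measurable_rieszPotential {n : ℕ} {f : Space n → ℝ≥0∞} (hf : Measurable f) :
    Measurable (rieszPotential f) := by
  unfold rieszPotential
  exact Measurable.lintegral_prod_right' (f := fun z : Space n × Space n =>
    ‖z.1 - z.2‖ₑ ^ (1 - n : ℝ) * f z.2) (by fun_prop)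

theorem rieszPotential_const_mul {n : ℕ} {f : Space n → ℝ≥0∞} (hf : Measurable f) (c : ℝ≥0∞)
    (x : Space n) : rieszPotential (fun y => c * f y) x = c * rieszPotential f x := by
  unfold rieszPotential
  rw [← lintegral_const_mul _ (by fun_prop)]
  congr 1; ext y; ring

/-- Cut the kernel at radius r and the function at height γ. The far kernel is handled by Hölder,
with a power of r read off from scaling. The near kernel has integral of order r, so it contributes
at most γ A r against the low part of f. Against the high part it gives h, whose L¹ norm is
controlled by Tonelli. -/
theorem exists_rieszPotential_splitting {n : ℕ} (hn : 2 ≤ n) {p : ℝ} (hp : 1 < p) (hpn : p < n) :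
    ∃ A B : ℝ, 0 < A ∧ 0 < B ∧ ∀ f : Space n → ℝ≥0∞, Measurable f → ∫⁻ y, f y ^ p ≤ 1 →
      ∀ r γ : ℝ, 0 < r → 0 < γ → ∃ h : Space n → ℝ≥0∞, Measurable h ∧
        (∀ x, rieszPotential f x ≤
          ENNReal.ofReal (B * r ^ (1 - n / p)) + ENNReal.ofReal (γ * (A * r)) + h x) ∧
        ∫⁻ x, h x ≤ ENNReal.ofReal (A * r) *
          ∫⁻ y, {y | ENNReal.ofReal γ < f y}.indicator f y := by
  have hn1 : (1 : ℝ) < n := by exact_mod_cast hn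
  set p' := p.conjExponent with hp'
  have hpp : p.HolderConjugate p' := .conjExponent hp
  have hp'0 : 0 < p' := hpp.symm.pos
  have hinv : p⁻¹ + p'⁻¹ = 1 := hpp.inv_add_inv_eq_one
  -- This is the condition p < n in dual form: the kernel |z|^(1-n) is in L^p' at infinity.
  have hfar : (n : ℝ) < (n - 1) * p' := by
    have h1 : p'⁻¹ = 1 - p⁻¹ := by linarith
    have h2 : (n : ℝ)⁻¹ < p⁻¹ := (inv_lt_inv₀ (by linarith) (by linarith)).2 hpn
    have h3 : n * p'⁻¹ < n - 1 := by
      rw [h1]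
      have : (n : ℝ) * (n : ℝ)⁻¹ = 1 := mul_inv_cancel₀ (by linarith)
      nlinarith
    have := mul_lt_mul_of_pos_right h3 hp'0
    rwa [mul_assoc, inv_mul_cancel₀ hp'0.ne', mul_one] at this
  have hA0 := lintegral_unit_ball_enorm_rpow_ne_top (n := n) (by omega) (s := n - 1) (by linarith)
  have hB0 := lintegral_compl_unit_ball_enorm_rpow_ne_top (n := n) hfar
  set A0 := ∫⁻ z : Space n, (Metric.ball 0 1).indicator (fun z => ‖z‖ₑ ^ (-((n : ℝ) - 1))) z
    with hA0d
  set B0 := ∫⁻ z : Space n, (Metric.ball 0 1)ᶜ.indicator (fun z => ‖z‖ₑ ^ (-((n - 1) * p'))) z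
    with hB0d
  have hAle : A0 ≤ ENNReal.ofReal (A0.toReal + 1) := by
    rw [← ENNReal.ofReal_toReal hA0]; exact ENNReal.ofReal_le_ofReal (by simp)
  have hBle : B0 ^ (1 / p') ≤ ENNReal.ofReal ((B0 ^ (1 / p')).toReal + 1) := by
    conv_lhs => rw [← ENNReal.ofReal_toReal (ENNReal.rpow_ne_top_of_nonneg (by positivity) hB0)]
    exact ENNReal.ofReal_le_ofReal (by simp)
  have hexp : -((n : ℝ) - 1) = 1 - n := by ring
  -- The added 1 gives positive constants without any lower bound on the two integrals.
  refine ⟨A0.toReal + 1, (B0 ^ (1 / p')).toReal + 1, by positivity, by positivity,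
    fun f hf hf1 r γ hr hγ => ?_⟩
  set N : Space n → ℝ≥0∞ := (Metric.ball 0 r).indicator (fun z => ‖z‖ₑ ^ (1 - n : ℝ)) with hN
  set K : Space n → ℝ≥0∞ := (Metric.ball 0 r)ᶜ.indicator (fun z => ‖z‖ₑ ^ (1 - n : ℝ)) with hK
  have hNm : Measurable N := Measurable.indicator (by fun_prop) measurableSet_ball
  have hKm : Measurable K := Measurable.indicator (by fun_prop) measurableSet_ball.compl
  set g : Space n → ℝ≥0∞ := {y | ENNReal.ofReal γ < f y}.indicator f with hg
  have hgm : Measurable g := hf.indicator (measurableSet_lt measurable_const hf)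
  have hNint : ∫⁻ z, N z ≤ ENNReal.ofReal ((A0.toReal + 1) * r) := by
    rw [hN, lintegral_ball_enorm_rpow _ hr, ← hexp, ← hA0d, mul_comm (A0.toReal + 1),
      ENNReal.ofReal_mul hr.le]
    have : (n : ℝ) + -(n - 1) = 1 := by ring
    rw [this, Real.rpow_one]
    gcongr
  have hfarle : ∀ x, ∫⁻ y, K (x - y) * f y
      ≤ ENNReal.ofReal (((B0 ^ (1 / p')).toReal + 1) * r ^ (1 - n / p)) := by
    intro x
    have h1 := ENNReal.lintegral_mul_le_Lp_mul_Lq volume hpp.symm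
      (f := fun y => K (x - y)) (g := f) (by fun_prop) hf.aemeasurable
    refine h1.trans ?_
    have h2 : ∫⁻ y, K (x - y) ^ p' = ENNReal.ofReal (r ^ (n + -((n - 1) * p'))) * B0 := by
      rw [lintegral_sub_left_eq_self (fun z => K z ^ p') x, hB0d,
        ← lintegral_compl_ball_enorm_rpow _ hr]
      congr 1; ext z
      by_cases hz : z ∈ (Metric.ball (0 : Space n) r)ᶜ
      · rw [hK, indicator_of_mem hz, indicator_of_mem hz, ← ENNReal.rpow_mul]
        congr 1; ring
      · rw [hK, indicator_of_notMem hz, indicator_of_notMem hz, ENNReal.zero_rpow_of_pos hp'0]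
    rw [h2, ENNReal.mul_rpow_of_nonneg _ _ (by positivity),
      ENNReal.ofReal_rpow_of_pos (by positivity), ← Real.rpow_mul hr.le]
    have h3 : (n + -((n - 1) * p')) * (1 / p') = 1 - n / p := by
      have h1 : p'⁻¹ = 1 - p⁻¹ := by linarith
      rw [one_div, add_mul, neg_mul, mul_assoc, mul_inv_cancel₀ hp'0.ne', h1, div_eq_mul_inv]
      ring
    rw [h3, mul_comm ((B0 ^ (1 / p')).toReal + 1), ENNReal.ofReal_mul (by positivity)]
    calc _ ≤ ENNReal.ofReal (r ^ (1 - n / p)) * ENNReal.ofReal ((B0 ^ (1 / p')).toReal + 1)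
          * (1 : ℝ≥0∞) ^ (1 / p) := by gcongr
      _ = _ := by rw [ENNReal.one_rpow, mul_one]
  refine ⟨fun x => ∫⁻ y, N (x - y) * g y, ?_, fun x => ?_, ?_⟩
  · exact Measurable.lintegral_prod_right' (f := fun z : Space n × Space n =>
      N (z.1 - z.2) * g z.2) (by fun_prop)
  · have hpt : ∀ y, ‖x - y‖ₑ ^ (1 - n : ℝ) * f y
        ≤ K (x - y) * f y + ENNReal.ofReal γ * N (x - y) + N (x - y) * g y := by
      intro y
      by_cases hz : x - y ∈ Metric.ball (0 : Space n) r
      · have hNz : N (x - y) = ‖x - y‖ₑ ^ (1 - n : ℝ) := by rw [hN, indicator_of_mem hz]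
        rw [hNz]
        by_cases hy : ENNReal.ofReal γ < f y
        · have : g y = f y := indicator_of_mem (s := {y | ENNReal.ofReal γ < f y}) hy f
          rw [this]; exact le_add_self
        · rw [mul_comm]
          refine le_trans ?_ (le_self_add.trans le_rfl)
          refine le_trans ?_ le_add_self
          gcongr
          exact not_lt.1 hy
      · have : K (x - y) = ‖x - y‖ₑ ^ (1 - n : ℝ) := by rw [hK, indicator_of_mem hz]
        rw [this, add_assoc]; exact le_self_add
    calc rieszPotential f x ≤ ∫⁻ y, (K (x - y) * f y + ENNReal.ofReal γ * N (x - y)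
          + N (x - y) * g y) := lintegral_mono hpt
      _ = (∫⁻ y, K (x - y) * f y) + ENNReal.ofReal γ * (∫⁻ z, N z)
          + ∫⁻ y, N (x - y) * g y := by
        rw [lintegral_add_left (by fun_prop), lintegral_add_left (by fun_prop),
          lintegral_const_mul _ (by fun_prop), lintegral_sub_left_eq_self N x]
      _ ≤ _ := by
        rw [ENNReal.ofReal_mul hγ.le]
        gcongr
        exact hfarle x
  · rw [lintegral_lintegral_swap (by fun_prop)]
    have : ∀ y, ∫⁻ x, N (x - y) * g y = (∫⁻ z, N z) * g y := by
      intro y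
      rw [lintegral_mul_const _ (by fun_prop), lintegral_sub_right_eq_self N y]
    simp_rw [this]
    rw [lintegral_const_mul _ hgm]
    gcongr

/-- A distribution estimate sharper than weak type: r and γ depend on τ so that the far term and the
low term are each τ/4. Where the potential exceeds τ, the high part h is then at least τ/2, and
Chebyshev applies. Keeping the truncated integral of f, instead of a bound for it, makes the strong
inequality accessible in one stroke. -/
theorem measure_lt_rieszPotential_le {n : ℕ} (hn : 2 ≤ n) {p q : ℝ} (hp : 1 < p) (hpn : p < n)
    (hq : 0 < q) (hpq : q⁻¹ = p⁻¹ - (n : ℝ)⁻¹) :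
    ∃ c : ℝ, 0 < c ∧ ∀ f : Space n → ℝ≥0∞, Measurable f → ∫⁻ y, f y ^ p ≤ 1 →
      ∀ τ : ℝ, 0 < τ → volume {x | ENNReal.ofReal τ < rieszPotential f x} ≤
        ENNReal.ofReal (1 / (2 * (c * τ ^ (q / p)))) *
          ∫⁻ y, {y | ENNReal.ofReal (c * τ ^ (q / p)) < f y}.indicator f y := by
  obtain ⟨A, B, hA, hB, H⟩ := exists_rieszPotential_splitting hn hp hpn
  have hn0 : (0 : ℝ) < n := by positivity
  have hp0 : 0 < p := by linarith
  have e1 : 1 - n / p = -(n / q) := by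
    rw [div_eq_mul_inv, div_eq_mul_inv, hpq, mul_sub, mul_inv_cancel₀ hn0.ne']; ring
  have e2 : q / p = 1 + q / n := by
    have : p⁻¹ = q⁻¹ + (n : ℝ)⁻¹ := by linarith
    rw [div_eq_mul_inv, this, mul_add, mul_inv_cancel₀ hq.ne', div_eq_mul_inv]
  refine ⟨1 / (4 * A * (4 * B) ^ (q / n)), by positivity, fun f hf hf1 τ hτ => ?_⟩
  -- Solves B r^(1 - n/p) = τ/4, using 1 - n/p = -n/q; γ is then determined by γ A r = τ/4.
  set r := (4 * B) ^ (q / n) * τ ^ (-(q / n)) with hr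
  have hr0 : 0 < r := by positivity
  set γ := 1 / (4 * A * (4 * B) ^ (q / n)) * τ ^ (q / p) with hγ
  have hγ0 : 0 < γ := by positivity
  have hγr : γ * (A * r) = τ / 4 := by
    rw [hγ, hr, e2, Real.rpow_add hτ, Real.rpow_one, Real.rpow_neg hτ.le]
    have : 0 < τ ^ (q / n) := by positivity
    have : 0 < (4 * B) ^ (q / n) := by positivity
    field_simp
  have hBr : B * r ^ (1 - n / p) = τ / 4 := by
    rw [e1, hr, Real.mul_rpow (by positivity) (by positivity), ← Real.rpow_mul (by positivity),
      ← Real.rpow_mul hτ.le]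
    have h1 : q / n * -(n / q) = -1 := by field_simp
    have h2 : -(q / n) * -(n / q) = 1 := by field_simp
    rw [h1, h2, Real.rpow_one, Real.rpow_neg_one]
    field_simp
  obtain ⟨h, hm, hle, hint⟩ := H f hf hf1 r γ hr0 hγ0
  have hsub : {x | ENNReal.ofReal τ < rieszPotential f x} ⊆ {x | ENNReal.ofReal (τ / 2) ≤ h x} := by
    intro x hx
    rw [mem_ofPred_eq] at hx ⊢
    by_contra! hlt
    have h1 := hx.trans_le (hle x)
    rw [hγr, hBr] at h1
    have h2 : ENNReal.ofReal (τ / 4) + ENNReal.ofReal (τ / 4) + h x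
        < ENNReal.ofReal (τ / 4) + ENNReal.ofReal (τ / 4) + ENNReal.ofReal (τ / 2) := by
      refine ENNReal.add_lt_add_left (by finiteness) hlt
    rw [← ENNReal.ofReal_add (by positivity) (by positivity),
      ← ENNReal.ofReal_add (by positivity) (by positivity)] at h2
    have : τ / 4 + τ / 4 + τ / 2 = τ := by ring
    rw [this, ENNReal.ofReal_add (by positivity) (by positivity)] at h2
    exact lt_asymm h1 h2
  calc _ ≤ volume {x | ENNReal.ofReal (τ / 2) ≤ h x} := measure_mono hsub
    _ ≤ (∫⁻ x, h x) / ENNReal.ofReal (τ / 2) :=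
      meas_ge_le_lintegral_div hm.aemeasurable (by simpa using hτ) ENNReal.ofReal_ne_top
    _ ≤ (ENNReal.ofReal (A * r) *
          ∫⁻ y, {y | ENNReal.ofReal γ < f y}.indicator f y) / ENNReal.ofReal (τ / 2) := by gcongr
    _ = _ := by
      rw [mul_comm, mul_div_assoc, ← ENNReal.ofReal_div_of_pos (by positivity), mul_comm]
      congr 2
      have : τ = 4 * (γ * (A * r)) := by rw [hγr]; ring
      rw [this]
      field_simp
      ring

/-- Marcinkiewicz argument: integrate the distribution estimate against q τ^(q-1) and exchange the
integrals. For fixed y the condition γ(τ) < f(y) restricts τ to an interval of length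
(f(y)/c)^(p/q), and the τ-integral yields f(y)^(p-1), which the remaining factor f(y) completes to
f(y)^p. -/
theorem exists_lintegral_rieszPotential_rpow_le {n : ℕ} (hn : 2 ≤ n) {p q : ℝ} (hp : 1 < p)
    (hpn : p < n) (hq : 0 < q) (hpq : q⁻¹ = p⁻¹ - (n : ℝ)⁻¹) :
    ∃ C : ℝ≥0, ∀ f : Space n → ℝ≥0∞, Measurable f → ∫⁻ y, f y ^ p ≤ 1 →
      ∫⁻ x, rieszPotential f x ^ q ≤ C := by
  obtain ⟨c, hc, H⟩ := measure_lt_rieszPotential_le hn hp hpn hq hpq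
  have hn0 : (0 : ℝ) < n := by positivity
  have hp0 : 0 < p := by linarith
  set s := q - q / p with hs
  have hs0 : 0 < s := by
    rw [hs, div_eq_mul_inv]
    have : p⁻¹ < 1 := inv_lt_one_of_one_lt₀ hp
    nlinarith
  have hps : p / q * s = p - 1 := by rw [hs]; field_simp
  -- Rewrites q τ^(q-1) / (2 c τ^(q/p)) as D s τ^(s-1), the integrand of the layer-cake formula.
  set D := q / (2 * c * s) with hD
  have hD0 : 0 < D := by positivity
  refine ⟨(D * (c⁻¹) ^ (p - 1)).toNNReal, fun f hf hf1 => ?_⟩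
  have hIm := measurable_rieszPotential hf
  set γ : ℝ → ℝ := fun τ => c * τ ^ (q / p) with hγ
  have hγm : Measurable γ := by fun_prop
  have hmI : MeasurableSet {z : Space n × ℝ | ENNReal.ofReal z.2 < rieszPotential f z.1} :=
    measurableSet_lt (by fun_prop) (by fun_prop)
  have hmf : MeasurableSet {z : ℝ × Space n | ENNReal.ofReal (γ z.1) < f z.2} :=
    measurableSet_lt (by fun_prop) (by fun_prop)
  have hpt : ∀ x, rieszPotential f x ^ q = ∫⁻ τ in Ioi (0 : ℝ),
      {z : Space n × ℝ | ENNReal.ofReal z.2 < rieszPotential f z.1}.indicator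
        (fun z => ENNReal.ofReal (q * z.2 ^ (q - 1))) (x, τ) := fun x =>
    (lintegral_Ioi_indicator_lt hq _).symm
  have hinner : ∀ y, ∫⁻ τ in Ioi (0 : ℝ), {z : ℝ × Space n | ENNReal.ofReal (γ z.1) < f z.2}.indicator
        (fun z => ENNReal.ofReal (q * z.1 ^ (q - 1) * (1 / (2 * γ z.1))) * f z.2) (τ, y)
      = ENNReal.ofReal (D * c⁻¹ ^ (p - 1)) * f y ^ p := by
    intro y
    have h1 : ∀ τ ∈ Ioi (0 : ℝ), {z : ℝ × Space n | ENNReal.ofReal (γ z.1) < f z.2}.indicator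
        (fun z => ENNReal.ofReal (q * z.1 ^ (q - 1) * (1 / (2 * γ z.1))) * f z.2) (τ, y)
        = (ENNReal.ofReal D * f y) *
          {τ : ℝ | ENNReal.ofReal τ < (ENNReal.ofReal c⁻¹ * f y) ^ (p / q)}.indicator
          (fun τ => ENNReal.ofReal (s * τ ^ (s - 1))) τ := by
      intro τ hτ
      have hτ0 : 0 < τ := hτ
      have hiff : ENNReal.ofReal (γ τ) < f y ↔
          ENNReal.ofReal τ < (ENNReal.ofReal c⁻¹ * f y) ^ (p / q) := by
        have hqp : p / q = (q / p)⁻¹ := by rw [inv_div]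
        rw [hqp, ENNReal.lt_rpow_inv_iff (by positivity), ENNReal.ofReal_rpow_of_pos hτ0, hγ,
          ENNReal.ofReal_mul hc.le, ENNReal.ofReal_inv_of_pos hc]
        rw [← ENNReal.mul_lt_mul_iff_right (a := ENNReal.ofReal c) (by simpa using hc)
          ENNReal.ofReal_ne_top (b := ENNReal.ofReal (τ ^ (q / p))), ← mul_assoc,
          ENNReal.mul_inv_cancel (by simpa using hc) ENNReal.ofReal_ne_top, one_mul]
      by_cases hlt : ENNReal.ofReal (γ τ) < f y
      · rw [indicator_of_mem (show (τ, y) ∈ _ from hlt), indicator_of_mem (show τ ∈ _ from hiff.1 hlt)]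
        rw [mul_right_comm (ENNReal.ofReal D), ← ENNReal.ofReal_mul hD0.le]
        dsimp only
        congr 2
        have e : s - 1 = (q - 1) - q / p := by rw [hs]; ring
        rw [hγ, e, Real.rpow_sub hτ0 (q - 1), hD]
        dsimp only
        have : 0 < τ ^ (q / p) := by positivity
        generalize τ ^ (q / p) = w at this ⊢
        generalize τ ^ (q - 1) = u
        field_simp
      · rw [indicator_of_notMem (show (τ, y) ∉ _ from hlt),
          indicator_of_notMem (show τ ∉ _ from fun h => hlt (hiff.2 h)), mul_zero]
    rw [setLIntegral_congr_fun measurableSet_Ioi h1,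
      lintegral_const_mul _ (Measurable.indicator (by fun_prop)
        (measurableSet_lt (by fun_prop) (by fun_prop))),
      lintegral_Ioi_indicator_lt hs0, ← ENNReal.rpow_mul, hps,
      ENNReal.mul_rpow_of_nonneg _ _ (by linarith), ENNReal.ofReal_rpow_of_pos (by positivity),
      ENNReal.ofReal_mul hD0.le]
    have : f y ^ p = f y * f y ^ (p - 1) := by
      conv_rhs => rw [← ENNReal.rpow_one (f y), ← ENNReal.rpow_mul,
        ← ENNReal.rpow_add_of_nonneg _ _ (by norm_num) (by linarith)]
      congr 1; ring
    rw [this]; ring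
  calc ∫⁻ x, rieszPotential f x ^ q
      = ∫⁻ x, ∫⁻ τ in Ioi (0 : ℝ),
        {z : Space n × ℝ | ENNReal.ofReal z.2 < rieszPotential f z.1}.indicator
        (fun z => ENNReal.ofReal (q * z.2 ^ (q - 1))) (x, τ) := lintegral_congr hpt
    _ = ∫⁻ τ in Ioi (0 : ℝ), ∫⁻ x,
        {z : Space n × ℝ | ENNReal.ofReal z.2 < rieszPotential f z.1}.indicator
        (fun z => ENNReal.ofReal (q * z.2 ^ (q - 1))) (x, τ) := by
      apply lintegral_lintegral_swap (f := fun x τ =>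
        {z : Space n × ℝ | ENNReal.ofReal z.2 < rieszPotential f z.1}.indicator
        (fun z => ENNReal.ofReal (q * z.2 ^ (q - 1))) (x, τ))
      exact (Measurable.indicator (by fun_prop) hmI).aemeasurable
    _ ≤ ∫⁻ τ in Ioi (0 : ℝ), ∫⁻ y, {z : ℝ × Space n | ENNReal.ofReal (γ z.1) < f z.2}.indicator
        (fun z => ENNReal.ofReal (q * z.1 ^ (q - 1) * (1 / (2 * γ z.1))) * f z.2) (τ, y) := by
      refine setLIntegral_mono' measurableSet_Ioi fun τ hτ => ?_
      have hτ0 : 0 < τ := hτ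
      have e1 : ∀ x, {z : Space n × ℝ | ENNReal.ofReal z.2 < rieszPotential f z.1}.indicator
        (fun z => ENNReal.ofReal (q * z.2 ^ (q - 1))) (x, τ) =
          {x | ENNReal.ofReal τ < rieszPotential f x}.indicator
          (fun _ => ENNReal.ofReal (q * τ ^ (q - 1))) x := fun x => rfl
      have e2 : ∀ y, {z : ℝ × Space n | ENNReal.ofReal (γ z.1) < f z.2}.indicator
        (fun z => ENNReal.ofReal (q * z.1 ^ (q - 1) * (1 / (2 * γ z.1))) * f z.2) (τ, y)
        = ENNReal.ofReal (q * τ ^ (q - 1) * (1 / (2 * γ τ))) *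
          {y | ENNReal.ofReal (γ τ) < f y}.indicator f y := by
        intro y
        by_cases hlt : ENNReal.ofReal (γ τ) < f y
        · rw [indicator_of_mem (show (τ, y) ∈ _ from hlt), indicator_of_mem (show y ∈ _ from hlt)]
        · rw [indicator_of_notMem (show (τ, y) ∉ _ from hlt),
            indicator_of_notMem (show y ∉ _ from hlt), mul_zero]
      simp_rw [e1, e2]
      rw [lintegral_indicator_const (measurableSet_lt measurable_const hIm),
        lintegral_const_mul _ (hf.indicator (measurableSet_lt measurable_const hf)),
        ENNReal.ofReal_mul (p := q * τ ^ (q - 1)) (by positivity), mul_assoc]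
      exact mul_le_mul_right (H f hf hf1 τ hτ0) _
    _ = ∫⁻ y, ∫⁻ τ in Ioi (0 : ℝ), {z : ℝ × Space n | ENNReal.ofReal (γ z.1) < f z.2}.indicator
        (fun z => ENNReal.ofReal (q * z.1 ^ (q - 1) * (1 / (2 * γ z.1))) * f z.2) (τ, y) := by
      apply lintegral_lintegral_swap (f := fun τ y =>
        {z : ℝ × Space n | ENNReal.ofReal (γ z.1) < f z.2}.indicator
        (fun z => ENNReal.ofReal (q * z.1 ^ (q - 1) * (1 / (2 * γ z.1))) * f z.2) (τ, y))
      exact (Measurable.indicator (by fun_prop) hmf).aemeasurable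
    _ = ENNReal.ofReal (D * c⁻¹ ^ (p - 1)) * ∫⁻ y, f y ^ p := by
      simp_rw [hinner]
      rw [lintegral_const_mul _ (by fun_prop)]
    _ ≤ ENNReal.ofReal (D * c⁻¹ ^ (p - 1)) * 1 := by gcongr
    _ = _ := by rw [mul_one]; rfl

theorem rieszPotential_congr_ae {n : ℕ} {f g : Space n → ℝ≥0∞} (h : f =ᵐ[volume] g) (x : Space n) :
    rieszPotential f x = rieszPotential g x :=
  lintegral_congr_ae (h.mono fun y hy => by simp only [hy])

/-- The **Hardy-Littlewood-Sobolev inequality** for the Riesz potential of order one. -/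
theorem exists_eLpNorm_rieszPotential_le {n : ℕ} (hn : 2 ≤ n) {p q : ℝ} (hp : 1 < p)
    (hpn : p < n) (hq : 0 < q) (hpq : q⁻¹ = p⁻¹ - (n : ℝ)⁻¹) :
    ∃ C : ℝ≥0, ∀ f : Space n → ℝ≥0∞, Measurable f →
      eLpNorm (rieszPotential f) (ENNReal.ofReal q) volume
        ≤ C * eLpNorm f (ENNReal.ofReal p) volume := by
  obtain ⟨C, hC⟩ := exists_lintegral_rieszPotential_rpow_le hn hp hpn hq hpq
  have hp0 : 0 < p := by linarith
  have hpe : ENNReal.ofReal p ≠ 0 := by simpa using hp0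
  have hqe : ENNReal.ofReal q ≠ 0 := by simpa using hq
  have norm_eq : ∀ (g : Space n → ℝ≥0∞) (r : ℝ), 0 < r → eLpNorm g (ENNReal.ofReal r) volume
      = (∫⁻ x, g x ^ r) ^ (1 / r) := by
    intro g r hr
    rw [eLpNorm_eq_lintegral_rpow_enorm_toReal (by simpa using hr) ENNReal.ofReal_ne_top,
      ENNReal.toReal_ofReal hr.le]
    rfl
  -- The added 1 keeps the constant nonzero, so the case of infinite norm is trivial.
  refine ⟨C ^ (1 / q) + 1, fun f hf => ?_⟩
  set N := eLpNorm f (ENNReal.ofReal p) volume with hN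
  have hNp : ∫⁻ x, f x ^ p = N ^ p := by
    rw [hN, norm_eq f p hp0, ← ENNReal.rpow_mul, one_div_mul_cancel hp0.ne', ENNReal.rpow_one]
  by_cases h0 : N = 0
  · have hz : f =ᵐ[volume] 0 := by
      rw [h0, ENNReal.zero_rpow_of_pos hp0, lintegral_eq_zero_iff (by fun_prop)] at hNp
      filter_upwards [hNp] with x hx
      simpa [hp0, hp0.not_gt] using hx
    have : rieszPotential f = 0 := by
      ext x; rw [rieszPotential_congr_ae hz]; simp [rieszPotential]
    rw [this, eLpNorm_zero]; exact zero_le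
  by_cases htop : N = ⊤
  · rw [htop, ENNReal.mul_top (by simp)]; exact le_top
  -- Homogeneity: the normalised estimate is applied to f divided by its norm.
  have h1 := hC (fun y => N⁻¹ * f y) (by fun_prop) (by
    simp_rw [ENNReal.mul_rpow_of_nonneg _ _ hp0.le]
    rw [lintegral_const_mul _ (by fun_prop), hNp, ENNReal.inv_rpow]
    exact ENNReal.inv_mul_le_one _)
  simp_rw [rieszPotential_const_mul hf, ENNReal.mul_rpow_of_nonneg _ _ hq.le] at h1
  have hIm := measurable_rieszPotential hf
  rw [lintegral_const_mul _ (by fun_prop)] at h1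
  rw [norm_eq _ q hq]
  have h2 : ∫⁻ x, rieszPotential f x ^ q ≤ C * N ^ q := by
    have := mul_le_mul_right h1 (N ^ q)
    rwa [← mul_assoc, ENNReal.inv_rpow, ENNReal.mul_inv_cancel, one_mul, mul_comm _ (C : ℝ≥0∞)] at this
    · simp [h0, hq, hq.not_gt, htop]
    · simp [h0, htop]
  calc _ ≤ (C * N ^ q) ^ (1 / q) := by gcongr
    _ = (C : ℝ≥0∞) ^ (1 / q) * N := by
      rw [ENNReal.mul_rpow_of_nonneg _ _ (by positivity), ← ENNReal.rpow_mul,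
        mul_one_div_cancel hq.ne', ENNReal.rpow_one]
    _ ≤ _ := by
      gcongr
      rw [ENNReal.coe_add, ENNReal.coe_rpow_of_nonneg _ (by positivity)]
      exact le_self_add

/-! ### The regularised kernel (|z|²+s)^(-n/2) z and integration by parts. -/

theorem MeasureTheory.MemLp.integrable_fun_mul {n : ℕ} {f g : Space n → ℝ} (hf : MemLp f 2 volume)
    (hg : MemLp g 2 volume) : Integrable fun y => f y * g y :=
  hf.integrable_mul hg

/-- The power `(‖z‖² + s) ^ β`, a regularisation of `‖z‖ ^ (2 β)`. -/
noncomputable def regPow {n : ℕ} (s β : ℝ) (z : Space n) : ℝ := (‖z‖ ^ 2 + s) ^ β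

theorem measurable_regPow {n : ℕ} (s β : ℝ) : Measurable (regPow (n := n) s β) := by
  unfold regPow; fun_prop

theorem regPow_pos {n : ℕ} {s : ℝ} (hs : 0 < s) (β : ℝ) (z : Space n) : 0 < regPow s β z := by
  unfold regPow; positivity

theorem regPow_add {n : ℕ} {s : ℝ} (hs : 0 < s) (β γ : ℝ) (z : Space n) :
    regPow s (β + γ) z = regPow s β z * regPow s γ z := by
  unfold regPow; rw [Real.rpow_add (by positivity)]

theorem norm_sq_mul_regPow {n : ℕ} {s : ℝ} (hs : 0 < s) (β : ℝ) (z : Space n) :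
    ‖z‖ ^ 2 * regPow s (β - 1) z = regPow s β z - s * regPow s (β - 1) z := by
  have : regPow s β z = (‖z‖ ^ 2 + s) * regPow s (β - 1) z := by
    unfold regPow; rw [Real.rpow_sub_one (by positivity)]; field_simp
  rw [this]; ring

theorem norm_mul_regPow_le {n : ℕ} {s : ℝ} (hs : 0 < s) (β : ℝ) (z : Space n) :
    ‖z‖ * regPow s β z ≤ regPow s (β + 1 / 2) z := by
  rw [regPow_add hs, mul_comm]
  refine mul_le_mul_of_nonneg_left ?_ (regPow_pos hs _ _).le
  unfold regPow
  rw [← Real.sqrt_eq_rpow]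
  exact Real.le_sqrt_of_sq_le (by linarith)

theorem regPow_anti {n : ℕ} {s S : ℝ} (hs : 0 < s) (hS : s ≤ S) {β : ℝ} (hβ : β ≤ 0)
    (z : Space n) : regPow S β z ≤ regPow s β z := by
  unfold regPow
  exact Real.rpow_le_rpow_of_nonpos (by positivity) (by linarith) hβ

/-- Changing the regularisation parameter gains two orders of decay at infinity. -/
theorem abs_regPow_sub_le {n : ℕ} {s S β : ℝ} (hs : 0 < s) (hS : s ≤ S) (hβ : 0 ≤ β)
    (z : Space n) : |regPow s (-β) z - regPow S (-β) z| ≤ (S - s) * β * regPow s (-β - 1) z := by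
  rw [abs_of_nonneg (sub_nonneg.2 (regPow_anti hs hS (by linarith) z))]
  set a := ‖z‖ ^ 2 + s with ha
  have ha0 : 0 < a := by positivity
  have hb : ‖z‖ ^ 2 + S = a * (1 + (S - s) / a) := by rw [ha]; field_simp; ring
  have hx : 0 < 1 + (S - s) / a := by
    have : 0 ≤ (S - s) / a := div_nonneg (by linarith) ha0.le
    linarith
  -- Bernoulli's inequality for a negative exponent, from e^t ≥ 1 + t and log t ≤ t - 1.
  have h1 : 1 - β * ((S - s) / a) ≤ (1 + (S - s) / a) ^ (-β) := by
    rw [Real.rpow_def_of_pos hx]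
    have h2 := Real.add_one_le_exp (Real.log (1 + (S - s) / a) * -β)
    have h3 := Real.log_le_sub_one_of_pos hx
    nlinarith
  have hS' : regPow S (-β) z = a ^ (-β) * (1 + (S - s) / a) ^ (-β) := by
    unfold regPow; rw [hb, Real.mul_rpow ha0.le hx.le]
  have hs1 : regPow s (-β - 1) z = a ^ (-β) / a := by
    unfold regPow; rw [← ha, Real.rpow_sub_one ha0.ne']
  have hs' : regPow s (-β) z = a ^ (-β) := rfl
  rw [hS', hs1, hs']
  have h4 := mul_le_mul_of_nonneg_left h1 (Real.rpow_nonneg ha0.le (-β))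
  have h5 : a ^ (-β) * (1 - β * ((S - s) / a)) = a ^ (-β) - (S - s) * β * (a ^ (-β) / a) := by
    ring
  linarith

/-- Since s > 0 there is no singularity, and the square decays like |z|^(-4β). -/
theorem memLp_two_regPow {n : ℕ} {s β : ℝ} (hs : 0 < s) (hβ : n < 4 * β) (x : Space n) :
    MemLp (fun y => regPow s (-β) (x - y)) 2 volume := by
  have hm : Measurable fun y => regPow s (-β) (x - y) :=
    (measurable_regPow s (-β)).comp (by fun_prop)
  rw [memLp_two_iff_integrable_sq hm.aestronglyMeasurable]
  have hβ0 : 0 < β := by have : (0 : ℝ) ≤ n := by positivity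
                         linarith
  have h := (integrable_rpow_neg_one_add_norm_sq (E := Space n) (μ := volume) (r := 4 * β)
    (by simpa using hβ)).comp_sub_left x
  set m := min s 1 with hm'
  have hm0 : 0 < m := by positivity
  refine (h.const_mul (m ^ (-(2 * β)))).mono' (hm.pow_const 2).aestronglyMeasurable (Eventually.of_forall fun y => ?_)
  rw [Real.norm_of_nonneg (by positivity)]
  unfold regPow
  rw [← Real.rpow_natCast _ 2, ← Real.rpow_mul (by positivity)]
  have e1 : -β * ((2 : ℕ) : ℝ) = -(2 * β) := by push_cast; ring
  have e2 : -(4 * β) / 2 = -(2 * β) := by ring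
  rw [e1, e2, ← Real.mul_rpow hm0.le (by positivity)]
  refine Real.rpow_le_rpow_of_nonpos (by positivity) ?_ (by linarith)
  have h1 : m ≤ s := min_le_left _ _
  have h2 : m ≤ 1 := min_le_right _ _
  nlinarith [sq_nonneg ‖x - y‖]

theorem hasFDerivAt_regPow {n : ℕ} {s : ℝ} (hs : 0 < s) (β : ℝ) (x y : Space n) :
    HasFDerivAt (fun y => regPow s β (x - y))
      ((-(2 * β) * regPow s (β - 1) (x - y)) • innerSL ℝ (x - y)) y := by
  have h1 : HasFDerivAt (fun y : Space n => ‖x - y‖ ^ 2 + s)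
      ((2 • innerSL ℝ (x - y)).comp (-ContinuousLinearMap.id ℝ (Space n))) y :=
    ((hasStrictFDerivAt_norm_sq (x - y)).hasFDerivAt.comp y
      ((hasFDerivAt_id y).const_sub x)).add_const s
  have h2 := h1.rpow_const (p := β) (Or.inl (by positivity))
  refine h2.congr_fderiv ?_
  ext v
  simp [regPow]
  ring

theorem fderiv_regPow_single {n : ℕ} {s : ℝ} (hs : 0 < s) (β : ℝ) (x y : Space n) (k : Fin n) :
    fderiv ℝ (fun y => regPow s β (x - y)) y (EuclideanSpace.single k 1)
      = -(2 * β) * regPow s (β - 1) (x - y) * (x - y) k := by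
  rw [(hasFDerivAt_regPow hs β x y).fderiv]
  simp [EuclideanSpace.inner_single_right]

theorem inner_eq_sum_mul {n : ℕ} (v w : Space n) : inner ℝ v w = ∑ k, v k * w k := by
  rw [PiLp.inner_apply]; simp [mul_comm]

theorem abs_coord_le {n : ℕ} (z : Space n) (k : Fin n) : |z k| ≤ ‖z‖ := by
  simpa using PiLp.norm_apply_le z k

theorem memLp_coord {n : ℕ} {V : Space n → Space n} {p : ℝ≥0∞} (hV : MemLp V p volume) (k : Fin n) :
    MemLp (fun y => V y k) p volume :=
  (EuclideanSpace.proj (𝕜 := ℝ) k).comp_memLp' hV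

/-- The regularised kernel decays like |z|^(1-n), which is square integrable at infinity when n > 2.
-/
theorem memLp_coord_mul_regPow {n : ℕ} (hn : 3 ≤ n) {s : ℝ} (hs : 0 < s) (x : Space n) (k : Fin n) :
    MemLp (fun y => regPow s (-(n / 2 : ℝ)) (x - y) * (x - y) k) 2 volume := by
  have hn3 : (3 : ℝ) ≤ n := by exact_mod_cast hn
  have hm := (measurable_regPow (n := n) s (-(n / 2 : ℝ))).comp (measurable_const_sub x)
  refine (memLp_two_regPow hs (β := (n - 1) / 2) (by linarith) x).mono' ?_
    (Eventually.of_forall fun y => ?_)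
  · exact (hm.mul (by fun_prop)).aestronglyMeasurable
  · rw [norm_mul, Real.norm_of_nonneg (regPow_pos hs _ _).le, Real.norm_eq_abs, mul_comm]
    calc _ ≤ ‖x - y‖ * regPow s (-(n / 2 : ℝ)) (x - y) := by
          gcongr
          · exact (regPow_pos hs _ _).le
          · exact abs_coord_le _ _
      _ ≤ _ := norm_mul_regPow_le hs _ _
      _ = _ := by congr 1; ring

theorem integrable_inner_mul_regPow {n : ℕ} (hn : 3 ≤ n) {s : ℝ} (hs : 0 < s) (x : Space n)
    {V : Space n → Space n} (hV : MemLp V 2 volume) :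
    Integrable fun y => regPow s (-(n / 2 : ℝ)) (x - y) * inner ℝ (x - y) (V y) := by
  have : (fun y => regPow s (-(n / 2 : ℝ)) (x - y) * inner ℝ (x - y) (V y)) =
      fun y => ∑ k, (regPow s (-(n / 2 : ℝ)) (x - y) * (x - y) k) * V y k := by
    ext y; rw [inner_eq_sum_mul, Finset.mul_sum]; congr 1; ext k; ring
  rw [this]
  exact integrable_finsetSum _ fun k _ => (memLp_coord_mul_regPow hn hs x k).integrable_fun_mul (memLp_coord hV k)

/-- The kernel is a multiple of the gradient of (|z|²+s)^(-(n-2)/2), and gradients are orthogonal to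
divergence-free fields. That potential is not in L² for n = 3 or 4. The difference of the potentials
for s and S decays like |z|^(-n) and is in L², which legitimises the integration by parts and shows
that the pairing does not depend on s. -/
theorem integral_regPow_inner_eq_of_divergence_zero {n : ℕ} (hn : 3 ≤ n) {V : Space n → Space n}
    (hV : Differentiable ℝ V) (hV2 : MemLp V 2 volume)
    (hdV : ∀ k, MemLp (fun y => partialDeriv k (fun z => V z k) y) 2 volume)
    (hdiv : ∀ y, ∑ k, partialDeriv k (fun z => V z k) y = 0) (x : Space n) {s S : ℝ} (hs : 0 < s)
    (hS : s ≤ S) :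
    ∫ y, regPow s (-(n / 2 : ℝ)) (x - y) * inner ℝ (x - y) (V y)
      = ∫ y, regPow S (-(n / 2 : ℝ)) (x - y) * inner ℝ (x - y) (V y) := by
  have hn3 : (3 : ℝ) ≤ n := by exact_mod_cast hn
  have hS0 : 0 < S := hs.trans_le hS
  set β : ℝ := (n - 2) / 2 with hβ
  have hβ1 : -β - 1 = -(n / 2 : ℝ) := by rw [hβ]; ring
  set h : Space n → ℝ := fun y => regPow s (-β) (x - y) - regPow S (-β) (x - y) with hh
  have hhd : Differentiable ℝ h := fun y =>
    (hasFDerivAt_regPow hs _ x y).differentiableAt.sub (hasFDerivAt_regPow hS0 _ x y).differentiableAt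
  have hder : ∀ k y, fderiv ℝ h y (EuclideanSpace.single k 1) = (n - 2 : ℝ) *
      (regPow s (-(n / 2 : ℝ)) (x - y) * (x - y) k - regPow S (-(n / 2 : ℝ)) (x - y) * (x - y) k) := by
    intro k y
    rw [hh, fderiv_fun_sub (hasFDerivAt_regPow hs _ x y).differentiableAt
      (hasFDerivAt_regPow hS0 _ x y).differentiableAt, sub_apply,
      fderiv_regPow_single hs, fderiv_regPow_single hS0, hβ1, hβ]
    ring
  have hh2 : MemLp h 2 volume := by
    refine ((memLp_two_regPow hs (β := n / 2) (by linarith) x).const_mul ((S - s) * β)).mono'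
      hhd.continuous.aestronglyMeasurable (Eventually.of_forall fun y => ?_)
    rw [← hβ1]
    exact abs_regPow_sub_le hs hS (by rw [hβ]; linarith) _
  have hdh2 : ∀ k, MemLp (fun y => fderiv ℝ h y (EuclideanSpace.single k 1)) 2 volume := by
    intro k
    simp_rw [hder]
    exact ((memLp_coord_mul_regPow hn hs x k).sub (memLp_coord_mul_regPow hn hS0 x k)).const_mul _
  have hVk : ∀ k, Differentiable ℝ fun z => V z k := fun k =>
    (EuclideanSpace.proj (𝕜 := ℝ) k).differentiable.comp hV
  have ibp : ∀ k, ∫ y, h y * partialDeriv k (fun z => V z k) y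
      = - ∫ y, fderiv ℝ h y (EuclideanSpace.single k 1) * V y k := fun k =>
    integral_mul_fderiv_eq_neg_fderiv_mul_of_integrable
      ((hdh2 k).integrable_fun_mul (memLp_coord hV2 k)) (hh2.integrable_fun_mul (hdV k))
      (hh2.integrable_fun_mul (memLp_coord hV2 k)) (fun y _ => hhd y) (fun y _ => hVk k y)
  have hsum : ∑ k, ∫ y, fderiv ℝ h y (EuclideanSpace.single k 1) * V y k = 0 := by
    have h0 : ∑ k, ∫ y, h y * partialDeriv k (fun z => V z k) y = 0 := by
      rw [← integral_finsetSum _ fun k _ => hh2.integrable_fun_mul (hdV k)]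
      simp_rw [← Finset.mul_sum, hdiv, mul_zero, integral_zero]
    simp_rw [ibp, Finset.sum_neg_distrib, neg_eq_zero] at h0
    exact h0
  rw [← integral_finsetSum _ fun k _ => (hdh2 k).integrable_fun_mul (memLp_coord hV2 k)] at hsum
  have e : ∀ y, ∑ k, fderiv ℝ h y (EuclideanSpace.single k 1) * V y k = (n - 2 : ℝ) *
      (regPow s (-(n / 2 : ℝ)) (x - y) * inner ℝ (x - y) (V y)
        - regPow S (-(n / 2 : ℝ)) (x - y) * inner ℝ (x - y) (V y)) := by
    intro y
    simp_rw [hder, inner_eq_sum_mul, Finset.mul_sum, ← Finset.sum_sub_distrib, Finset.mul_sum]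
    refine Finset.sum_congr rfl fun k _ => by ring
  simp_rw [e] at hsum
  rw [integral_const_mul, integral_sub (integrable_inner_mul_regPow hn hs x hV2)
    (integrable_inner_mul_regPow hn hS0 x hV2), mul_eq_zero] at hsum
  rcases hsum with h1 | h1
  · linarith
  · exact sub_eq_zero.1 h1

/-- The pairing is independent of the parameter and vanishes as the parameter tends to infinity, by
dominated convergence. -/
theorem integral_regPow_inner_of_divergence_zero {n : ℕ} (hn : 3 ≤ n) {V : Space n → Space n}
    (hV : Differentiable ℝ V) (hV2 : MemLp V 2 volume)
    (hdV : ∀ k, MemLp (fun y => partialDeriv k (fun z => V z k) y) 2 volume)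
    (hdiv : ∀ y, ∑ k, partialDeriv k (fun z => V z k) y = 0) (x : Space n) {s : ℝ} (hs : 0 < s) :
    ∫ y, regPow s (-(n / 2 : ℝ)) (x - y) * inner ℝ (x - y) (V y) = 0 := by
  have hn3 : (3 : ℝ) ≤ n := by exact_mod_cast hn
  have hlim : Tendsto (fun S => ∫ y, regPow S (-(n / 2 : ℝ)) (x - y) * inner ℝ (x - y) (V y)) atTop
      (𝓝 (∫ _ : Space n, (0 : ℝ))) := by
    refine tendsto_integral_filter_of_dominated_convergence
      (fun y => ‖regPow s (-(n / 2 : ℝ)) (x - y) * inner ℝ (x - y) (V y)‖) ?_ ?_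
      (integrable_inner_mul_regPow hn hs x hV2).norm ?_
    · filter_upwards [eventually_gt_atTop 0] with S hS
      exact (integrable_inner_mul_regPow hn hS x hV2).aestronglyMeasurable
    · filter_upwards [eventually_ge_atTop s] with S hS
      refine Eventually.of_forall fun y => ?_
      rw [norm_mul, norm_mul, Real.norm_of_nonneg (regPow_pos hs _ _).le,
        Real.norm_of_nonneg (regPow_pos (hs.trans_le hS) _ _).le]
      gcongr
      exact regPow_anti hs hS (by linarith) _
    · refine Eventually.of_forall fun y => ?_
      have h1 : Tendsto (fun S : ℝ => ‖x - y‖ ^ 2 + S) atTop atTop :=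
        tendsto_atTop_add_const_left _ _ tendsto_id
      have h2 := (tendsto_rpow_neg_atTop (y := (n / 2 : ℝ)) (by linarith)).comp h1
      have h3 := h2.mul_const (inner ℝ (x - y) (V y))
      rw [zero_mul] at h3
      exact h3
  rw [integral_zero] at hlim
  refine tendsto_nhds_unique (tendsto_const_nhds.congr' ?_) hlim
  filter_upwards [eventually_ge_atTop s] with S hS
  exact integral_regPow_inner_eq_of_divergence_zero hn hV hV2 hdV hdiv x hs hS

/-- The divergence of (|z|²+s)^(-n/2) z is n s (|z|²+s)^(-n/2-1), a smooth substitute for a multiple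
of the Dirac mass. All pairings are between L² functions, so there are no boundary terms. -/
theorem integral_regPow_inner_gradient {n : ℕ} (hn : 3 ≤ n) {φ : Space n → ℝ}
    (hφ : Differentiable ℝ φ) (hφ2 : MemLp φ 2 volume)
    (hdφ : ∀ k, MemLp (fun y => partialDeriv k φ y) 2 volume) (x : Space n) {s : ℝ} (hs : 0 < s) :
    ∫ y, regPow s (-(n / 2 : ℝ)) (x - y) *
        inner ℝ (x - y) (WithLp.toLp 2 fun k => partialDeriv k φ y : Space n)
      = ∫ y, n * (s * regPow s (-(n / 2 : ℝ) - 1) (x - y)) * φ y := by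
  have hn3 : (3 : ℝ) ≤ n := by exact_mod_cast hn
  set f : Fin n → Space n → ℝ := fun k y => regPow s (-(n / 2 : ℝ)) (x - y) * (x - y) k with hf
  have hf2 : ∀ k, MemLp (f k) 2 volume := fun k => memLp_coord_mul_regPow hn hs x k
  have hcd : ∀ k y, HasFDerivAt (fun y : Space n => (x - y) k)
      (-(EuclideanSpace.proj (𝕜 := ℝ) k : Space n →L[ℝ] ℝ)) y := by
    intro k y
    exact ((EuclideanSpace.proj (𝕜 := ℝ) k : Space n →L[ℝ] ℝ).hasFDerivAt.comp y
      ((hasFDerivAt_id y).const_sub x)).congr_fderiv (by ext v; simp)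
  have hfd : ∀ k, Differentiable ℝ (f k) := fun k y =>
    ((hasFDerivAt_regPow hs _ x y).mul (hcd k y)).differentiableAt
  have hder : ∀ k y, fderiv ℝ (f k) y (EuclideanSpace.single k 1) =
      n * regPow s (-(n / 2 : ℝ) - 1) (x - y) * (x - y) k ^ 2 - regPow s (-(n / 2 : ℝ)) (x - y) := by
    intro k y
    have h : HasFDerivAt (f k) _ y := (hasFDerivAt_regPow hs (-(n / 2 : ℝ)) x y).mul (hcd k y)
    rw [h.fderiv]
    simp [EuclideanSpace.inner_single_right]
    ring
  have hdf2 : ∀ k, MemLp (fun y => fderiv ℝ (f k) y (EuclideanSpace.single k 1)) 2 volume := by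
    intro k
    refine ((memLp_two_regPow hs (β := n / 2) (by linarith) x).const_mul (n + 1)).mono'
      ?_ (Eventually.of_forall fun y => ?_)
    · exact (measurable_fderiv_apply_const ℝ (f k) _).aestronglyMeasurable
    · rw [hder, Real.norm_eq_abs]
      have h1 := norm_sq_mul_regPow hs (-(n / 2 : ℝ)) (x - y)
      have h2 := regPow_pos hs (-(n / 2 : ℝ)) (x - y)
      have h3 := regPow_pos hs (-(n / 2 : ℝ) - 1) (x - y)
      have h4 : (x - y) k ^ 2 ≤ ‖x - y‖ ^ 2 := by
        rw [← sq_abs]; gcongr; exact abs_coord_le _ _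
      have h5 : regPow s (-(n / 2 : ℝ) - 1) (x - y) * (x - y) k ^ 2
          ≤ regPow s (-(n / 2 : ℝ)) (x - y) := by
        calc _ ≤ regPow s (-(n / 2 : ℝ) - 1) (x - y) * ‖x - y‖ ^ 2 := by gcongr
          _ ≤ _ := by nlinarith
      have h6 : 0 ≤ regPow s (-(n / 2 : ℝ) - 1) (x - y) * (x - y) k ^ 2 := by positivity
      rw [abs_le]
      constructor <;> nlinarith
  have ibp : ∀ k, ∫ y, f k y * partialDeriv k φ y
      = - ∫ y, fderiv ℝ (f k) y (EuclideanSpace.single k 1) * φ y := fun k =>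
    integral_mul_fderiv_eq_neg_fderiv_mul_of_integrable ((hdf2 k).integrable_fun_mul hφ2)
      ((hf2 k).integrable_fun_mul (hdφ k)) ((hf2 k).integrable_fun_mul hφ2)
      (fun y _ => hfd k y) (fun y _ => hφ y)
  have e1 : ∀ y, regPow s (-(n / 2 : ℝ)) (x - y) *
        inner ℝ (x - y) (WithLp.toLp 2 fun k => partialDeriv k φ y : Space n)
      = ∑ k, f k y * partialDeriv k φ y := by
    intro y
    rw [inner_eq_sum_mul, Finset.mul_sum]
    exact Finset.sum_congr rfl fun k _ => by simp [hf]; ring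
  have e2 : ∀ y, ∑ k, fderiv ℝ (f k) y (EuclideanSpace.single k 1) * φ y
      = -(n * (s * regPow s (-(n / 2 : ℝ) - 1) (x - y)) * φ y) := by
    intro y
    have h1 := norm_sq_mul_regPow hs (-(n / 2 : ℝ)) (x - y)
    have h2 : ‖x - y‖ ^ 2 = ∑ k, (x - y) k ^ 2 := by
      rw [EuclideanSpace.norm_sq_eq]; simp
    simp_rw [hder]
    rw [← Finset.sum_mul, Finset.sum_sub_distrib, ← Finset.mul_sum, ← h2, Finset.sum_const,
      Finset.card_univ, Fintype.card_fin, nsmul_eq_mul, mul_assoc (n : ℝ),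
      mul_comm (regPow s _ _) (‖x - y‖ ^ 2), h1]
    ring
  simp_rw [e1]
  rw [integral_finsetSum _ fun k _ => (hf2 k).integrable_fun_mul (hdφ k)]
  simp_rw [ibp]
  rw [Finset.sum_neg_distrib, ← integral_finsetSum _ fun k _ => (hdf2 k).integrable_fun_mul hφ2]
  simp_rw [e2]
  rw [integral_neg, neg_neg]

/-! ### Approximate identity generated by the divergence of the kernel. -/

/-- The normalisation constant of the Newtonian kernel. -/
noncomputable def newtonConst (n : ℕ) : ℝ :=
  ∫ z : Space n, n * regPow 1 (-(n / 2 : ℝ) - 1) z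

theorem integrable_regPow_one {n : ℕ} :
    Integrable fun z : Space n => regPow 1 (-(n / 2 : ℝ) - 1) z := by
  have h := integrable_rpow_neg_one_add_norm_sq (E := Space n) (μ := volume) (r := n + 2) (by simp)
  refine h.congr (Eventually.of_forall fun z => ?_)
  unfold regPow
  dsimp only
  rw [add_comm]
  congr 1; ring

theorem newtonConst_pos {n : ℕ} (hn : 1 ≤ n) : 0 < newtonConst n := by
  unfold newtonConst
  have hn0 : (0 : ℝ) < n := by exact_mod_cast hn
  rw [integral_pos_iff_support_of_nonneg]
  · have : Function.support (fun z : Space n => n * regPow 1 (-(n / 2 : ℝ) - 1) z) = univ := by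
      ext z
      have := regPow_pos one_pos (-(n / 2 : ℝ) - 1) z
      simp [this.ne', hn0.ne']
    rw [this]; exact isOpen_univ.measure_pos _ univ_nonempty
  · intro z
    have := regPow_pos one_pos (-(n / 2 : ℝ) - 1) z
    simp only [Pi.zero_apply]; positivity
  · exact integrable_regPow_one.const_mul _

/-- With s = c^(-2) the divergence of the kernel is the dilate by c of one fixed profile, so that c
→ ∞ is an approximate identity of mass `newtonConst n`. -/
theorem mul_regPow_scaling {n : ℕ} {c : ℝ} (hc : 0 < c) (z : Space n) :
    c⁻¹ ^ 2 * regPow (c⁻¹ ^ 2) (-(n / 2 : ℝ) - 1) z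
      = c ^ n * regPow 1 (-(n / 2 : ℝ) - 1) (c • z) := by
  unfold regPow
  have h1 : ‖c • z‖ ^ 2 + 1 = c ^ 2 * (‖z‖ ^ 2 + c⁻¹ ^ 2) := by
    rw [norm_smul, Real.norm_of_nonneg hc.le]; field_simp
  rw [h1, Real.mul_rpow (by positivity) (by positivity), ← mul_assoc]
  congr 1
  rw [← Real.rpow_natCast c 2, ← Real.rpow_mul hc.le, ← Real.rpow_natCast c n, ← Real.rpow_add hc,
    inv_pow, ← Real.rpow_natCast c 2, ← Real.rpow_neg hc.le]
  congr 1; push_cast; ring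

/-- The concentration theorem requires an integrable function, whereas φ is only in L². It is
therefore applied to φ restricted to the unit ball around x; away from that ball the kernel is
O(c^(-2)) times a fixed L² function. -/
theorem tendsto_integral_regPow_approx {n : ℕ} (hn : 1 ≤ n) {φ : Space n → ℝ} (hφ : Continuous φ)
    (hφ2 : MemLp φ 2 volume) (x : Space n) :
    Tendsto (fun c : ℝ => ∫ y, n * (c⁻¹ ^ 2 * regPow (c⁻¹ ^ 2) (-(n / 2 : ℝ) - 1) (x - y)) * φ y)
      atTop (𝓝 (newtonConst n * φ x)) := by
  have hn0 : (0 : ℝ) < n := by exact_mod_cast hn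
  have hA := newtonConst_pos hn
  set A := newtonConst n with hAdef
  set η : Space n → ℝ := fun z => A⁻¹ * (n * regPow 1 (-(n / 2 : ℝ) - 1) z) with hη
  set B := Metric.closedBall x 1 with hB
  have hBm : MeasurableSet B := Metric.isClosed_closedBall.measurableSet
  have hη0 : ∀ z, 0 ≤ η z := fun z => by
    have := regPow_pos one_pos (-(n / 2 : ℝ) - 1) z
    simp only [hη]; positivity
  have hη1 : ∫ z, η z = 1 := by
    simp only [hη]; rw [integral_const_mul]; exact inv_mul_cancel₀ hA.ne'
  have hηlim : Tendsto (fun z : Space n => ‖z‖ ^ Module.finrank ℝ (Space n) * η z)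
      (Bornology.cobounded (Space n)) (𝓝 0) := by
    have h1 : Tendsto (fun z : Space n => (A⁻¹ * n) * (‖z‖ ^ (2 : ℝ)) ⁻¹)
        (Bornology.cobounded (Space n)) (𝓝 ((A⁻¹ * n) * 0)) :=
      (((tendsto_rpow_atTop (by norm_num)).comp tendsto_norm_cobounded_atTop).inv_tendsto_atTop).const_mul _
    rw [mul_zero] at h1
    refine squeeze_zero' (Eventually.of_forall fun z => mul_nonneg (by positivity) (hη0 z)) ?_ h1
    filter_upwards [tendsto_norm_cobounded_atTop.eventually (eventually_gt_atTop 0)] with z hz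
    rw [finrank_euclideanSpace_fin]
    simp only [hη]
    have h2 : regPow 1 (-(n / 2 : ℝ) - 1) z ≤ (‖z‖ ^ 2) ^ (-(n / 2 : ℝ) - 1) := by
      unfold regPow
      exact Real.rpow_le_rpow_of_nonpos (by positivity) (by linarith) (by linarith)
    have h3 : ‖z‖ ^ n * (‖z‖ ^ 2) ^ (-(n / 2 : ℝ) - 1) = (‖z‖ ^ (2 : ℝ))⁻¹ := by
      rw [← Real.rpow_natCast ‖z‖ 2, ← Real.rpow_mul hz.le, ← Real.rpow_natCast ‖z‖ n,
        ← Real.rpow_add hz, ← Real.rpow_neg hz.le]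
      congr 1; push_cast; ring
    calc _ = (A⁻¹ * n) * (‖z‖ ^ n * regPow 1 (-(n / 2 : ℝ) - 1) z) := by ring
      _ ≤ (A⁻¹ * n) * (‖z‖ ^ n * (‖z‖ ^ 2) ^ (-(n / 2 : ℝ) - 1)) := by gcongr
      _ = _ := by rw [h3]
  have hin : Integrable (B.indicator φ) :=
    (hφ.continuousOn.integrableOn_compact (isCompact_closedBall x 1)).integrable_indicator hBm
  have hcont : ContinuousAt (B.indicator φ) x := by
    refine hφ.continuousAt.congr ?_
    filter_upwards [Metric.closedBall_mem_nhds x one_pos] with y hy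
    rw [indicator_of_mem hy]
  have hnear := (tendsto_integral_comp_smul_smul_of_integrable' hη0 hη1 hηlim hin hcont).const_mul A
  rw [indicator_of_mem (Metric.mem_closedBall_self zero_le_one)] at hnear
  have hker : ∀ c : ℝ, 0 < c → ∀ y,
      n * (c⁻¹ ^ 2 * regPow (c⁻¹ ^ 2) (-(n / 2 : ℝ) - 1) (x - y))
        = A * (c ^ Module.finrank ℝ (Space n) * η (c • (x - y))) := by
    intro c hc y
    rw [mul_regPow_scaling hc, finrank_euclideanSpace_fin]
    simp only [hη]
    field_simp
  -- For |z| ≥ 1 one has |z|² ≥ (|z|²+1)/2, which accounts for the factor 2^(n/2+1) and makes this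
  -- majorant independent of c.
  set K : Space n → ℝ := fun y => n * (2 ^ (n / 2 + 1 : ℝ) * regPow 1 (-(n / 2 : ℝ) - 1) (x - y)) with hK
  have hKi : Integrable fun y => K y * ‖φ y‖ := by
    have h1 : MemLp (fun y => regPow 1 (-(n / 2 + 1 : ℝ)) (x - y)) 2 volume :=
      memLp_two_regPow one_pos (by linarith) x
    have h2 : MemLp K 2 volume := by
      have e : -(n / 2 + 1 : ℝ) = -(n / 2 : ℝ) - 1 := by ring
      rw [e] at h1
      exact (h1.const_mul _).const_mul _
    exact h2.integrable_fun_mul hφ2.norm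
  have hfarbound : ∀ c : ℝ, 0 < c → ∀ y,
      ‖n * (c⁻¹ ^ 2 * regPow (c⁻¹ ^ 2) (-(n / 2 : ℝ) - 1) (x - y)) * Bᶜ.indicator φ y‖
        ≤ c⁻¹ ^ 2 * (K y * ‖φ y‖) := by
    intro c hc y
    have hKy : 0 ≤ K y := by
      have := regPow_pos one_pos (-(n / 2 : ℝ) - 1) (x - y)
      simp only [hK]; positivity
    by_cases hy : y ∈ Bᶜ
    · rw [indicator_of_mem hy, norm_mul]
      have hxy : 1 < ‖x - y‖ := by
        simpa [hB, dist_eq_norm, norm_sub_rev] using hy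
      have hs : 0 < c⁻¹ ^ 2 := by positivity
      have h0 := regPow_pos hs (-(n / 2 : ℝ) - 1) (x - y)
      rw [Real.norm_of_nonneg (by positivity), ← mul_assoc (c⁻¹ ^ 2), mul_left_comm (n : ℝ)]
      simp only [hK]
      gcongr
      unfold regPow
      have e : (2 : ℝ) ^ (n / 2 + 1 : ℝ) = (2⁻¹) ^ (-(n / 2 : ℝ) - 1) := by
        rw [Real.inv_rpow (by norm_num), ← Real.rpow_neg (by norm_num)]; congr 1; ring
      rw [e, ← Real.mul_rpow (by norm_num) (by positivity)]
      refine Real.rpow_le_rpow_of_nonpos (by positivity) ?_ (by linarith)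
      nlinarith
    · rw [indicator_of_notMem hy, mul_zero, norm_zero]; positivity
  have hmeas : ∀ s : ℝ, AEStronglyMeasurable
      (fun y : Space n => n * (s * regPow s (-(n / 2 : ℝ) - 1) (x - y))) volume := fun s =>
    (((measurable_regPow s _).comp (measurable_const_sub x)).const_mul s |>.const_mul _).aestronglyMeasurable
  have hfi : ∀ c : ℝ, 0 < c → Integrable fun y =>
      n * (c⁻¹ ^ 2 * regPow (c⁻¹ ^ 2) (-(n / 2 : ℝ) - 1) (x - y)) * Bᶜ.indicator φ y := fun c hc =>
    (hKi.const_mul (c⁻¹ ^ 2)).mono' ((hmeas _).mul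
      (hφ.aestronglyMeasurable.indicator hBm.compl)) (Eventually.of_forall (hfarbound c hc))
  have hfar : Tendsto (fun c : ℝ => ∫ y,
      n * (c⁻¹ ^ 2 * regPow (c⁻¹ ^ 2) (-(n / 2 : ℝ) - 1) (x - y)) * Bᶜ.indicator φ y) atTop (𝓝 0) := by
    have h1 : Tendsto (fun c : ℝ => c⁻¹ ^ 2 * ∫ y, K y * ‖φ y‖) atTop (𝓝 (0 ^ 2 * ∫ y, K y * ‖φ y‖)) :=
      (tendsto_inv_atTop_zero.pow 2).mul_const _
    rw [zero_pow two_ne_zero, zero_mul] at h1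
    refine squeeze_zero_norm' ?_ h1
    filter_upwards [eventually_gt_atTop 0] with c hc
    rw [← integral_const_mul]
    exact norm_integral_le_of_norm_le (hKi.const_mul _) (Eventually.of_forall (hfarbound c hc))
  have hsum := hnear.add hfar
  rw [add_zero] at hsum
  refine hsum.congr' ?_
  filter_upwards [eventually_gt_atTop 0] with c hc
  have hni : Integrable fun y =>
      n * (c⁻¹ ^ 2 * regPow (c⁻¹ ^ 2) (-(n / 2 : ℝ) - 1) (x - y)) * B.indicator φ y := by
    have hs : 0 < c⁻¹ ^ 2 := by positivity
    have h1 : MemLp (fun y => regPow (c⁻¹ ^ 2) (-(n / 2 + 1 : ℝ)) (x - y)) 2 volume :=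
      memLp_two_regPow hs (by linarith) x
    have e : -(n / 2 + 1 : ℝ) = -(n / 2 : ℝ) - 1 := by ring
    rw [e] at h1
    exact ((h1.const_mul _).const_mul _).integrable_fun_mul (hφ2.indicator hBm)
  rw [← integral_const_mul]
  have : ∀ y, A * ((c ^ Module.finrank ℝ (Space n) * η (c • (x - y))) • B.indicator φ y)
      = n * (c⁻¹ ^ 2 * regPow (c⁻¹ ^ 2) (-(n / 2 : ℝ) - 1) (x - y)) * B.indicator φ y := by
    intro y; rw [hker c hc, smul_eq_mul, mul_assoc A]
  simp_rw [this]
  rw [← integral_add hni (hfi c hc)]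
  congr 1; ext y
  rw [← mul_add, indicator_self_add_compl_apply]

/-! ### Representation by the Newtonian kernel. -/

/-- The Newtonian kernel in divergence form applied to a vector field, that is, the solution of
`Δ ψ = div F` up to sign conventions. -/
noncomputable def newtonConv {n : ℕ} (F : Space n → Space n) (x : Space n) : ℝ :=
  (newtonConst n)⁻¹ * ∫ y, regPow 0 (-(n / 2 : ℝ)) (x - y) * inner ℝ (x - y) (F y)

theorem enorm_regPow_mul_inner_le {n : ℕ} {s : ℝ} (hs : 0 ≤ s) (z w : Space n) :
    ‖regPow s (-(n / 2 : ℝ)) z * inner ℝ z w‖ₑ ≤ ‖z‖ₑ ^ (1 - n : ℝ) * ‖w‖ₑ := by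
  by_cases hz : z = 0
  · simp [hz]
  have hz0 : 0 < ‖z‖ := norm_pos_iff.2 hz
  have h1 : regPow s (-(n / 2 : ℝ)) z * ‖z‖ ≤ ‖z‖ ^ (1 - n : ℝ) := by
    have : regPow s (-(n / 2 : ℝ)) z ≤ ‖z‖ ^ (-n : ℝ) := by
      have e : ‖z‖ ^ (-n : ℝ) = (‖z‖ ^ 2) ^ (-(n / 2 : ℝ)) := by
        rw [← Real.rpow_natCast ‖z‖ 2, ← Real.rpow_mul hz0.le]; congr 1; push_cast; ring
      rw [e]; unfold regPow
      have : (0 : ℝ) ≤ n := by positivity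
      exact Real.rpow_le_rpow_of_nonpos (by positivity) (by linarith) (by linarith)
    calc _ ≤ ‖z‖ ^ (-n : ℝ) * ‖z‖ := by gcongr
      _ = _ := by rw [sub_eq_add_neg, add_comm, Real.rpow_add hz0, Real.rpow_one]
  have h2 : ‖regPow s (-(n / 2 : ℝ)) z * inner ℝ z w‖ ≤ ‖z‖ ^ (1 - n : ℝ) * ‖w‖ := by
    have h0 : 0 ≤ regPow s (-(n / 2 : ℝ)) z := by unfold regPow; positivity
    rw [norm_mul, Real.norm_of_nonneg h0]
    calc _ ≤ regPow s (-(n / 2 : ℝ)) z * (‖z‖ * ‖w‖) := by gcongr; exact norm_inner_le_norm _ _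
      _ = regPow s (-(n / 2 : ℝ)) z * ‖z‖ * ‖w‖ := by ring
      _ ≤ _ := by gcongr
  rw [← ofReal_norm, ← ofReal_norm z, ← ofReal_norm w, ENNReal.ofReal_rpow_of_pos hz0,
    ← ENNReal.ofReal_mul (by positivity)]
  exact ENNReal.ofReal_le_ofReal h2

theorem measurable_regPow_mul_inner {n : ℕ} (s : ℝ) {F : Space n → Space n} (hF : Measurable F) :
    Measurable fun z : Space n × Space n =>
      regPow s (-(n / 2 : ℝ)) (z.1 - z.2) * inner ℝ (z.1 - z.2) (F z.2) :=
  ((measurable_regPow s _).comp (measurable_fst.sub measurable_snd)).mul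
    ((measurable_fst.sub measurable_snd).inner (hF.comp measurable_snd))

theorem aestronglyMeasurable_newtonConv {n : ℕ} {F : Space n → Space n} (hF : Measurable F) :
    AEStronglyMeasurable (newtonConv F) volume := by
  unfold newtonConv
  have h := (measurable_regPow_mul_inner 0 hF).stronglyMeasurable
  exact (h.integral_prod_right (ν := (volume : Measure (Space n)))).aestronglyMeasurable.const_mul _

theorem enorm_integral_regPow_inner_le {n : ℕ} {s : ℝ} (hs : 0 ≤ s) (F : Space n → Space n)
    (x : Space n) : ‖∫ y, regPow s (-(n / 2 : ℝ)) (x - y) * inner ℝ (x - y) (F y)‖ₑ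
      ≤ rieszPotential (fun y => ‖F y‖ₑ) x :=
  (enorm_integral_le_lintegral_enorm _).trans
    (lintegral_mono fun y => enorm_regPow_mul_inner_le hs (x - y) (F y))

theorem integrable_regPow_inner_of_rieszPotential_ne_top {n : ℕ} {s : ℝ} (hs : 0 ≤ s)
    {F : Space n → Space n} (hF : Measurable F) {x : Space n}
    (hx : rieszPotential (fun y => ‖F y‖ₑ) x ≠ ⊤) :
    Integrable fun y => regPow s (-(n / 2 : ℝ)) (x - y) * inner ℝ (x - y) (F y) :=
  ⟨((measurable_regPow_mul_inner s hF).comp measurable_prodMk_left).aestronglyMeasurable,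
    lt_of_le_of_lt (lintegral_mono fun y => enorm_regPow_mul_inner_le hs (x - y) (F y)) hx.lt_top⟩

theorem enorm_newtonConv_le {n : ℕ} (F : Space n → Space n) (x : Space n) :
    ‖newtonConv F x‖ₑ ≤ ‖(newtonConst n)⁻¹‖ₑ * rieszPotential (fun y => ‖F y‖ₑ) x := by
  unfold newtonConv
  rw [enorm_mul]
  gcongr
  exact enorm_integral_regPow_inner_le le_rfl F x

theorem newtonConv_sub {n : ℕ} {F G : Space n → Space n} (hF : Measurable F) (hG : Measurable G)
    {x : Space n} (hFx : rieszPotential (fun y => ‖F y‖ₑ) x ≠ ⊤)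
    (hGx : rieszPotential (fun y => ‖G y‖ₑ) x ≠ ⊤) :
    newtonConv F x - newtonConv G x = newtonConv (fun y => F y - G y) x := by
  unfold newtonConv
  rw [← mul_sub, ← integral_sub (integrable_regPow_inner_of_rieszPotential_ne_top le_rfl hF hFx)
    (integrable_regPow_inner_of_rieszPotential_ne_top le_rfl hG hGx)]
  congr 2; ext y; rw [inner_sub_right]; ring

/-- Pair the kernel with ∇φ = V + F: the term with V vanishes by incompressibility, and the pairing
with ∇φ tends to a multiple of φ by the approximate identity. -/
theorem tendsto_integral_regPow_inner {n : ℕ} (hn : 3 ≤ n) {φ : Space n → ℝ}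
    {V F : Space n → Space n}
    (hφ : Differentiable ℝ φ) (hφ2 : MemLp φ 2 volume)
    (hdφ : ∀ k, MemLp (fun y => partialDeriv k φ y) 2 volume)
    (hV : Differentiable ℝ V) (hV2 : MemLp V 2 volume)
    (hdV : ∀ k, MemLp (fun y => partialDeriv k (fun z => V z k) y) 2 volume)
    (hdiv : ∀ y, ∑ k, partialDeriv k (fun z => V z k) y = 0)
    (hF2 : MemLp F 2 volume)
    (hF : ∀ y k, partialDeriv k φ y = V y k + F y k) (x : Space n) :
    Tendsto (fun c : ℝ => ∫ y, regPow (c⁻¹ ^ 2) (-(n / 2 : ℝ)) (x - y) * inner ℝ (x - y) (F y))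
      atTop (𝓝 (newtonConst n * φ x)) := by
  refine (tendsto_integral_regPow_approx (by omega) hφ.continuous hφ2 x).congr' ?_
  filter_upwards [eventually_gt_atTop 0] with c hc
  have hs : 0 < c⁻¹ ^ 2 := by positivity
  rw [← integral_regPow_inner_gradient hn hφ hφ2 hdφ x hs]
  have e : ∀ y, (WithLp.toLp 2 fun k => partialDeriv k φ y : Space n) = V y + F y := fun y => by
    ext k; simp [hF]
  simp_rw [e, inner_add_right, mul_add]
  rw [integral_add (integrable_inner_mul_regPow hn hs x hV2)
    (integrable_inner_mul_regPow hn hs x hF2),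
    integral_regPow_inner_of_divergence_zero hn hV hV2 hdV hdiv x hs, zero_add]

/-- Only the contribution of G has to converge as the regularisation is removed, which is why
finiteness of its Riesz potential at x is required. The contribution of F is bounded uniformly in
the parameter by its Riesz potential, and that bound survives the limit even when it is infinite. -/
theorem enorm_sub_newtonConv_le {n : ℕ} (hn : 3 ≤ n) {φ : Space n → ℝ}
    {V F G : Space n → Space n}
    (hφ : Differentiable ℝ φ) (hφ2 : MemLp φ 2 volume)
    (hdφ : ∀ k, MemLp (fun y => partialDeriv k φ y) 2 volume)
    (hV : Differentiable ℝ V) (hV2 : MemLp V 2 volume)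
    (hdV : ∀ k, MemLp (fun y => partialDeriv k (fun z => V z k) y) 2 volume)
    (hdiv : ∀ y, ∑ k, partialDeriv k (fun z => V z k) y = 0)
    (hF2 : MemLp F 2 volume) (hG2 : MemLp G 2 volume) (hGm : Measurable G)
    (hF : ∀ y k, partialDeriv k φ y = V y k + (F y k + G y k)) {x : Space n}
    (hx : rieszPotential (fun y => ‖G y‖ₑ) x ≠ ⊤) :
    ‖φ x - newtonConv G x‖ₑ
      ≤ ‖(newtonConst n)⁻¹‖ₑ * rieszPotential (fun y => ‖F y‖ₑ) x := by
  have hA := newtonConst_pos (show 1 ≤ n by omega)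
  have hn0 : (0 : ℝ) ≤ n := by positivity
  have h1 := tendsto_integral_regPow_inner hn hφ hφ2 hdφ hV hV2 hdV hdiv (hF2.add hG2)
    (fun y k => by simpa using hF y k) x
  have h2 : Tendsto (fun c : ℝ => ∫ y, regPow (c⁻¹ ^ 2) (-(n / 2 : ℝ)) (x - y) *
      inner ℝ (x - y) (G y)) atTop
      (𝓝 (∫ y, regPow 0 (-(n / 2 : ℝ)) (x - y) * inner ℝ (x - y) (G y))) := by
    have hm : Measurable fun y => ‖x - y‖ₑ ^ (1 - n : ℝ) * ‖G y‖ₑ := by fun_prop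
    have hxi : ∫⁻ y, ‖x - y‖ₑ ^ (1 - n : ℝ) * ‖G y‖ₑ ≠ ⊤ := hx
    refine tendsto_integral_filter_of_dominated_convergence
      (fun y => (‖x - y‖ₑ ^ (1 - n : ℝ) * ‖G y‖ₑ).toReal) ?_ ?_
      (integrable_toReal_of_lintegral_ne_top hm.aemeasurable hxi) ?_
    · exact Eventually.of_forall fun c =>
        (integrable_regPow_inner_of_rieszPotential_ne_top (sq_nonneg _) hGm hx).aestronglyMeasurable
    · refine Eventually.of_forall fun c => ?_
      filter_upwards [ae_lt_top hm hxi] with y hy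
      rw [← toReal_enorm]
      exact ENNReal.toReal_mono hy.ne (enorm_regPow_mul_inner_le (sq_nonneg _) _ _)
    · refine Eventually.of_forall fun y => ?_
      by_cases hy : x - y = 0
      · simp [hy]
      have hc : Tendsto (fun c : ℝ => ‖x - y‖ ^ 2 + c⁻¹ ^ 2) atTop (𝓝 (‖x - y‖ ^ 2 + 0 ^ 2)) :=
        (tendsto_inv_atTop_zero.pow 2).const_add _
      rw [zero_pow two_ne_zero] at hc
      have hne : ‖x - y‖ ^ 2 + 0 ≠ 0 := by
        have : 0 < ‖x - y‖ := norm_pos_iff.2 hy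
        positivity
      exact (hc.rpow_const (Or.inl hne)).mul_const _
  have h3 := (h1.sub h2).enorm
  have h4 : ‖newtonConst n * φ x - ∫ y, regPow 0 (-(n / 2 : ℝ)) (x - y) * inner ℝ (x - y) (G y)‖ₑ
      ≤ rieszPotential (fun y => ‖F y‖ₑ) x := by
    refine le_of_tendsto h3 ?_
    filter_upwards [eventually_gt_atTop 0] with c hc
    have hs : 0 < c⁻¹ ^ 2 := by positivity
    rw [← integral_sub (integrable_inner_mul_regPow hn hs x (hF2.add hG2))
      (integrable_inner_mul_regPow hn hs x hG2)]
    have e : ∀ y, regPow (c⁻¹ ^ 2) (-(n / 2 : ℝ)) (x - y) * inner ℝ (x - y) ((F + G) y)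
        - regPow (c⁻¹ ^ 2) (-(n / 2 : ℝ)) (x - y) * inner ℝ (x - y) (G y)
        = regPow (c⁻¹ ^ 2) (-(n / 2 : ℝ)) (x - y) * inner ℝ (x - y) (F y) := by
      intro y; rw [Pi.add_apply, inner_add_right]; ring
    simp_rw [e]
    exact enorm_integral_regPow_inner_le hs.le F x
  have h5 : φ x - newtonConv G x = (newtonConst n)⁻¹ * (newtonConst n * φ x
      - ∫ y, regPow 0 (-(n / 2 : ℝ)) (x - y) * inner ℝ (x - y) (G y)) := by
    unfold newtonConv; field_simp
  rw [h5, enorm_mul]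
  gcongr

theorem enorm_le_rieszPotential {n : ℕ} (hn : 3 ≤ n) {φ : Space n → ℝ} {V F : Space n → Space n}
    (hφ : Differentiable ℝ φ) (hφ2 : MemLp φ 2 volume)
    (hdφ : ∀ k, MemLp (fun y => partialDeriv k φ y) 2 volume)
    (hV : Differentiable ℝ V) (hV2 : MemLp V 2 volume)
    (hdV : ∀ k, MemLp (fun y => partialDeriv k (fun z => V z k) y) 2 volume)
    (hdiv : ∀ y, ∑ k, partialDeriv k (fun z => V z k) y = 0)
    (hF2 : MemLp F 2 volume) (hF : ∀ y k, partialDeriv k φ y = V y k + F y k) (x : Space n) :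
    ‖φ x‖ₑ ≤ ‖(newtonConst n)⁻¹‖ₑ * rieszPotential (fun y => ‖F y‖ₑ) x := by
  have h := enorm_sub_newtonConv_le hn (G := fun _ => 0) hφ hφ2 hdφ hV hV2 hdV hdiv hF2
    (MemLp.zero') measurable_const (fun y k => by simpa using hF y k) (x := x)
    (by simp [rieszPotential])
  simpa [newtonConv] using h

/-- Formulated for any φ dominated by the potential, since it serves both `newtonConv F` itself and
the connection coefficients, which are only estimated and not written as convolutions. -/
theorem exists_eLpNorm_newtonConv_le {n : ℕ} (hn : 2 ≤ n) {p q : ℝ} (hp : 1 < p)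
    (hpn : p < n) (hq : 0 < q) (hpq : q⁻¹ = p⁻¹ - (n : ℝ)⁻¹) :
    ∃ C : ℝ≥0, ∀ F : Space n → Space n, Measurable F → ∀ φ : Space n → ℝ,
      (∀ᵐ x, ‖φ x‖ₑ ≤ ‖(newtonConst n)⁻¹‖ₑ * rieszPotential (fun y => ‖F y‖ₑ) x) →
      eLpNorm φ (ENNReal.ofReal q) volume ≤ C * eLpNorm F (ENNReal.ofReal p) volume := by
  obtain ⟨C, hC⟩ := exists_eLpNorm_rieszPotential_le hn hp hpn hq hpq
  refine ⟨‖(newtonConst n)⁻¹‖₊ * C, fun F hF φ hφ => ?_⟩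
  have h1 := hC (fun y => ‖F y‖ₑ) hF.enorm
  have h2 : eLpNorm φ (ENNReal.ofReal q) volume
      ≤ ‖(newtonConst n)⁻¹‖₊ • eLpNorm (rieszPotential fun y => ‖F y‖ₑ) (ENNReal.ofReal q) volume := by
    refine eLpNorm_le_nnreal_smul_eLpNorm_of_ae_le_mul' ?_ _
    filter_upwards [hφ] with x hx
    exact hx
  refine h2.trans ?_
  rw [ENNReal.smul_def, smul_eq_mul, ENNReal.coe_mul, mul_assoc]
  gcongr
  rwa [eLpNorm_enorm] at h1

/-- Supplies the almost everywhere absolute convergence on which linearity of `newtonConv` and the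
splitting of a_0 depend. -/
theorem ae_rieszPotential_ne_top {n : ℕ} (hn : 2 ≤ n) {p q : ℝ} (hp : 1 < p)
    (hpn : p < n) (hq : 0 < q) (hpq : q⁻¹ = p⁻¹ - (n : ℝ)⁻¹) {F : Space n → Space n}
    (hFm : Measurable F) (hF : MemLp F (ENNReal.ofReal p) volume) :
    ∀ᵐ x, rieszPotential (fun y => ‖F y‖ₑ) x ≠ ⊤ := by
  obtain ⟨C, hC⟩ := exists_eLpNorm_rieszPotential_le hn hp hpn hq hpq
  have h1 := hC (fun y => ‖F y‖ₑ) hFm.enorm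
  rw [eLpNorm_enorm] at h1
  have h2 : eLpNorm (rieszPotential fun y => ‖F y‖ₑ) (ENNReal.ofReal q) volume < ⊤ :=
    h1.trans_lt (ENNReal.mul_lt_top ENNReal.coe_lt_top hF.2)
  have h3 := lintegral_rpow_enorm_lt_top_of_eLpNorm_lt_top (by simpa using hq)
    ENNReal.ofReal_ne_top h2
  rw [ENNReal.toReal_ofReal hq.le] at h3
  have hm := measurable_rieszPotential (f := fun y => ‖F y‖ₑ) hFm.enorm
  filter_upwards [ae_lt_top (by fun_prop) h3.ne] with x hx htop
  rw [htop] at hx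
  simp [hq] at hx

/-! ### Calculus of continuous curves in L^p. -/

section ContInLp

variable {n : ℕ} {E F G : Type*} [NormedAddCommGroup E]
  [NormedAddCommGroup F] [NormedAddCommGroup G]

theorem ContInLp.congr {T : ℝ} {p : ℝ≥0∞} {f g : ℝ → Space n → F} (hf : ContInLp T p f)
    (h : ∀ t ∈ Icc 0 T, ∀ᵐ x, f t x = g t x) : ContInLp T p g := by
  refine ⟨fun t ht => (hf.1 t ht).ae_eq (h t ht), fun t₀ ht₀ => (hf.2 t₀ ht₀).congr' ?_⟩
  filter_upwards [self_mem_nhdsWithin] with t ht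
  refine eLpNorm_congr_ae ?_
  filter_upwards [h t ht, h t₀ ht₀] with x hx hx0
  rw [hx, hx0]

theorem ContInLp.clm [NormedSpace ℝ F] [NormedSpace ℝ G] {T : ℝ} {p : ℝ≥0∞} {f : ℝ → Space n → F} (hf : ContInLp T p f)
    (L : F →L[ℝ] G) : ContInLp T p fun t x => L (f t x) := by
  refine ⟨fun t ht => L.comp_memLp' (hf.1 t ht), fun t₀ ht₀ => ?_⟩
  have h1 := ENNReal.Tendsto.const_mul (a := (‖L‖₊ : ℝ≥0∞)) (hf.2 t₀ ht₀) (Or.inr ENNReal.coe_ne_top)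
  rw [mul_zero] at h1
  refine tendsto_of_tendsto_of_tendsto_of_le_of_le tendsto_const_nhds h1 (fun _ => zero_le) fun t => ?_
  refine (eLpNorm_le_nnreal_smul_eLpNorm_of_ae_le_mul (g := fun x => f t x - f t₀ x) (c := ‖L‖₊)
    (Eventually.of_forall fun x => ?_) p).trans_eq (ENNReal.smul_def _ _)
  rw [← map_sub]; exact L.le_opNNNorm _

theorem ContInLp.add {T : ℝ} {p : ℝ≥0∞} (hp : 1 ≤ p) {f g : ℝ → Space n → F}
    (hf : ContInLp T p f) (hg : ContInLp T p g) : ContInLp T p fun t x => f t x + g t x := by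
  refine ⟨fun t ht => (hf.1 t ht).add (hg.1 t ht), fun t₀ ht₀ => ?_⟩
  have h1 := (hf.2 t₀ ht₀).add (hg.2 t₀ ht₀)
  rw [add_zero] at h1
  refine tendsto_of_tendsto_of_tendsto_of_le_of_le' tendsto_const_nhds h1
    (Eventually.of_forall fun _ => zero_le) ?_
  filter_upwards [self_mem_nhdsWithin] with t ht
  have e : (fun x => f t x + g t x - (f t₀ x + g t₀ x))
      = (fun x => f t x - f t₀ x) + fun x => g t x - g t₀ x := by
    ext x; simp only [Pi.add_apply]; abel
  rw [e]
  exact eLpNorm_add_le ((hf.1 t ht).sub (hf.1 t₀ ht₀)).1 ((hg.1 t ht).sub (hg.1 t₀ ht₀)).1 hp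

theorem ContInLp.sum {T : ℝ} {p : ℝ≥0∞} (hp : 1 ≤ p) {ι : Type*} (s : Finset ι)
    {f : ι → ℝ → Space n → F} (hf : ∀ i ∈ s, ContInLp T p (f i)) :
    ContInLp T p fun t x => ∑ i ∈ s, f i t x := by
  classical
  induction s using Finset.induction_on with
  | empty =>
    refine ⟨fun t _ => by simp, fun t₀ _ => ?_⟩
    simp only [Finset.sum_empty, sub_self, eLpNorm_zero']
    exact tendsto_const_nhds
  | insert a s ha ih =>
    simp_rw [Finset.sum_insert ha]
    exact (hf a (Finset.mem_insert_self a s)).add hp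
      (ih fun i hi => hf i (Finset.mem_insert_of_mem hi))

/-- Hölder applied to the three terms of the increment: both factors varying, and each factor
varying with the other frozen at t₀. -/
theorem ContInLp.bilin [NormedSpace ℝ E] [NormedSpace ℝ F] [NormedSpace ℝ G]
    {T : ℝ} {p q r : ℝ≥0∞} [ENNReal.HolderTriple p q r] (hr : 1 ≤ r)
    {f : ℝ → Space n → E} {g : ℝ → Space n → F} (hf : ContInLp T p f) (hg : ContInLp T q g)
    (B : E →L[ℝ] F →L[ℝ] G) : ContInLp T r fun t x => B (f t x) (g t x) := by
  have hB : ∀ x y, ‖B x y‖₊ ≤ ‖B‖₊ * ‖x‖₊ * ‖y‖₊ := fun x y => B.le_opNorm₂ x y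
  have hmeas : ∀ {u : Space n → E} {v : Space n → F}, AEStronglyMeasurable u volume →
      AEStronglyMeasurable v volume → AEStronglyMeasurable (fun x => B (u x) (v x)) volume :=
    fun hu hv => B.aestronglyMeasurable_comp₂ hu hv
  refine ⟨fun t ht => MemLp.of_bilin (fun x y => B x y) ‖B‖₊ (hf.1 t ht) (hg.1 t ht)
    (hmeas (hf.1 t ht).1 (hg.1 t ht).1) (Eventually.of_forall fun x => hB _ _), fun t₀ ht₀ => ?_⟩
  have hlim : Tendsto (fun t =>
      ‖B‖₊ * eLpNorm (fun x => f t x - f t₀ x) p volume * eLpNorm (fun x => g t x - g t₀ x) q volume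
      + ‖B‖₊ * eLpNorm (fun x => f t x - f t₀ x) p volume * eLpNorm (g t₀) q volume
      + ‖B‖₊ * eLpNorm (f t₀) p volume * eLpNorm (fun x => g t x - g t₀ x) q volume)
      (𝓝[Icc 0 T] t₀) (𝓝 0) := by
    have h1 := ENNReal.Tendsto.const_mul (a := (‖B‖₊ : ℝ≥0∞)) (hf.2 t₀ ht₀) (Or.inr ENNReal.coe_ne_top)
    have h2 := hg.2 t₀ ht₀
    rw [mul_zero] at h1
    have h3 := ENNReal.Tendsto.mul h1 (Or.inr (by simp)) h2 (Or.inr (by simp))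
    have h4 := ENNReal.Tendsto.mul_const (b := eLpNorm (g t₀) q volume) h1 (Or.inr (hg.1 t₀ ht₀).2.ne)
    have h5 := ENNReal.Tendsto.const_mul (a := ‖B‖₊ * eLpNorm (f t₀) p volume) h2
      (Or.inr (ENNReal.mul_ne_top ENNReal.coe_ne_top (hf.1 t₀ ht₀).2.ne))
    simpa using (h3.add h4).add h5
  refine tendsto_of_tendsto_of_tendsto_of_le_of_le' tendsto_const_nhds hlim
    (Eventually.of_forall fun _ => zero_le) ?_
  filter_upwards [self_mem_nhdsWithin] with t ht
  have e : (fun x => B (f t x) (g t x) - B (f t₀ x) (g t₀ x))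
      = ((fun x => B (f t x - f t₀ x) (g t x - g t₀ x)) + fun x => B (f t x - f t₀ x) (g t₀ x))
        + fun x => B (f t₀ x) (g t x - g t₀ x) := by
    ext x; simp only [Pi.add_apply, map_sub, sub_apply]; abel
  have hfd := ((hf.1 t ht).sub (hf.1 t₀ ht₀)).1
  have hgd := ((hg.1 t ht).sub (hg.1 t₀ ht₀)).1
  have hf0 := (hf.1 t₀ ht₀).1
  have hg0 := (hg.1 t₀ ht₀).1
  rw [e]
  refine (eLpNorm_add_le ((hmeas hfd hgd).add (hmeas hfd hg0)) (hmeas hf0 hgd) hr).trans ?_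
  gcongr
  · refine (eLpNorm_add_le (hmeas hfd hgd) (hmeas hfd hg0) hr).trans ?_
    gcongr
    · exact eLpNorm_le_eLpNorm_mul_eLpNorm_of_nnnorm hfd hgd (fun x y => B x y) _
        (Eventually.of_forall fun x => hB _ _)
    · exact eLpNorm_le_eLpNorm_mul_eLpNorm_of_nnnorm hfd hg0 (fun x y => B x y) _
        (Eventually.of_forall fun x => hB _ _)
  · exact eLpNorm_le_eLpNorm_mul_eLpNorm_of_nnnorm hf0 hgd (fun x y => B x y) _
        (Eventually.of_forall fun x => hB _ _)

theorem eLpNorm_ofReal_rpow {f : Space n → F} {p : ℝ} (hp : 0 < p) :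
    eLpNorm f (ENNReal.ofReal p) volume ^ p = ∫⁻ x, ‖f x‖ₑ ^ p := by
  rw [eLpNorm_eq_lintegral_rpow_enorm_toReal (by simpa using hp) ENNReal.ofReal_ne_top,
    ENNReal.toReal_ofReal hp.le, ← ENNReal.rpow_mul, one_div_mul_cancel hp.ne', ENNReal.rpow_one]

theorem tendsto_eLpNorm_zero_iff {ι : Type*} {l : Filter ι} {f : ι → Space n → F} {p : ℝ}
    (hp : 0 < p) : Tendsto (fun i => eLpNorm (f i) (ENNReal.ofReal p) volume) l (𝓝 0) ↔
      Tendsto (fun i => ∫⁻ x, ‖f i x‖ₑ ^ p) l (𝓝 0) := by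
  constructor
  · intro h
    have := (ENNReal.continuous_rpow_const (y := p)).continuousAt.tendsto.comp h
    rw [ENNReal.zero_rpow_of_pos hp] at this
    exact this.congr fun i => eLpNorm_ofReal_rpow hp
  · intro h
    have := (ENNReal.continuous_rpow_const (y := p⁻¹)).continuousAt.tendsto.comp h
    rw [ENNReal.zero_rpow_of_pos (inv_pos.2 hp)] at this
    refine this.congr fun i => ?_
    rw [Function.comp_apply, ← eLpNorm_ofReal_rpow hp, ← ENNReal.rpow_mul, mul_inv_cancel₀ hp.ne',
      ENNReal.rpow_one]

/-- Meant for products with the frame vectors, which are unit vectors and so belong to no L^p with p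
< ∞. Their pointwise continuity in time suffices, by dominated convergence with f(t₀) providing the
majorant. -/
theorem ContInLp.bilin_bdd [NormedSpace ℝ E] [NormedSpace ℝ F] [NormedSpace ℝ G]
    {T p : ℝ} (hp : 1 ≤ p)
    {f : ℝ → Space n → E} {g : ℝ → Space n → F} (hf : ContInLp T (ENNReal.ofReal p) f)
    (hgm : ∀ t ∈ Icc 0 T, AEStronglyMeasurable (g t) volume)
    (hg1 : ∀ t ∈ Icc 0 T, ∀ x, ‖g t x‖ ≤ 1)
    (hgc : ∀ x, ContinuousOn (fun t => g t x) (Icc 0 T))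
    (B : E →L[ℝ] F →L[ℝ] G) : ContInLp T (ENNReal.ofReal p) fun t x => B (f t x) (g t x) := by
  have hp0 : 0 < p := by linarith
  have hp1 : 1 ≤ ENNReal.ofReal p := by simpa using hp
  have hB : ∀ x y, ‖B x y‖₊ ≤ ‖B‖₊ * ‖x‖₊ * ‖y‖₊ := fun x y => B.le_opNorm₂ x y
  have hB1 : ∀ t ∈ Icc 0 T, ∀ (v : E) x, ‖B v (g t x)‖₊ ≤ ‖B‖₊ * ‖v‖₊ := fun t ht v x =>
    (hB _ _).trans (mul_le_of_le_one_right' (hg1 t ht x))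
  have hmeas : ∀ {u : Space n → E} {v : Space n → F}, AEStronglyMeasurable u volume →
      AEStronglyMeasurable v volume → AEStronglyMeasurable (fun x => B (u x) (v x)) volume :=
    fun hu hv => B.aestronglyMeasurable_comp₂ hu hv
  refine ⟨fun t ht => (hf.1 t ht).of_le_mul (c := ‖B‖) (hmeas (hf.1 t ht).1 (hgm t ht))
    (Eventually.of_forall fun x => hB1 t ht _ x), fun t₀ ht₀ => ?_⟩
  have hlim1 := ENNReal.Tendsto.const_mul (a := (‖B‖₊ : ℝ≥0∞)) (hf.2 t₀ ht₀)
    (Or.inr ENNReal.coe_ne_top)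
  rw [mul_zero] at hlim1
  have hlim2 : Tendsto (fun t => eLpNorm (fun x => B (f t₀ x) (g t x - g t₀ x))
      (ENNReal.ofReal p) volume) (𝓝[Icc 0 T] t₀) (𝓝 0) := by
    rw [tendsto_eLpNorm_zero_iff hp0]
    have hz : ∫⁻ _ : Space n, (0 : ℝ≥0∞) = 0 := by simp
    rw [← hz]
    refine tendsto_lintegral_filter_of_dominated_convergence'
      (fun x => (‖(2 * ‖B‖) • f t₀ x‖ₑ) ^ p) ?_ ?_ ?_ ?_
    · filter_upwards [self_mem_nhdsWithin] with t ht
      exact ((hmeas (hf.1 t₀ ht₀).1 ((hgm t ht).sub (hgm t₀ ht₀))).enorm.pow_const p)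
    · filter_upwards [self_mem_nhdsWithin] with t ht
      refine Eventually.of_forall fun x => ?_
      gcongr
      rw [← ofReal_norm, ← ofReal_norm]
      refine ENNReal.ofReal_le_ofReal ?_
      have h1 := B.le_opNorm₂ (f t₀ x) (g t x - g t₀ x)
      have h2 : ‖g t x - g t₀ x‖ ≤ 2 := (norm_sub_le _ _).trans
        (by linarith [hg1 t ht x, hg1 t₀ ht₀ x])
      rw [norm_smul, Real.norm_of_nonneg (by positivity)]
      calc _ ≤ ‖B‖ * ‖f t₀ x‖ * ‖g t x - g t₀ x‖ := h1
        _ ≤ ‖B‖ * ‖f t₀ x‖ * 2 := by gcongr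
        _ = _ := by ring
    · have := ((hf.1 t₀ ht₀).const_smul (2 * ‖B‖))
      rw [← eLpNorm_ofReal_rpow (f := fun x => (2 * ‖B‖) • f t₀ x) hp0]
      exact (ENNReal.rpow_lt_top_of_nonneg hp0.le this.2.ne).ne
    · refine Eventually.of_forall fun x => ?_
      have h1 : Tendsto (fun t => g t x - g t₀ x) (𝓝[Icc 0 T] t₀) (𝓝 0) := by
        have := (hgc x t₀ ht₀).tendsto.sub_const (g t₀ x)
        rwa [sub_self] at this
      have h2 := ((B (f t₀ x)).continuous.tendsto 0).comp h1
      rw [map_zero] at h2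
      have h3 := (ENNReal.continuous_rpow_const (y := p)).continuousAt.tendsto.comp h2.enorm
      rw [enorm_zero, ENNReal.zero_rpow_of_pos hp0] at h3
      exact h3
  have hlim := hlim1.add hlim2
  rw [add_zero] at hlim
  refine tendsto_of_tendsto_of_tendsto_of_le_of_le' tendsto_const_nhds hlim
    (Eventually.of_forall fun _ => zero_le) ?_
  filter_upwards [self_mem_nhdsWithin] with t ht
  have e : (fun x => B (f t x) (g t x) - B (f t₀ x) (g t₀ x))
      = (fun x => B (f t x - f t₀ x) (g t x)) + fun x => B (f t₀ x) (g t x - g t₀ x) := by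
    ext x; simp only [Pi.add_apply, map_sub, sub_apply]; abel
  have hfd := ((hf.1 t ht).sub (hf.1 t₀ ht₀)).1
  have hf0 := (hf.1 t₀ ht₀).1
  rw [e]
  refine (eLpNorm_add_le (hmeas hfd (hgm t ht))
    (hmeas hf0 ((hgm t ht).sub (hgm t₀ ht₀))) hp1).trans ?_
  refine add_le_add ?_ le_rfl
  exact (eLpNorm_le_nnreal_smul_eLpNorm_of_ae_le_mul (g := fun x => f t x - f t₀ x) (c := ‖B‖₊)
    (Eventually.of_forall fun x => hB1 t ht _ x) _).trans_eq (ENNReal.smul_def _ _)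

/-- Pointwise, |f|^r is at most |f|^a where |f| ≤ 1 and at most |f|^b elsewhere. -/
theorem lintegral_enorm_rpow_interpolate {a r b : ℝ} (har : a ≤ r) (hrb : r ≤ b)
    {f : Space n → F} (hf : AEStronglyMeasurable f volume) :
    ∫⁻ x, ‖f x‖ₑ ^ r ≤ (∫⁻ x, ‖f x‖ₑ ^ a) + ∫⁻ x, ‖f x‖ₑ ^ b := by
  rw [← lintegral_add_left' (hf.enorm.pow_const a)]
  refine lintegral_mono fun x => ?_
  rcases le_total ‖f x‖ₑ 1 with h | h
  · exact (ENNReal.rpow_le_rpow_of_exponent_ge h har).trans le_self_add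
  · exact (ENNReal.rpow_le_rpow_of_exponent_le h hrb).trans le_add_self

theorem ContInLp.interpolate {T a r b : ℝ} (ha : 0 < a) (har : a ≤ r) (hrb : r ≤ b)
    {f : ℝ → Space n → F} (hfa : ContInLp T (ENNReal.ofReal a) f)
    (hfb : ContInLp T (ENNReal.ofReal b) f) : ContInLp T (ENNReal.ofReal r) f := by
  have hr : 0 < r := by linarith
  have hb : 0 < b := by linarith
  refine ⟨fun t ht => ⟨(hfa.1 t ht).1, ?_⟩, fun t₀ ht₀ => ?_⟩
  · have h1 := lintegral_enorm_rpow_interpolate har hrb (hfa.1 t ht).1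
    rw [← eLpNorm_ofReal_rpow ha, ← eLpNorm_ofReal_rpow hb, ← eLpNorm_ofReal_rpow hr] at h1
    have h2 := h1.trans_lt (ENNReal.add_lt_top.2
      ⟨ENNReal.rpow_lt_top_of_nonneg ha.le (hfa.1 t ht).2.ne,
        ENNReal.rpow_lt_top_of_nonneg hb.le (hfb.1 t ht).2.ne⟩)
    rw [lt_top_iff_ne_top] at h2 ⊢
    intro h3
    rw [h3, ENNReal.top_rpow_of_pos hr] at h2
    exact h2 rfl
  · have h1 := hfa.2 t₀ ht₀
    have h2 := hfb.2 t₀ ht₀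
    rw [tendsto_eLpNorm_zero_iff ha] at h1
    rw [tendsto_eLpNorm_zero_iff hb] at h2
    rw [tendsto_eLpNorm_zero_iff hr]
    have h3 := h1.add h2
    rw [add_zero] at h3
    refine tendsto_of_tendsto_of_tendsto_of_le_of_le' tendsto_const_nhds h3
      (Eventually.of_forall fun _ => zero_le) ?_
    filter_upwards [self_mem_nhdsWithin] with t ht
    exact lintegral_enorm_rpow_interpolate har hrb ((hfa.1 t ht).sub (hfa.1 t₀ ht₀)).1

theorem ContInLp.tendsto_eLpNorm {T : ℝ} {p : ℝ≥0∞} (hp : 1 ≤ p) {f : ℝ → Space n → F}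
    (hf : ContInLp T p f) {t₀ : ℝ} (ht₀ : t₀ ∈ Icc 0 T) :
    Tendsto (fun t => eLpNorm (f t) p volume) (𝓝[Icc 0 T] t₀) (𝓝 (eLpNorm (f t₀) p volume)) := by
  have h := hf.2 t₀ ht₀
  have hfin := (hf.1 t₀ ht₀).2.ne
  have hub : Tendsto (fun t => eLpNorm (f t₀) p volume + eLpNorm (fun x => f t x - f t₀ x) p volume)
      (𝓝[Icc 0 T] t₀) (𝓝 (eLpNorm (f t₀) p volume)) := by
    simpa using h.const_add (eLpNorm (f t₀) p volume)
  have hlb : Tendsto (fun t => eLpNorm (f t₀) p volume - eLpNorm (fun x => f t x - f t₀ x) p volume)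
      (𝓝[Icc 0 T] t₀) (𝓝 (eLpNorm (f t₀) p volume)) := by
    have := ENNReal.Tendsto.sub (tendsto_const_nhds (x := eLpNorm (f t₀) p volume)) h (Or.inl hfin)
    simpa using this
  refine tendsto_of_tendsto_of_tendsto_of_le_of_le' hlb hub ?_ ?_
  · filter_upwards [self_mem_nhdsWithin] with t ht
    rw [tsub_le_iff_right]
    have e : f t₀ = f t - fun x => f t x - f t₀ x := by ext x; simp
    conv_lhs => rw [e]
    exact eLpNorm_sub_le (hf.1 t ht).1 ((hf.1 t ht).sub (hf.1 t₀ ht₀)).1 hp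
  · filter_upwards [self_mem_nhdsWithin] with t ht
    have e : f t = f t₀ + fun x => f t x - f t₀ x := by ext x; simp
    conv_lhs => rw [e]
    exact eLpNorm_add_le (hf.1 t₀ ht₀).1 ((hf.1 t ht).sub (hf.1 t₀ ht₀)).1 hp

end ContInLp

/-! ### Sobolev embedding of H^∞ into L^r for 2 ≤ r < ∞. -/

/-- Dilates of one bump function, stretched by j + 1 ≥ 1, so the gradient bound of the original bump
is inherited by all of them. -/
theorem exists_smooth_cutoff (n : ℕ) : ∃ χ : ℕ → Space n → ℝ, ∃ M : ℝ≥0,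
    (∀ j, ContDiff ℝ 1 (χ j)) ∧ (∀ j, HasCompactSupport (χ j)) ∧ (∀ j x, ‖χ j x‖ ≤ 1) ∧
    (∀ j x, ‖fderiv ℝ (χ j) x‖ ≤ M) ∧ ∀ x, Tendsto (fun j => χ j x) atTop (𝓝 1) := by
  let b : ContDiffBump (0 : Space n) := ⟨1, 2, one_pos, one_lt_two⟩
  have hb : ContDiff ℝ 1 b := b.contDiff
  obtain ⟨M, hM⟩ := (hb.continuous_fderiv one_ne_zero).bounded_above_of_compact_support
    (b.hasCompactSupport.fderiv ℝ)
  have hM0 : 0 ≤ M := (norm_nonneg _).trans (hM 0)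
  have hc : ∀ j : ℕ, (0 : ℝ) < ((j : ℝ) + 1)⁻¹ := fun j => by positivity
  have hc1 : ∀ j : ℕ, ((j : ℝ) + 1)⁻¹ ≤ 1 := fun j => inv_le_one_of_one_le₀ (by
    have : (0 : ℝ) ≤ j := by positivity
    linarith)
  refine ⟨fun j x => b (((j : ℝ) + 1)⁻¹ • x), ⟨M, hM0⟩, fun j => hb.comp (contDiff_const_smul _),
    fun j => b.hasCompactSupport.comp_smul (hc j).ne', fun j x => ?_, fun j x => ?_, fun x => ?_⟩
  · rw [Real.norm_of_nonneg b.nonneg]; exact b.le_one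
  · have h1 : HasFDerivAt (fun x : Space n => ((j : ℝ) + 1)⁻¹ • x)
        (((j : ℝ) + 1)⁻¹ • ContinuousLinearMap.id ℝ (Space n)) x :=
      (((j : ℝ) + 1)⁻¹ • ContinuousLinearMap.id ℝ (Space n)).hasFDerivAt
    have h2 := ((hb.differentiable one_ne_zero) (((j : ℝ) + 1)⁻¹ • x)).hasFDerivAt.comp x h1
    have h3 : fderiv ℝ (fun x => b (((j : ℝ) + 1)⁻¹ • x)) x
        = (fderiv ℝ b (((j : ℝ) + 1)⁻¹ • x)).comp
          (((j : ℝ) + 1)⁻¹ • ContinuousLinearMap.id ℝ (Space n)) := h2.fderiv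
    rw [h3, ContinuousLinearMap.comp_smul, ContinuousLinearMap.comp_id, norm_smul,
      Real.norm_of_nonneg (hc j).le]
    calc _ ≤ 1 * M := by
          gcongr
          · exact hc1 j
          · exact hM _
      _ = M := one_mul M
  · refine tendsto_const_nhds.congr' ?_
    filter_upwards [eventually_ge_atTop ⌈‖x‖⌉₊] with j hj
    refine (b.one_of_mem_closedBall ?_).symm
    rw [mem_closedBall_zero_iff, norm_smul, Real.norm_of_nonneg (hc j).le]
    have h1 : ‖x‖ ≤ j := (Nat.le_ceil _).trans (by exact_mod_cast hj)
    have h2 : (0 : ℝ) < (j : ℝ) + 1 := by positivity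
    change ((j : ℝ) + 1)⁻¹ * ‖x‖ ≤ 1
    rw [inv_mul_le_iff₀ h2]; linarith

/-- The **Gagliardo-Nirenberg-Sobolev inequality** without compact support. -/
theorem exists_eLpNorm_le_eLpNorm_add_eLpNorm_fderiv {n : ℕ} (hn : 1 ≤ n) {F : Type*}
    [NormedAddCommGroup F] [NormedSpace ℝ F] [FiniteDimensional ℝ F] {p p' : ℝ} (hp : 1 ≤ p)
    (hp'0 : 0 < p') (hp' : p'⁻¹ = p⁻¹ - (n : ℝ)⁻¹) :
    ∃ C : ℝ≥0, ∀ f : Space n → F, ContDiff ℝ 1 f →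
      eLpNorm f (ENNReal.ofReal p') volume ≤ C * (eLpNorm f (ENNReal.ofReal p) volume
        + eLpNorm (fderiv ℝ f) (ENNReal.ofReal p) volume) := by
  obtain ⟨χ, M, hχ, hχc, hχ1, hχM, hχlim⟩ := exists_smooth_cutoff n
  set C₀ := SNormLESNormFDerivOfEqConst F (volume : Measure (Space n)) (p.toNNReal : ℝ) with hC₀
  have hp0 : 0 ≤ p := by linarith
  have hp1 : (1 : ℝ≥0∞) ≤ ENNReal.ofReal p := by simpa using hp
  -- The gradient of χ_j f is bounded by |∇f| + M |f|; Fatou's lemma then removes the cutoff.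
  refine ⟨C₀ * (M + 1), fun f hf => ?_⟩
  have hbound : ∀ j, eLpNorm (fun x => χ j x • f x) (ENNReal.ofReal p') volume
      ≤ (C₀ * (M + 1) : ℝ≥0) * (eLpNorm f (ENNReal.ofReal p) volume
        + eLpNorm (fderiv ℝ f) (ENNReal.ofReal p) volume) := by
    intro j
    have h1 := eLpNorm_le_eLpNorm_fderiv_of_eq (μ := (volume : Measure (Space n)))
      (u := fun x => χ j x • f x) ((hχ j).smul hf) ((hχc j).smul_right) (p := p.toNNReal)
      (p' := p'.toNNReal) (by simpa using hp) (by simpa using Nat.pos_of_ne_zero (by omega))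
      (by simpa [hp0, hp'0.le] using hp')
    have hd : ∀ x, fderiv ℝ (fun x => χ j x • f x) x
        = χ j x • fderiv ℝ f x + (fderiv ℝ (χ j) x).smulRight (f x) := fun x =>
      fderiv_fun_smul ((hχ j).differentiable one_ne_zero x) (hf.differentiable one_ne_zero x)
    have hfm : AEStronglyMeasurable f volume := hf.continuous.aestronglyMeasurable
    have hdfm : AEStronglyMeasurable (fderiv ℝ f) volume :=
      (hf.continuous_fderiv one_ne_zero).aestronglyMeasurable
    have h2 : eLpNorm (fderiv ℝ (fun x => χ j x • f x)) (ENNReal.ofReal p) volume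
        ≤ eLpNorm (fderiv ℝ f) (ENNReal.ofReal p) volume
          + M * eLpNorm f (ENNReal.ofReal p) volume := by
      have e : fderiv ℝ (fun x => χ j x • f x) = (fun x => χ j x • fderiv ℝ f x)
          + fun x => (fderiv ℝ (χ j) x).smulRight (f x) := funext hd
      rw [e]
      refine (eLpNorm_add_le ((hχ j).continuous.aestronglyMeasurable.smul hdfm) ?_ hp1).trans ?_
      · have hc : Continuous fun x => (fderiv ℝ (χ j) x).smulRight (f x) := by
          have h1 := (hχ j).continuous_fderiv one_ne_zero
          have h2 := hf.continuous
          exact (ContinuousLinearMap.smulRightL ℝ (Space n) F).continuous₂.comp (h1.prodMk h2)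
        exact hc.aestronglyMeasurable
      gcongr
      · refine eLpNorm_mono fun x => ?_
        rw [Pi.smul_apply', norm_smul]
        exact mul_le_of_le_one_left (norm_nonneg _) (hχ1 j x)
      · refine (eLpNorm_le_nnreal_smul_eLpNorm_of_ae_le_mul (g := f) (c := M)
          (Eventually.of_forall fun x => ?_) _).trans_eq (ENNReal.smul_def _ _)
        rw [← NNReal.coe_le_coe, NNReal.coe_mul, coe_nnnorm, coe_nnnorm,
          ContinuousLinearMap.norm_smulRight_apply]
        gcongr
        exact hχM j x
    refine h1.trans ?_
    rw [← ENNReal.ofReal, ENNReal.coe_mul, mul_assoc]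
    refine mul_le_mul_right (h2.trans ?_) _
    rw [add_comm, mul_add, ENNReal.coe_add, ENNReal.coe_one]
    gcongr
    · exact le_self_add
    · exact le_mul_of_one_le_left zero_le le_add_self
  refine (Lp.eLpNorm_lim_le_liminf_eLpNorm (f := fun j x => χ j x • f x)
    (fun j => ((hχ j).continuous.smul hf.continuous).aestronglyMeasurable) f
    (Eventually.of_forall fun x => ?_)).trans ?_
  · simpa using (hχlim x).smul_const (f x)
  · exact liminf_le_of_le (by isBoundedDefault) fun b hb => by
      obtain ⟨j, hj⟩ := hb.exists
      exact hj.trans (hbound j)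

section HInfty

variable {n : ℕ} {F G : Type*} [NormedAddCommGroup F] [NormedSpace ℝ F]
  [NormedAddCommGroup G] [NormedSpace ℝ G]

theorem ContInHInfty.contInLp_two {T : ℝ} {f : ℝ → Space n → F} (hf : ContInHInfty T f) :
    ContInLp T 2 f := by
  have h := (hf.2 0).clm (continuousMultilinearCurryFin0 ℝ (Space n)
    F).toContinuousLinearEquiv.toContinuousLinearMap
  refine h.congr fun t _ => Eventually.of_forall fun x => ?_
  simp [iteratedFDeriv_zero_eq_comp]

theorem ContInHInfty.clm {T : ℝ} {f : ℝ → Space n → F} (hf : ContInHInfty T f) (L : F →L[ℝ] G) :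
    ContInHInfty T fun t x => L (f t x) := by
  refine ⟨fun t ht => L.contDiff.comp (hf.1 t ht), fun k => ?_⟩
  have h := (hf.2 k).clm (ContinuousLinearMap.compContinuousMultilinearMapL ℝ
    (fun _ : Fin k => Space n) F G L)
  refine h.congr fun t ht => Eventually.of_forall fun x => ?_
  exact (L.iteratedFDeriv_comp_left (hf.1 t ht).contDiffAt (by exact_mod_cast le_top)).symm

theorem ContInHInfty.fderiv {T : ℝ} {f : ℝ → Space n → F} (hf : ContInHInfty T f) :
    ContInHInfty T fun t => fderiv ℝ (f t) := by
  refine ⟨fun t ht => (hf.1 t ht).fderiv_right (by simp), fun k => ?_⟩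
  let L : (ContinuousMultilinearMap ℝ (fun _ : Fin (k + 1) => Space n) F) →L[ℝ]
      ContinuousMultilinearMap ℝ (fun _ : Fin k => Space n) (Space n →L[ℝ] F) :=
    (continuousMultilinearCurryRightEquiv' ℝ k (Space n) F).toContinuousLinearEquiv
  have h := ContInLp.clm
    (G := ContinuousMultilinearMap ℝ (fun _ : Fin k => Space n) (Space n →L[ℝ] F)) (hf.2 (k + 1)) L
  refine h.congr fun t _ => Eventually.of_forall fun x => ?_
  simp [L, iteratedFDeriv_succ_eq_comp_right]

theorem ContInHInfty.partialDeriv {T : ℝ} {f : ℝ → Space n → F} (hf : ContInHInfty T f)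
    (k : Fin n) : ContInHInfty T fun t => partialDeriv k (f t) :=
  hf.fderiv.clm (ContinuousLinearMap.apply ℝ F (EuclideanSpace.single k (1 : ℝ)))

theorem ContInLp.sobolev [FiniteDimensional ℝ F] (hn : 1 ≤ n) {T p p' : ℝ} (hp : 1 ≤ p)
    (hp'0 : 0 < p') (hp' : p'⁻¹ = p⁻¹ - (n : ℝ)⁻¹) {f : ℝ → Space n → F}
    (hs : ∀ t ∈ Icc 0 T, ContDiff ℝ 1 (f t)) (hf : ContInLp T (ENNReal.ofReal p) f)
    (hdf : ContInLp T (ENNReal.ofReal p) fun t => _root_.fderiv ℝ (f t)) :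
    ContInLp T (ENNReal.ofReal p') f := by
  obtain ⟨C, hC⟩ := exists_eLpNorm_le_eLpNorm_add_eLpNorm_fderiv hn (F := F) hp hp'0 hp'
  refine ⟨fun t ht => ⟨(hf.1 t ht).1, (hC _ (hs t ht)).trans_lt ?_⟩, fun t₀ ht₀ => ?_⟩
  · have := (hf.1 t ht).2
    have := (hdf.1 t ht).2
    finiteness
  · have h := ENNReal.Tendsto.const_mul (a := (C : ℝ≥0∞)) ((hf.2 t₀ ht₀).add (hdf.2 t₀ ht₀))
      (Or.inr ENNReal.coe_ne_top)
    rw [add_zero, mul_zero] at h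
    refine tendsto_of_tendsto_of_tendsto_of_le_of_le' tendsto_const_nhds h
      (Eventually.of_forall fun _ => zero_le) ?_
    filter_upwards [self_mem_nhdsWithin] with t ht
    refine (hC _ ((hs t ht).sub (hs t₀ ht₀))).trans_eq ?_
    congr 3
    ext1 x
    exact fderiv_fun_sub ((hs t ht).differentiable one_ne_zero x)
      ((hs t₀ ht₀).differentiable one_ne_zero x)

end HInfty

/-- Each Sobolev step lowers the reciprocal exponent by 1/n at the price of one derivative. The
induction must range over all target spaces, because it is also applied to the differential of f. -/
theorem ContInHInfty.contInLp_of_inv_le {n : ℕ} (hn : 3 ≤ n) {T : ℝ} (j : ℕ) :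
    ∀ {F : Type} [NormedAddCommGroup F] [NormedSpace ℝ F] [FiniteDimensional ℝ F]
      {f : ℝ → Space n → F}, ContInHInfty T f → ∀ r : ℝ, 2 ≤ r → 1 / 2 - j * (n : ℝ)⁻¹ ≤ r⁻¹ →
      ContInLp T (ENNReal.ofReal r) f := by
  have hn3 : (3 : ℝ) ≤ n := by exact_mod_cast hn
  have hninv : (n : ℝ)⁻¹ ≤ 3⁻¹ := inv_anti₀ (by norm_num) hn3
  have hn0 : 0 < (n : ℝ)⁻¹ := by positivity
  have htwo : ENNReal.ofReal 2 = 2 := by simp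
  induction j with
  | zero =>
    intro F _ _ _ f hf r hr hr'
    have : r = 2 := by
      refine le_antisymm ?_ hr
      have h1 : (2 : ℝ)⁻¹ ≤ r⁻¹ := by simpa using hr'
      exact (inv_le_inv₀ (by norm_num) (by linarith)).1 h1
    rw [this, htwo]; exact hf.contInLp_two
  | succ j ih =>
    intro F _ _ _ f hf r hr hr'
    have hr0 : 0 < r := by linarith
    have hs : ∀ t ∈ Icc 0 T, ContDiff ℝ 1 (f t) := fun t ht =>
      (hf.1 t ht).of_le (by exact_mod_cast le_top)
    set p := (r⁻¹ + (n : ℝ)⁻¹)⁻¹ with hp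
    have hpinv : p⁻¹ = r⁻¹ + (n : ℝ)⁻¹ := inv_inv _
    have hp0 : 0 < p := by positivity
    by_cases hp2 : 2 ≤ p
    · refine ContInLp.sobolev (by omega) (by linarith) hr0 (by rw [hpinv]; ring) hs
        (ih hf p hp2 ?_) (ih hf.fderiv p hp2 ?_) <;>
      · rw [hpinv]; push_cast at hr'; linarith
    -- Here the preceding exponent would fall below 2, so r lies between 2 and the Sobolev exponent
    -- of 2, and interpolation replaces the induction hypothesis.
    · set r₂ := ((2 : ℝ)⁻¹ - (n : ℝ)⁻¹)⁻¹ with hr₂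
      have hr₂0 : 0 < r₂ := inv_pos.2 (by linarith)
      have h2 : ContInLp T (ENNReal.ofReal 2) f := by rw [htwo]; exact hf.contInLp_two
      have h2' : ContInLp T (ENNReal.ofReal 2) fun t => _root_.fderiv ℝ (f t) := by
        rw [htwo]; exact hf.fderiv.contInLp_two
      have h3 : ContInLp T (ENNReal.ofReal r₂) f :=
        ContInLp.sobolev (by omega) (by norm_num) hr₂0 (inv_inv _) hs h2 h2'
      refine h2.interpolate (by norm_num) hr ?_ h3
      rw [not_le] at hp2
      have h4 : (2 : ℝ)⁻¹ < p⁻¹ := (inv_lt_inv₀ (by norm_num) hp0).2 hp2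
      rw [← inv_le_inv₀ hr₂0 hr0, hr₂, inv_inv]
      linarith

theorem ContInHInfty.contInLp {n : ℕ} (hn : 3 ≤ n) {T : ℝ} {F : Type} [NormedAddCommGroup F]
    [NormedSpace ℝ F] [FiniteDimensional ℝ F] {f : ℝ → Space n → F} (hf : ContInHInfty T f)
    {r : ℝ} (hr : 2 ≤ r) : ContInLp T (ENNReal.ofReal r) f := by
  refine ContInHInfty.contInLp_of_inv_le hn n hf r hr ?_
  have hn0 : (n : ℝ) ≠ 0 := by positivity
  rw [mul_inv_cancel₀ hn0]
  have : 0 < r⁻¹ := by positivity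
  linarith

/-! ### Partial derivatives and the class `RegLp`, stable under products. -/

section PartialDeriv

variable {n : ℕ} {E F G : Type*} [NormedAddCommGroup E] [NormedSpace ℝ E]
  [NormedAddCommGroup F] [NormedSpace ℝ F] [NormedAddCommGroup G] [NormedSpace ℝ G]

theorem partialDeriv_bilin (B : E →L[ℝ] F →L[ℝ] G) {f : Space n → E} {g : Space n → F}
    {x : Space n} (hf : DifferentiableAt ℝ f x) (hg : DifferentiableAt ℝ g x) (k : Fin n) :
    partialDeriv k (fun y => B (f y) (g y)) x
      = B (partialDeriv k f x) (g x) + B (f x) (partialDeriv k g x) := by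
  unfold partialDeriv
  rw [(B.hasFDerivAt_of_bilinear hf.hasFDerivAt hg.hasFDerivAt).fderiv]
  simp [add_comm]

theorem partialDeriv_clm (L : F →L[ℝ] G) {f : Space n → F} {x : Space n}
    (hf : DifferentiableAt ℝ f x) (k : Fin n) :
    partialDeriv k (fun y => L (f y)) x = L (partialDeriv k f x) := by
  unfold partialDeriv
  have h : fderiv ℝ (fun y => L (f y)) x = L.comp (fderiv ℝ f x) :=
    (L.hasFDerivAt.comp x hf.hasFDerivAt).fderiv
  rw [h]; rfl

theorem partialDeriv_add {f g : Space n → F} {x : Space n}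
    (hf : DifferentiableAt ℝ f x) (hg : DifferentiableAt ℝ g x) (k : Fin n) :
    partialDeriv k (fun y => f y + g y) x = partialDeriv k f x + partialDeriv k g x := by
  unfold partialDeriv; rw [fderiv_fun_add hf hg]; rfl

theorem partialDeriv_sum {ι : Type*} (s : Finset ι) {f : ι → Space n → F} {x : Space n}
    (hf : ∀ i ∈ s, DifferentiableAt ℝ (f i) x) (k : Fin n) :
    partialDeriv k (fun y => ∑ i ∈ s, f i y) x = ∑ i ∈ s, partialDeriv k (f i) x := by
  unfold partialDeriv; rw [fderiv_fun_sum hf]; simp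

theorem contDiff_partialDeriv {f : Space n → F} (hf : ContDiff ℝ ∞ f) (k : Fin n) :
    ContDiff ℝ ∞ (partialDeriv k f) :=
  (hf.fderiv_right (m := ∞) (by simp)).clm_apply contDiff_const

theorem partialDeriv_comm {f : Space n → F} (hf : ContDiff ℝ ∞ f) (k l : Fin n) (x : Space n) :
    partialDeriv k (partialDeriv l f) x = partialDeriv l (partialDeriv k f) x := by
  have hd : DifferentiableAt ℝ (fderiv ℝ f) x :=
    ((hf.fderiv_right (m := ∞) (by simp)).differentiable (by simp)) x
  have h : ∀ i j : Fin n, partialDeriv i (partialDeriv j f) x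
      = fderiv ℝ (fderiv ℝ f) x (EuclideanSpace.single i 1) (EuclideanSpace.single j 1) := by
    intro i j
    have h1 := partialDeriv_clm (ContinuousLinearMap.apply ℝ F (EuclideanSpace.single j (1 : ℝ)))
      hd i
    exact h1
  rw [h, h]
  exact (hf.contDiffAt.isSymmSndFDerivAt (by simp; exact ENat.LEInfty.out)) _ _

end PartialDeriv

/-- Time dependent functions that are smooth in space and belong to `C⁰([0, T]; L^r)` for all
`2 ≤ r < ∞`, together with their spatial derivatives up to order `j`. -/
def RegLp {n : ℕ} {F : Type*} [NormedAddCommGroup F] [NormedSpace ℝ F] (T : ℝ) :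
    ℕ → (ℝ → Space n → F) → Prop
  | 0, f => (∀ t ∈ Icc 0 T, ContDiff ℝ ∞ (f t)) ∧
      ∀ r : ℝ, 2 ≤ r → ContInLp T (ENNReal.ofReal r) f
  | j + 1, f => ((∀ t ∈ Icc 0 T, ContDiff ℝ ∞ (f t)) ∧
      ∀ r : ℝ, 2 ≤ r → ContInLp T (ENNReal.ofReal r) f) ∧ ∀ k, RegLp T j fun t => partialDeriv k (f t)

/-- Bounded time dependent functions, continuous in time and smooth in space, whose first spatial
derivatives belong to the class `RegLp`. -/
structure RegBdd {n : ℕ} {F : Type*} [NormedAddCommGroup F] [NormedSpace ℝ F] (T : ℝ)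
    (g : ℝ → Space n → F) : Prop where
  smooth : ∀ t ∈ Icc 0 T, ContDiff ℝ ∞ (g t)
  norm_le : ∀ t ∈ Icc 0 T, ∀ x, ‖g t x‖ ≤ 1
  continuousOn : ∀ x, ContinuousOn (fun t => g t x) (Icc 0 T)
  deriv : ∀ k j, RegLp T j fun t => partialDeriv k (g t)

section RegLp

variable {n : ℕ} {E F G : Type*} [NormedAddCommGroup E] [NormedSpace ℝ E]
  [NormedAddCommGroup F] [NormedSpace ℝ F] [NormedAddCommGroup G] [NormedSpace ℝ G] {T : ℝ}

theorem regLp_zero_iff {f : ℝ → Space n → F} : RegLp T 0 f ↔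
    (∀ t ∈ Icc 0 T, ContDiff ℝ ∞ (f t)) ∧
      ∀ r : ℝ, 2 ≤ r → ContInLp T (ENNReal.ofReal r) f := Iff.rfl

theorem regLp_succ_iff {j : ℕ} {f : ℝ → Space n → F} : RegLp T (j + 1) f ↔
    ((∀ t ∈ Icc 0 T, ContDiff ℝ ∞ (f t)) ∧
      ∀ r : ℝ, 2 ≤ r → ContInLp T (ENNReal.ofReal r) f) ∧
    ∀ k, RegLp T j fun t => partialDeriv k (f t) := Iff.rfl

theorem RegLp.base {j : ℕ} {f : ℝ → Space n → F} (hf : RegLp T j f) :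
    (∀ t ∈ Icc 0 T, ContDiff ℝ ∞ (f t)) ∧
      ∀ r : ℝ, 2 ≤ r → ContInLp T (ENNReal.ofReal r) f := by
  cases j with
  | zero => exact hf
  | succ j => exact (regLp_succ_iff.1 hf).1

theorem RegLp.partialDeriv {j : ℕ} {f : ℝ → Space n → F} (hf : RegLp T (j + 1) f) (k : Fin n) :
    RegLp T j fun t => partialDeriv k (f t) := (regLp_succ_iff.1 hf).2 k

theorem RegLp.smooth {j : ℕ} {f : ℝ → Space n → F} (hf : RegLp T j f) {t : ℝ}
    (ht : t ∈ Icc 0 T) : ContDiff ℝ ∞ (f t) := hf.base.1 t ht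

theorem RegLp.contInLp {j : ℕ} {f : ℝ → Space n → F} (hf : RegLp T j f) {r : ℝ} (hr : 2 ≤ r) :
    ContInLp T (ENNReal.ofReal r) f := hf.base.2 r hr

/-- Induction principle for membership in the class `RegLp`. -/
theorem RegLp.of_base {j : ℕ} {f : ℝ → Space n → F}
    (h1 : ∀ t ∈ Icc 0 T, ContDiff ℝ ∞ (f t))
    (h2 : ∀ r : ℝ, 2 ≤ r → ContInLp T (ENNReal.ofReal r) f)
    (h3 : ∀ i, i + 1 = j → ∀ k, RegLp T i fun t => _root_.partialDeriv k (f t)) :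
    RegLp T j f := by
  cases j with
  | zero => exact regLp_zero_iff.2 ⟨h1, h2⟩
  | succ j => exact regLp_succ_iff.2 ⟨⟨h1, h2⟩, h3 j rfl⟩

theorem RegLp.of_succ {j : ℕ} : ∀ {f : ℝ → Space n → F}, RegLp T (j + 1) f → RegLp T j f := by
  induction j with
  | zero => exact fun hf => regLp_zero_iff.2 hf.base
  | succ j ih => exact fun hf => regLp_succ_iff.2 ⟨hf.base, fun k => ih (hf.partialDeriv k)⟩

theorem RegLp.differentiable {j : ℕ} {f : ℝ → Space n → F} (hf : RegLp T j f) {t : ℝ}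
    (ht : t ∈ Icc 0 T) : Differentiable ℝ (f t) := (hf.smooth ht).differentiable (by simp)

theorem RegLp.memLp_two {j : ℕ} {f : ℝ → Space n → F} (hf : RegLp T j f) {t : ℝ}
    (ht : t ∈ Icc 0 T) : MemLp (f t) 2 volume := by
  simpa using (hf.contInLp le_rfl).1 t ht

theorem RegLp.congr {j : ℕ} {f g : ℝ → Space n → F} (hf : RegLp T j f)
    (h : ∀ t ∈ Icc 0 T, ∀ x, f t x = g t x) : RegLp T j g := by
  have h' : ∀ t ∈ Icc 0 T, f t = g t := fun t ht => funext fun x => h t ht x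
  induction j generalizing f g with
  | zero =>
    refine .of_base (fun t ht => h' t ht ▸ hf.smooth ht) (fun r hr => (hf.contInLp hr).congr
      fun t ht => Eventually.of_forall fun x => h t ht x) (by simp)
  | succ j ih =>
    refine .of_base (fun t ht => h' t ht ▸ hf.smooth ht) (fun r hr => (hf.contInLp hr).congr
      fun t ht => Eventually.of_forall fun x => h t ht x) fun i hi k => ?_
    obtain rfl : i = j := by omega
    exact ih (hf.partialDeriv k) (fun t ht x => by rw [h' t ht]) fun t ht => by rw [h' t ht]

theorem RegLp.clm {j : ℕ} {f : ℝ → Space n → F} (hf : RegLp T j f) (L : F →L[ℝ] G) :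
    RegLp T j fun t x => L (f t x) := by
  induction j generalizing f with
  | zero =>
    exact .of_base (fun t ht => (L.contDiff.comp (hf.smooth ht) : ContDiff ℝ ∞ fun x => L (f t x)))
      (fun r hr => (hf.contInLp hr).clm L) (by simp)
  | succ j ih =>
    refine .of_base (fun t ht => (L.contDiff.comp (hf.smooth ht) : ContDiff ℝ ∞ fun x => L (f t x)))
      (fun r hr => (hf.contInLp hr).clm L) fun i hi k => ?_
    obtain rfl : i = j := by omega
    exact (ih (hf.partialDeriv k)).congr fun t ht x =>
      (partialDeriv_clm L (hf.differentiable ht x) k).symm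

theorem one_le_ofReal {r : ℝ} (hr : 2 ≤ r) : 1 ≤ ENNReal.ofReal r := by
  simpa using (by linarith : 1 ≤ r)

theorem RegLp.add {j : ℕ} {f g : ℝ → Space n → F} (hf : RegLp T j f) (hg : RegLp T j g) :
    RegLp T j fun t x => f t x + g t x := by
  induction j generalizing f g with
  | zero =>
    exact .of_base (fun t ht => (hf.smooth ht).add (hg.smooth ht))
      (fun r hr => (hf.contInLp hr).add (one_le_ofReal hr) (hg.contInLp hr)) (by simp)
  | succ j ih =>
    refine .of_base (fun t ht => (hf.smooth ht).add (hg.smooth ht))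
      (fun r hr => (hf.contInLp hr).add (one_le_ofReal hr) (hg.contInLp hr)) fun i hi k => ?_
    obtain rfl : i = j := by omega
    exact (ih (hf.partialDeriv k) (hg.partialDeriv k)).congr fun t ht x =>
      (partialDeriv_add (hf.differentiable ht x) (hg.differentiable ht x) k).symm

theorem RegLp.neg {j : ℕ} {f : ℝ → Space n → F} (hf : RegLp T j f) :
    RegLp T j fun t x => -f t x := hf.clm (-ContinuousLinearMap.id ℝ F)

theorem RegLp.sub {j : ℕ} {f g : ℝ → Space n → F} (hf : RegLp T j f) (hg : RegLp T j g) :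
    RegLp T j fun t x => f t x - g t x :=
  (hf.add hg.neg).congr fun _ _ _ => (sub_eq_add_neg _ _).symm

theorem RegLp.const_mul {j : ℕ} {f : ℝ → Space n → ℝ} (hf : RegLp T j f) (c : ℝ) :
    RegLp T j fun t x => c * f t x := hf.clm (c • ContinuousLinearMap.id ℝ ℝ)

theorem RegLp.fun_zero (j : ℕ) : RegLp T j fun (_ : ℝ) (_ : Space n) => (0 : F) := by
  have h : ∀ r : ℝ, 2 ≤ r → ContInLp T (ENNReal.ofReal r) fun (_ : ℝ) (_ : Space n) => (0 : F) := by
    refine fun r hr => ⟨fun t _ => MemLp.zero', fun t₀ _ => ?_⟩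
    simp only [sub_self, eLpNorm_zero']
    exact tendsto_const_nhds
  induction j with
  | zero =>
    exact .of_base (fun _ _ => contDiff_const) h (by simp)
  | succ j ih =>
    refine .of_base (fun _ _ => contDiff_const) h fun i hi k => ?_
    obtain rfl : i = j := by omega
    exact ih.congr fun t _ x => by simp [_root_.partialDeriv]

theorem RegLp.sum {ι : Type*} {j : ℕ} (s : Finset ι) {f : ι → ℝ → Space n → F}
    (hf : ∀ i ∈ s, RegLp T j (f i)) : RegLp T j fun t x => ∑ i ∈ s, f i t x := by
  classical
  induction s using Finset.induction_on with
  | empty => simpa using RegLp.fun_zero j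
  | insert a s ha ih =>
    simp_rw [Finset.sum_insert ha]
    exact (hf a (Finset.mem_insert_self a s)).add
      (ih fun i hi => hf i (Finset.mem_insert_of_mem hi))

/-- Both factors are taken in L^(2r), where 2r ≥ 2. Products thus reach exponents down to 1, below
the range of the class itself. -/
theorem RegLp.contInLp_bilin {i j : ℕ} {f : ℝ → Space n → E} {g : ℝ → Space n → F}
    (hf : RegLp T i f) (hg : RegLp T j g) (B : E →L[ℝ] F →L[ℝ] G) {r : ℝ} (hr : 1 ≤ r) :
    ContInLp T (ENNReal.ofReal r) fun t x => B (f t x) (g t x) := by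
  have : ENNReal.HolderTriple (ENNReal.ofReal (2 * r)) (ENNReal.ofReal (2 * r))
      (ENNReal.ofReal r) := by
    constructor
    rw [← ENNReal.ofReal_inv_of_pos (by linarith), ← ENNReal.ofReal_inv_of_pos (by linarith),
      ← ENNReal.ofReal_add (by positivity) (by positivity)]
    congr 1; field_simp; norm_num
  have h2 : 2 ≤ 2 * r := by linarith
  exact (hf.contInLp h2).bilin (p := ENNReal.ofReal (2 * r)) (q := ENNReal.ofReal (2 * r))
    (by simpa using hr) (hg.contInLp h2) B

theorem contDiff_bilin (B : E →L[ℝ] F →L[ℝ] G) {f : Space n → E} {g : Space n → F}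
    (hf : ContDiff ℝ ∞ f) (hg : ContDiff ℝ ∞ g) : ContDiff ℝ ∞ fun x => B (f x) (g x) :=
  (B.contDiff.comp hf).clm_apply hg

theorem RegLp.bilin {j : ℕ} {f : ℝ → Space n → E} {g : ℝ → Space n → F} (hf : RegLp T j f)
    (hg : RegLp T j g) (B : E →L[ℝ] F →L[ℝ] G) : RegLp T j fun t x => B (f t x) (g t x) := by
  induction j generalizing f g with
  | zero =>
    exact .of_base (fun t ht => contDiff_bilin B (hf.smooth ht) (hg.smooth ht))
      (fun r hr => hf.contInLp_bilin hg B (by linarith)) (by simp)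
  | succ j ih =>
    refine .of_base (fun t ht => contDiff_bilin B (hf.smooth ht) (hg.smooth ht))
      (fun r hr => hf.contInLp_bilin hg B (by linarith)) fun i hi k => ?_
    obtain rfl : i = j := by omega
    exact ((ih (hf.partialDeriv k) hg.of_succ).add (ih hf.of_succ (hg.partialDeriv k))).congr
      fun t ht x => (partialDeriv_bilin B (hf.differentiable ht x) (hg.differentiable ht x) k).symm

/-- By the product rule, a derivative falling on the bounded factor turns it into a member of
`RegLp`, so the remaining product is covered by `RegLp.bilin`. -/
theorem RegLp.bilin_bdd {j : ℕ} {f : ℝ → Space n → E} {g : ℝ → Space n → F} (hf : RegLp T j f)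
    (hg : RegBdd T g) (B : E →L[ℝ] F →L[ℝ] G) : RegLp T j fun t x => B (f t x) (g t x) := by
  have h1 : ∀ {f : ℝ → Space n → E} {j : ℕ}, RegLp T j f → ∀ r : ℝ, 2 ≤ r →
      ContInLp T (ENNReal.ofReal r) fun t x => B (f t x) (g t x) := fun hf r hr =>
    (hf.contInLp hr).bilin_bdd (by linarith)
      (fun t ht => (hg.smooth t ht).continuous.aestronglyMeasurable) hg.norm_le hg.continuousOn B
  induction j generalizing f with
  | zero =>
    exact .of_base (fun t ht => contDiff_bilin B (hf.smooth ht) (hg.smooth t ht)) (h1 hf)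
      (by simp)
  | succ j ih =>
    refine .of_base (fun t ht => contDiff_bilin B (hf.smooth ht) (hg.smooth t ht)) (h1 hf)
      fun i hi k => ?_
    obtain rfl : i = j := by omega
    exact ((ih (hf.partialDeriv k)).add (hf.of_succ.bilin (hg.deriv k i) B)).congr fun t ht x =>
      (partialDeriv_bilin B (hf.differentiable ht x)
        ((hg.smooth t ht).differentiable (by simp) x) k).symm

end RegLp

theorem ContInHInfty.regLp {n : ℕ} (hn : 3 ≤ n) {F : Type} [NormedAddCommGroup F]
    [NormedSpace ℝ F] [FiniteDimensional ℝ F] {T : ℝ} (j : ℕ) {f : ℝ → Space n → F}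
    (hf : ContInHInfty T f) : RegLp T j f := by
  induction j generalizing f with
  | zero =>
    exact .of_base hf.1 (fun r hr => hf.contInLp hn hr) (by simp)
  | succ j ih =>
    refine .of_base hf.1 (fun r hr => hf.contInLp hn hr) fun i hi k => ?_
    obtain rfl : i = j := by omega
    exact ih (hf.partialDeriv k)

/-! ### Pointwise algebra of orthonormal frames and their variations. -/

section Cross

theorem inner_vec (v w : Vec) : inner ℝ v w = v 0 * w 0 + v 1 * w 1 + v 2 * w 2 := by
  simp [inner_eq_sum_mul, Fin.sum_univ_three]

theorem cross_apply_zero (v w : Vec) : cross v w 0 = v 1 * w 2 - v 2 * w 1 := by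
  simp [cross, cross_apply]

theorem cross_apply_one (v w : Vec) : cross v w 1 = v 2 * w 0 - v 0 * w 2 := by
  simp [cross, cross_apply]

theorem cross_apply_two (v w : Vec) : cross v w 2 = v 0 * w 1 - v 1 * w 0 := by
  simp [cross, cross_apply]

theorem inner_cross_left (v w : Vec) : inner ℝ v (cross v w) = 0 := by
  simp only [inner_vec, cross_apply_zero, cross_apply_one, cross_apply_two]; ring

theorem inner_cross_right (v w : Vec) : inner ℝ w (cross v w) = 0 := by
  simp only [inner_vec, cross_apply_zero, cross_apply_one, cross_apply_two]; ring

theorem inner_cross_cross_self (v w : Vec) :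
    inner ℝ (cross v w) (cross v w) = inner ℝ v v * inner ℝ w w - inner ℝ v w ^ 2 := by
  simp only [inner_vec, cross_apply_zero, cross_apply_one, cross_apply_two]; ring

theorem inner_cross_cross (x y v w : Vec) :
    inner ℝ (cross (cross x y) v) w
      = inner ℝ x v * inner ℝ y w - inner ℝ y v * inner ℝ x w := by
  simp only [inner_vec, cross_apply_zero, cross_apply_one, cross_apply_two]; ring

/-- `(x, y, z)` is a positively oriented orthonormal frame of `ℝ³`. -/
structure IsFrame (x y z : Vec) : Prop where
  norm_x : ‖x‖ = 1
  norm_y : ‖y‖ = 1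
  norm_z : ‖z‖ = 1
  eq_cross : z = cross x y

namespace IsFrame

variable {x y z : Vec}

theorem inner_xx (h : IsFrame x y z) : inner ℝ x x = 1 := by
  simp [h.norm_x]

theorem inner_yy (h : IsFrame x y z) : inner ℝ y y = 1 := by
  simp [h.norm_y]

theorem inner_zz (h : IsFrame x y z) : inner ℝ z z = 1 := by
  simp [h.norm_z]

theorem inner_xz (h : IsFrame x y z) : inner ℝ x z = 0 := h.eq_cross ▸ inner_cross_left x y

theorem inner_yz (h : IsFrame x y z) : inner ℝ y z = 0 := h.eq_cross ▸ inner_cross_right x y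

/-- Orthogonality need not be assumed: by Lagrange's identity, the cross product of two unit vectors
has length one only if they are orthogonal. -/
theorem inner_xy (h : IsFrame x y z) : inner ℝ x y = 0 := by
  have h1 := inner_cross_cross_self x y
  rw [← h.eq_cross, h.inner_xx, h.inner_yy, h.inner_zz] at h1
  have h2 : (inner ℝ x y : ℝ) ^ 2 = 0 := by linarith
  exact pow_eq_zero_iff (two_ne_zero) |>.1 h2

theorem inner_eq (h : IsFrame x y z) (v w : Vec) : inner ℝ v w
    = inner ℝ v x * inner ℝ w x + inner ℝ v y * inner ℝ w y + inner ℝ v z * inner ℝ w z := by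
  have ho : Orthonormal ℝ ![x, y, z] := by
    rw [orthonormal_iff_ite]
    intro i j
    fin_cases i <;> fin_cases j <;>
      simp [h.norm_x, h.norm_y, h.norm_z, h.inner_xy, h.inner_xz, h.inner_yz,
        real_inner_comm x y, real_inner_comm x z, real_inner_comm y z]
  have hs : ⊤ ≤ Submodule.span ℝ (Set.range ![x, y, z]) :=
    (ho.linearIndependent.span_eq_top_of_card_eq_finrank (by simp)).ge
  have := (OrthonormalBasis.mk ho hs).sum_inner_mul_inner v w
  rw [← this]
  simp [Fin.sum_univ_three, real_inner_comm w]

/-- Together with the companion for `y`: z × acts on the tangent plane as the rotation by a right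
angle, i.e. multiplication by i in the coordinates given by the frame. -/
theorem inner_cross_fst (h : IsFrame x y z) (v : Vec) : inner ℝ (cross z v) x = -inner ℝ v y := by
  rw [h.eq_cross, inner_cross_cross, h.inner_xx, real_inner_comm x y, h.inner_xy,
    real_inner_comm v y]
  ring

theorem inner_cross_snd (h : IsFrame x y z) (v : Vec) : inner ℝ (cross z v) y = inner ℝ v x := by
  rw [h.eq_cross, inner_cross_cross, h.inner_yy, h.inner_xy, real_inner_comm v x]
  ring

end IsFrame

/-- `(dx, dy, dz)` is an infinitesimal variation of the orthonormal frame `(x, y, z)`. -/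
structure IsFrameVariation (x y z dx dy dz : Vec) : Prop where
  xx : inner ℝ dx x = 0
  yy : inner ℝ dy y = 0
  zz : inner ℝ dz z = 0
  xy : inner ℝ dx y + inner ℝ dy x = 0
  xz : inner ℝ dx z + inner ℝ dz x = 0
  yz : inner ℝ dy z + inner ℝ dz y = 0

/-- The Gauss equation in algebraic form. In the expansion of ⟨dx, ey⟩ along the frame, the x and y
terms vanish because dx ⊥ x and ey ⊥ y; only normal components survive, and these are expressed
through dz and ez. -/
theorem IsFrameVariation.inner_sub_inner {x y z dx dy dz ex ey ez : Vec} (h : IsFrame x y z)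
    (hd : IsFrameVariation x y z dx dy dz) (he : IsFrameVariation x y z ex ey ez) :
    inner ℝ dx ey - inner ℝ ex dy
      = (inner ℝ dz x * inner ℝ ez y - inner ℝ ez x * inner ℝ dz y : ℝ) := by
  rw [h.inner_eq dx ey, h.inner_eq ex dy, hd.xx, he.xx, hd.yy, he.yy,
    eq_neg_of_add_eq_zero_left hd.xz, eq_neg_of_add_eq_zero_left hd.yz,
    eq_neg_of_add_eq_zero_left he.xz, eq_neg_of_add_eq_zero_left he.yz]
  ring

/-- With `inner_snd`, this identifies the connection term when ∂_k of ⟨∂_k m, X⟩ is compared with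
⟨∂_k ∂_k m, X⟩. -/
theorem IsFrameVariation.inner_fst {x y z dx dy dz ex ey ez : Vec} (h : IsFrame x y z)
    (hd : IsFrameVariation x y z dx dy dz) (he : IsFrameVariation x y z ex ey ez) :
    (inner ℝ dz ex : ℝ) = inner ℝ dz y * inner ℝ ex y := by
  rw [h.inner_eq dz ex, hd.zz, he.xx]; ring

theorem IsFrameVariation.inner_snd {x y z dx dy dz ex ey ez : Vec} (h : IsFrame x y z)
    (hd : IsFrameVariation x y z dx dy dz) (he : IsFrameVariation x y z ex ey ez) :
    (inner ℝ dz ey : ℝ) = -(inner ℝ dz x * inner ℝ ex y) := by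
  rw [h.inner_eq dz ey, hd.zz, he.yy, eq_neg_of_add_eq_zero_right he.xy]; ring

end Cross

/-! ### Exchange of time and space derivatives on the open strip. -/

section Schwarz

variable {n : ℕ} {F : Type*} [NormedAddCommGroup F] [NormedSpace ℝ F]
  {f : ℝ → Space n → F} {T t : ℝ}

theorem timeDeriv_eq_deriv (ht : t ∈ Ioo 0 T) (f : ℝ → Space n → F) (x : Space n) :
    timeDeriv T f t x = deriv (fun s => f s x) t :=
  derivWithin_of_mem_nhds (Icc_mem_nhds ht.1 ht.2)

theorem contDiffAt_of_strip (hf : ContDiffOn ℝ ∞ (fun p : ℝ × Space n => f p.1 p.2)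
    (Ioo 0 T ×ˢ univ)) (ht : t ∈ Ioo 0 T) (x : Space n) :
    ContDiffAt ℝ ∞ (fun p : ℝ × Space n => f p.1 p.2) (t, x) :=
  hf.contDiffAt ((isOpen_Ioo.prod isOpen_univ).mem_nhds ⟨ht, mem_univ x⟩)

theorem hasDerivAt_of_strip (hf : ContDiffOn ℝ ∞ (fun p : ℝ × Space n => f p.1 p.2)
    (Ioo 0 T ×ˢ univ)) (ht : t ∈ Ioo 0 T) (x : Space n) :
    HasDerivAt (fun s => f s x)
      (fderiv ℝ (fun p : ℝ × Space n => f p.1 p.2) (t, x) (1, 0)) t := by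
  have h1 := ((contDiffAt_of_strip hf ht x).differentiableAt (by simp)).hasFDerivAt
  exact h1.comp_hasDerivAt t ((hasDerivAt_id t).prodMk (hasDerivAt_const t x))

theorem partialDeriv_of_strip (hf : ContDiffOn ℝ ∞ (fun p : ℝ × Space n => f p.1 p.2)
    (Ioo 0 T ×ˢ univ)) (ht : t ∈ Ioo 0 T) (x : Space n) (k : Fin n) :
    partialDeriv k (f t) x = fderiv ℝ (fun p : ℝ × Space n => f p.1 p.2) (t, x)
      (0, EuclideanSpace.single k 1) := by
  have h1 := ((contDiffAt_of_strip hf ht x).differentiableAt (by simp)).hasFDerivAt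
  have h2 : HasFDerivAt (f t) _ x :=
    h1.comp x ((hasFDerivAt_const t x).prodMk (hasFDerivAt_id x))
  unfold partialDeriv
  rw [h2.fderiv]; simp

theorem contDiffOn_fderiv_strip (hf : ContDiffOn ℝ ∞ (fun p : ℝ × Space n => f p.1 p.2)
    (Ioo 0 T ×ˢ univ)) :
    ContDiffOn ℝ ∞ (fderiv ℝ (fun p : ℝ × Space n => f p.1 p.2)) (Ioo 0 T ×ˢ univ) :=
  hf.fderiv_of_isOpen (isOpen_Ioo.prod isOpen_univ) (by simp)

theorem contDiffOn_partialDeriv_strip (hf : ContDiffOn ℝ ∞ (fun p : ℝ × Space n => f p.1 p.2)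
    (Ioo 0 T ×ˢ univ)) (k : Fin n) :
    ContDiffOn ℝ ∞ (fun p : ℝ × Space n => partialDeriv k (f p.1) p.2) (Ioo 0 T ×ˢ univ) :=
  ((contDiffOn_fderiv_strip hf).clm_apply contDiffOn_const).congr fun p hp =>
    partialDeriv_of_strip hf hp.1 p.2 k

/-- Both sides are entries of the second differential in space-time, which is symmetric because the
function is jointly smooth near interior times. -/
theorem deriv_partialDeriv_comm (hf : ContDiffOn ℝ ∞ (fun p : ℝ × Space n => f p.1 p.2)
    (Ioo 0 T ×ˢ univ)) (ht : t ∈ Ioo 0 T) (x : Space n) (k : Fin n) :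
    deriv (fun s => partialDeriv k (f s) x) t = partialDeriv k (timeDeriv T f t) x := by
  set g : ℝ × Space n → F := fun p => f p.1 p.2
  have hd : HasFDerivAt (fderiv ℝ g) (fderiv ℝ (fderiv ℝ g) (t, x)) (t, x) :=
    (((contDiffOn_fderiv_strip hf).contDiffAt ((isOpen_Ioo.prod isOpen_univ).mem_nhds
      ⟨ht, mem_univ x⟩)).differentiableAt (by simp)).hasFDerivAt
  have h1 : HasDerivAt (fun s => partialDeriv k (f s) x)
      (fderiv ℝ (fderiv ℝ g) (t, x) (1, 0) (0, EuclideanSpace.single k 1)) t := by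
    have h2 : HasDerivAt (fun s => fderiv ℝ g (s, x)) _ t :=
      hd.comp_hasDerivAt t ((hasDerivAt_id t).prodMk (hasDerivAt_const t x))
    have h3 := h2.clm_apply (hasDerivAt_const t ((0 : ℝ), EuclideanSpace.single k (1 : ℝ)))
    refine (h3.congr_of_eventuallyEq ?_).congr_deriv (by simp)
    filter_upwards [Ioo_mem_nhds ht.1 ht.2] with s hs
    exact partialDeriv_of_strip hf hs x k
  have h4 : timeDeriv T f t = fun y => fderiv ℝ g (t, y) (1, 0) := by
    funext y
    rw [timeDeriv_eq_deriv ht]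
    exact (hasDerivAt_of_strip hf ht y).deriv
  have h5 : partialDeriv k (timeDeriv T f t) x
      = fderiv ℝ (fderiv ℝ g) (t, x) (0, EuclideanSpace.single k 1) (1, 0) := by
    have h6 : HasFDerivAt (fun y => fderiv ℝ g (t, y)) _ x :=
      hd.comp x ((hasFDerivAt_const t x).prodMk (hasFDerivAt_id x))
    have h7 := h6.clm_apply (hasFDerivAt_const ((1 : ℝ), (0 : Space n)) x)
    rw [h4]
    unfold partialDeriv
    rw [h7.fderiv]
    simp
  rw [h1.deriv, h5]
  exact (contDiffAt_of_strip hf ht x).isSymmSndFDerivAt (by simp; exact ENat.LEInfty.out) _ _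

end Schwarz

/-! ### Vector-valued fields and differentiated orthogonality relations. -/

section PiField

variable {n : ℕ} {T : ℝ}

theorem RegLp.toLp {ι E : Type*} [Fintype ι] [NormedAddCommGroup E] [NormedSpace ℝ E] {j : ℕ}
    {f : ι → ℝ → Space n → E} (hf : ∀ i, RegLp T j (f i)) :
    RegLp T j fun t x => (WithLp.toLp 2 fun i => f i t x : PiLp 2 fun _ : ι => E) := by
  classical
  let L : ι → E →L[ℝ] PiLp 2 fun _ : ι => E := fun i =>
    ((PiLp.continuousLinearEquiv 2 ℝ fun _ : ι => E).symm : _ →L[ℝ] _).comp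
      (ContinuousLinearMap.single ℝ (fun _ : ι => E) i)
  refine (RegLp.sum Finset.univ fun i _ => (hf i).clm (L i)).congr fun t _ x => ?_
  ext j
  simp [L, Pi.single_apply]

theorem RegLp.mul {j : ℕ} {f g : ℝ → Space n → ℝ} (hf : RegLp T j f) (hg : RegLp T j g) :
    RegLp T j fun t x => f t x * g t x := hf.bilin hg (ContinuousLinearMap.mul ℝ ℝ)

theorem RegLp.inner_mul {j : ℕ} {f g : ℝ → Space n → Vec} (hf : RegLp T j f) (hg : RegLp T j g) :
    RegLp T j fun t x => (inner ℝ (f t x) (g t x) : ℝ) :=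
  hf.bilin hg (innerSL ℝ : Vec →L[ℝ] Vec →L[ℝ] ℝ)

theorem RegLp.inner_bdd {j : ℕ} {f g : ℝ → Space n → Vec} (hf : RegLp T j f) (hg : RegBdd T g) :
    RegLp T j fun t x => (inner ℝ (f t x) (g t x) : ℝ) :=
  hf.bilin_bdd hg (innerSL ℝ : Vec →L[ℝ] Vec →L[ℝ] ℝ)

theorem partialDeriv_inner {f g : Space n → Vec} {x : Space n} (hf : DifferentiableAt ℝ f x)
    (hg : DifferentiableAt ℝ g x) (k : Fin n) :
    partialDeriv k (fun y => (inner ℝ (f y) (g y) : ℝ)) x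
      = inner ℝ (partialDeriv k f x) (g x) + inner ℝ (f x) (partialDeriv k g x) :=
  partialDeriv_bilin (innerSL ℝ : Vec →L[ℝ] Vec →L[ℝ] ℝ) hf hg k

theorem inner_partialDeriv_add_eq_zero {f g : Space n → Vec} {x : Space n} {c : ℝ}
    (hf : DifferentiableAt ℝ f x) (hg : DifferentiableAt ℝ g x) (k : Fin n)
    (h : ∀ y, inner ℝ (f y) (g y) = c) :
    inner ℝ (partialDeriv k f x) (g x) + inner ℝ (partialDeriv k g x) (f x) = (0 : ℝ) := by
  have h1 := partialDeriv_inner hf hg k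
  simp_rw [h] at h1
  rw [real_inner_comm (f x), ← h1]
  simp [partialDeriv]

theorem inner_timeDeriv_add_eq_zero {f g : ℝ → Space n → Vec} {t : ℝ} {x : Space n} {c : ℝ}
    (ht : t ∈ Ioo 0 T) (hf : DifferentiableAt ℝ (fun s => f s x) t)
    (hg : DifferentiableAt ℝ (fun s => g s x) t)
    (h : ∀ s ∈ Icc 0 T, inner ℝ (f s x) (g s x) = c) :
    inner ℝ (timeDeriv T f t x) (g t x) + inner ℝ (timeDeriv T g t x) (f t x) = (0 : ℝ) := by
  have h1 := hf.hasDerivAt.inner ℝ hg.hasDerivAt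
  have h2 : HasDerivAt (fun s => (inner ℝ (f s x) (g s x) : ℝ)) 0 t := by
    refine (hasDerivAt_const t c).congr_of_eventuallyEq ?_
    filter_upwards [Ioo_mem_nhds ht.1 ht.2] with s hs using h s (Ioo_subset_Icc_self hs)
  rw [timeDeriv_eq_deriv ht, timeDeriv_eq_deriv ht, real_inner_comm (f t x), add_comm]
  exact h1.unique h2

end PiField

/-! ### Structure equations of the frame and the Landau-Lifshitz-Gilbert equation. -/

/-- The coefficient `⟨∂ₖ f, g⟩` of a map `f` with respect to a vector field `g`. -/
noncomputable def frameCoeff {n : ℕ} (f g : ℝ → Space n → Vec) (k : Fin n) (t : ℝ)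
    (x : Space n) : ℝ :=
  inner ℝ (partialDeriv k (f t) x) (g t x)

section Geometry

variable {n : ℕ} {lam T t : ℝ} {mInf : Vec} {m X Y : ℝ → Space n → Vec}

theorem IsLLGSolution.space_smooth (hm : IsLLGSolution lam T mInf m) (ht : t ∈ Icc 0 T) :
    ContDiff ℝ ∞ (m t) := by
  simpa using (hm.regular.1 t ht).add (contDiff_const (c := mInf))

theorem IsLLGSolution.regLp_partialDeriv (hm : IsLLGSolution lam T mInf m) (hn : 3 ≤ n)
    (k : Fin n) (j : ℕ) : RegLp T j fun t => partialDeriv k (m t) := by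
  refine ((hm.regular.regLp hn (j + 1)).partialDeriv k).congr fun t _ x => ?_
  simp only [partialDeriv, fderiv_sub_const]

theorem IsMovingFrame.regBdd_X (hf : IsMovingFrame T m X Y) (hn : 3 ≤ n) : RegBdd T X :=
  ⟨hf.space_smooth_X, fun t ht x => (hf.norm_X t ht x).le,
    fun x => (hf.time_differentiable_X x).continuousOn, fun k j => (hf.regular_X k).regLp hn j⟩

theorem IsMovingFrame.regBdd_Y (hf : IsMovingFrame T m X Y) (hn : 3 ≤ n) : RegBdd T Y :=
  ⟨hf.space_smooth_Y, fun t ht x => (hf.norm_Y t ht x).le,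
    fun x => (hf.time_differentiable_Y x).continuousOn, fun k j => (hf.regular_Y k).regLp hn j⟩

theorem regLp_frameCoeff_X (hn : 3 ≤ n) (hm : IsLLGSolution lam T mInf m)
    (hf : IsMovingFrame T m X Y) (k : Fin n) (j : ℕ) : RegLp T j (frameCoeff m X k) :=
  (hm.regLp_partialDeriv hn k j).inner_bdd (hf.regBdd_X hn)

theorem regLp_frameCoeff_Y (hn : 3 ≤ n) (hm : IsLLGSolution lam T mInf m)
    (hf : IsMovingFrame T m X Y) (k : Fin n) (j : ℕ) : RegLp T j (frameCoeff m Y k) :=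
  (hm.regLp_partialDeriv hn k j).inner_bdd (hf.regBdd_Y hn)

theorem regLp_frameCoeff_XY (hn : 3 ≤ n) (hf : IsMovingFrame T m X Y) (k : Fin n) (j : ℕ) :
    RegLp T j (frameCoeff X Y k) :=
  ((hf.regular_X k).regLp hn j).inner_bdd (hf.regBdd_Y hn)

theorem regLp_temporalPotential (hn : 3 ≤ n) (hf : IsMovingFrame T m X Y) (j : ℕ) :
    RegLp T j (temporalPotential T X Y) :=
  (hf.regular_time_X.regLp hn j).inner_bdd (hf.regBdd_Y hn)

theorem isFrame (hm : IsLLGSolution lam T mInf m) (hf : IsMovingFrame T m X Y)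
    (ht : t ∈ Icc 0 T) (x : Space n) : IsFrame (X t x) (Y t x) (m t x) :=
  ⟨hf.norm_X t ht x, hf.norm_Y t ht x, hm.norm_eq_one t ht x, hf.eq_cross t ht x⟩

theorem isFrameVariation_partialDeriv (hm : IsLLGSolution lam T mInf m)
    (hf : IsMovingFrame T m X Y) (ht : t ∈ Icc 0 T) (x : Space n) (k : Fin n) :
    IsFrameVariation (X t x) (Y t x) (m t x) (partialDeriv k (X t) x) (partialDeriv k (Y t) x)
      (partialDeriv k (m t) x) := by
  have hX := (hf.space_smooth_X t ht).differentiable (by simp) x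
  have hY := (hf.space_smooth_Y t ht).differentiable (by simp) x
  have hM := (hm.space_smooth ht).differentiable (by simp) x
  have h := isFrame hm hf ht
  refine ⟨?_, ?_, ?_, inner_partialDeriv_add_eq_zero hX hY k fun y => (h y).inner_xy,
    inner_partialDeriv_add_eq_zero hX hM k fun y => (h y).inner_xz,
    inner_partialDeriv_add_eq_zero hY hM k fun y => (h y).inner_yz⟩
  · linarith [inner_partialDeriv_add_eq_zero hX hX k fun y => (h y).inner_xx]
  · linarith [inner_partialDeriv_add_eq_zero hY hY k fun y => (h y).inner_yy]
  · linarith [inner_partialDeriv_add_eq_zero hM hM k fun y => (h y).inner_zz]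

theorem isFrameVariation_timeDeriv (hm : IsLLGSolution lam T mInf m)
    (hf : IsMovingFrame T m X Y) (ht : t ∈ Ioo 0 T) (x : Space n) :
    IsFrameVariation (X t x) (Y t x) (m t x) (timeDeriv T X t x) (timeDeriv T Y t x)
      (timeDeriv T m t x) := by
  have hX := (hasDerivAt_of_strip hf.smooth_X ht x).differentiableAt
  have hY := (hasDerivAt_of_strip hf.smooth_Y ht x).differentiableAt
  have hM := (hasDerivAt_of_strip hm.smooth ht x).differentiableAt
  have h := fun s hs => isFrame hm hf (t := s) hs x
  refine ⟨?_, ?_, ?_, inner_timeDeriv_add_eq_zero ht hX hY fun s hs => (h s hs).inner_xy,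
    inner_timeDeriv_add_eq_zero ht hX hM fun s hs => (h s hs).inner_xz,
    inner_timeDeriv_add_eq_zero ht hY hM fun s hs => (h s hs).inner_yz⟩
  · linarith [inner_timeDeriv_add_eq_zero ht hX hX fun s hs => (h s hs).inner_xx]
  · linarith [inner_timeDeriv_add_eq_zero ht hY hY fun s hs => (h s hs).inner_yy]
  · linarith [inner_timeDeriv_add_eq_zero ht hM hM fun s hs => (h s hs).inner_zz]

theorem partialDeriv_frameCoeff {f g : ℝ → Space n → Vec} {x : Space n}
    (hf : ContDiff ℝ ∞ (f t)) (hg : ContDiff ℝ ∞ (g t)) (k l : Fin n) :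
    partialDeriv k (frameCoeff f g l t) x
      = inner ℝ (partialDeriv k (partialDeriv l (f t)) x) (g t x)
        + inner ℝ (partialDeriv l (f t) x) (partialDeriv k (g t) x) :=
  partialDeriv_inner ((contDiff_partialDeriv hf l).differentiable (by simp) x)
    (hg.differentiable (by simp) x) k

/-- The curvature identity for the spatial connection coefficients. -/
theorem partialDeriv_frameCoeff_XY (hm : IsLLGSolution lam T mInf m)
    (hf : IsMovingFrame T m X Y) (ht : t ∈ Icc 0 T) (x : Space n) (k l : Fin n) :
    partialDeriv k (frameCoeff X Y l t) x = partialDeriv l (frameCoeff X Y k t) x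
      + (frameCoeff m X l t x * frameCoeff m Y k t x
          - frameCoeff m X k t x * frameCoeff m Y l t x) := by
  have hX := hf.space_smooth_X t ht
  have hY := hf.space_smooth_Y t ht
  have h := (isFrameVariation_partialDeriv hm hf ht x l).inner_sub_inner (isFrame hm hf ht x)
    (isFrameVariation_partialDeriv hm hf ht x k)
  rw [partialDeriv_frameCoeff hX hY, partialDeriv_frameCoeff hX hY, partialDeriv_comm hX k l]
  unfold frameCoeff
  linarith

/-- The derivative `⟨∂ₖ∂₀X, Y⟩ + ⟨∂ₖX, ∂₀Y⟩` of the connection coefficients in time. -/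
noncomputable def mixedCoeff (T : ℝ) (X Y : ℝ → Space n → Vec) (k : Fin n) (t : ℝ)
    (x : Space n) : ℝ :=
  inner ℝ (partialDeriv k (timeDeriv T X t) x) (Y t x)
    + inner ℝ (partialDeriv k (X t) x) (timeDeriv T Y t x)

theorem regLp_mixedCoeff (hn : 3 ≤ n) (hf : IsMovingFrame T m X Y) (k : Fin n) (j : ℕ) :
    RegLp T j (mixedCoeff T X Y k) :=
  (((hf.regular_time_X.regLp hn (j + 1)).partialDeriv k).inner_bdd (hf.regBdd_Y hn)).add
    (((hf.regular_X k).regLp hn j).inner_mul (hf.regular_time_Y.regLp hn j))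

/-- Replaces ∂_t a_k by an expression in fields whose regularity is part of the hypotheses on the
frame. -/
theorem timeDeriv_frameCoeff_XY (hf : IsMovingFrame T m X Y) (ht : t ∈ Ioo 0 T) (x : Space n)
    (k : Fin n) : timeDeriv T (frameCoeff X Y k) t x = mixedCoeff T X Y k t x := by
  have h1 := (hasDerivAt_of_strip (f := fun s => partialDeriv k (X s))
    (contDiffOn_partialDeriv_strip hf.smooth_X k) ht x).differentiableAt.hasDerivAt
  have h2 := (hasDerivAt_of_strip hf.smooth_Y ht x).differentiableAt.hasDerivAt
  rw [deriv_partialDeriv_comm hf.smooth_X ht] at h1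
  rw [← timeDeriv_eq_deriv ht] at h2
  rw [timeDeriv_eq_deriv ht, mixedCoeff, add_comm]
  exact (h1.inner ℝ h2).deriv

theorem contDiffOn_frameCoeff_strip {f g : ℝ → Space n → Vec}
    (hf : ContDiffOn ℝ ∞ (fun p : ℝ × Space n => f p.1 p.2) (Ioo 0 T ×ˢ univ))
    (hg : ContDiffOn ℝ ∞ (fun p : ℝ × Space n => g p.1 p.2) (Ioo 0 T ×ˢ univ)) (k : Fin n) :
    ContDiffOn ℝ ∞ (fun p : ℝ × Space n => frameCoeff f g k p.1 p.2) (Ioo 0 T ×ˢ univ) :=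
  (contDiffOn_partialDeriv_strip hf k).inner ℝ hg

theorem sum_partialDeriv_frameCoeff_XY (hC : IsCoulombGauge T X Y) (ht : t ∈ Icc 0 T)
    (x : Space n) : ∑ k, partialDeriv k (frameCoeff X Y k t) x = 0 := hC t ht x

/-- The Coulomb condition differentiated in time, after exchanging ∂_k and ∂_t. It provides the
divergence-free field in the representation of a_0. -/
theorem sum_partialDeriv_mixedCoeff (hf : IsMovingFrame T m X Y) (hC : IsCoulombGauge T X Y)
    (ht : t ∈ Ioo 0 T) (x : Space n) : ∑ k, partialDeriv k (mixedCoeff T X Y k t) x = 0 := by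
  have hs := fun k => contDiffOn_frameCoeff_strip hf.smooth_X hf.smooth_Y k
  have h1 : ∀ k, partialDeriv k (mixedCoeff T X Y k t) x
      = deriv (fun s => partialDeriv k (frameCoeff X Y k s) x) t := by
    intro k
    rw [deriv_partialDeriv_comm (hs k) ht]
    congr 1
    funext y
    exact (timeDeriv_frameCoeff_XY hf ht y k).symm
  simp_rw [h1]
  rw [← deriv_fun_sum fun k _ => (hasDerivAt_of_strip
    (f := fun s => partialDeriv k (frameCoeff X Y k s))
    (contDiffOn_partialDeriv_strip (hs k) k) ht x).differentiableAt]
  have h2 : (fun s => ∑ k, partialDeriv k (frameCoeff X Y k s) x) =ᶠ[𝓝 t] fun _ => 0 := by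
    filter_upwards [Ioo_mem_nhds ht.1 ht.2] with s hs
    exact sum_partialDeriv_frameCoeff_XY hC (Ioo_subset_Icc_self hs) x
  rw [h2.deriv_eq, deriv_const]

/-- The curvature identity for the temporal connection coefficient. -/
theorem partialDeriv_temporalPotential (hm : IsLLGSolution lam T mInf m)
    (hf : IsMovingFrame T m X Y) (ht : t ∈ Ioo 0 T) (x : Space n) (k : Fin n) :
    partialDeriv k (temporalPotential T X Y t) x = mixedCoeff T X Y k t x
      + (inner ℝ (timeDeriv T m t x) (X t x) * frameCoeff m Y k t x
          - frameCoeff m X k t x * inner ℝ (timeDeriv T m t x) (Y t x)) := by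
  have ht' := Ioo_subset_Icc_self ht
  have h := (isFrameVariation_timeDeriv hm hf ht x).inner_sub_inner (isFrame hm hf ht' x)
    (isFrameVariation_partialDeriv hm hf ht' x k)
  have h1 : partialDeriv k (temporalPotential T X Y t) x = _ :=
    partialDeriv_inner ((hf.regular_time_X.1 t ht').differentiable (by simp) x)
      ((hf.space_smooth_Y t ht').differentiable (by simp) x) k
  rw [h1, mixedCoeff]
  unfold frameCoeff
  linarith

theorem laplacian_eq_sum_partialDeriv {f : Space n → Vec} (hf : ContDiff ℝ ∞ f) (x : Space n) :
    Laplacian.laplacian f x = ∑ k, partialDeriv k (partialDeriv k f) x := by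
  rw [InnerProductSpace.laplacian_eq_iteratedFDeriv_orthonormalBasis f
    (EuclideanSpace.basisFun (Fin n) ℝ)]
  refine Finset.sum_congr rfl fun k _ => ?_
  have hd : DifferentiableAt ℝ (fderiv ℝ f) x :=
    ((hf.fderiv_right (m := ∞) (by simp)).differentiable (by simp)) x
  have h1 := partialDeriv_clm (ContinuousLinearMap.apply ℝ Vec (EuclideanSpace.single k (1 : ℝ)))
    hd k
  rw [iteratedFDeriv_two_apply]
  simp only [EuclideanSpace.basisFun_apply, Matrix.cons_val_zero, Matrix.cons_val_one]
  exact h1.symm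

/-- The first component of the tension field in the moving frame. -/
theorem inner_laplacian_X (hm : IsLLGSolution lam T mInf m) (hf : IsMovingFrame T m X Y)
    (ht : t ∈ Icc 0 T) (x : Space n) :
    inner ℝ (Laplacian.laplacian (m t) x) (X t x)
      = ∑ k, partialDeriv k (frameCoeff m X k t) x
        + -∑ k, frameCoeff X Y k t x * frameCoeff m Y k t x := by
  rw [laplacian_eq_sum_partialDeriv (hm.space_smooth ht), sum_inner, ← sub_eq_add_neg,
    ← Finset.sum_sub_distrib]
  refine Finset.sum_congr rfl fun k _ => ?_
  have h := isFrameVariation_partialDeriv hm hf ht x k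
  rw [partialDeriv_frameCoeff (hm.space_smooth ht) (hf.space_smooth_X t ht),
    h.inner_fst (isFrame hm hf ht x) h]
  unfold frameCoeff
  ring

/-- The second component of the tension field in the moving frame. -/
theorem inner_laplacian_Y (hm : IsLLGSolution lam T mInf m) (hf : IsMovingFrame T m X Y)
    (ht : t ∈ Icc 0 T) (x : Space n) :
    inner ℝ (Laplacian.laplacian (m t) x) (Y t x)
      = ∑ k, partialDeriv k (frameCoeff m Y k t) x
        + ∑ k, frameCoeff X Y k t x * frameCoeff m X k t x := by
  rw [laplacian_eq_sum_partialDeriv (hm.space_smooth ht), sum_inner, ← Finset.sum_add_distrib]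
  refine Finset.sum_congr rfl fun k _ => ?_
  have h := isFrameVariation_partialDeriv hm hf ht x k
  rw [partialDeriv_frameCoeff (hm.space_smooth ht) (hf.space_smooth_Y t ht),
    h.inner_snd (isFrame hm hf ht x) h]
  unfold frameCoeff
  ring

/-- Since m × is a rotation by a right angle in the tangent plane, applying it twice gives minus the
tangential projection; the damping term therefore enters as λ times the tension field. -/
theorem IsLLGSolution.inner_timeDeriv_X (hm : IsLLGSolution lam T mInf m)
    (hf : IsMovingFrame T m X Y) (ht : t ∈ Ioo 0 T) (x : Space n) :
    inner ℝ (timeDeriv T m t x) (X t x) = lam * inner ℝ (Laplacian.laplacian (m t) x) (X t x)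
      + inner ℝ (Laplacian.laplacian (m t) x) (Y t x) := by
  have h := isFrame hm hf (Ioo_subset_Icc_self ht) x
  rw [hm.equation t ht x, inner_sub_left, inner_neg_left, real_inner_smul_left,
    h.inner_cross_fst, h.inner_cross_fst, h.inner_cross_snd]
  ring

theorem IsLLGSolution.inner_timeDeriv_Y (hm : IsLLGSolution lam T mInf m)
    (hf : IsMovingFrame T m X Y) (ht : t ∈ Ioo 0 T) (x : Space n) :
    inner ℝ (timeDeriv T m t x) (Y t x) = lam * inner ℝ (Laplacian.laplacian (m t) x) (Y t x)
      - inner ℝ (Laplacian.laplacian (m t) x) (X t x) := by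
  have h := isFrame hm hf (Ioo_subset_Icc_self ht) x
  rw [hm.equation t ht x, inner_sub_left, inner_neg_left, real_inner_smul_left,
    h.inner_cross_snd, h.inner_cross_snd, h.inner_cross_fst]
  ring

/-- The part of the curvature `⟨∂₀m, X⟩⟨∂ₖm, Y⟩ - ⟨∂ₖm, X⟩⟨∂₀m, Y⟩` generated by the components
`w`, `z` of a tension field. -/
noncomputable def curvatureField (lam : ℝ) (m X Y : ℝ → Space n → Vec) (w z : ℝ → Space n → ℝ)
    (t : ℝ) (x : Space n) : Space n :=
  WithLp.toLp 2 fun k => (lam * w t x + z t x) * frameCoeff m Y k t x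
    - frameCoeff m X k t x * (lam * z t x - w t x)

/-- The curvature identity for the temporal potential of a solution of the
Landau-Lifshitz-Gilbert equation. -/
theorem partialDeriv_temporalPotential_eq (hm : IsLLGSolution lam T mInf m)
    (hf : IsMovingFrame T m X Y) (ht : t ∈ Ioo 0 T) (x : Space n) (k : Fin n) :
    partialDeriv k (temporalPotential T X Y t) x = mixedCoeff T X Y k t x
      + (curvatureField lam m X Y (fun t x => ∑ l, partialDeriv l (frameCoeff m X l t) x)
            (fun t x => ∑ l, partialDeriv l (frameCoeff m Y l t) x) t x k
        + curvatureField lam m X Y (fun t x => -∑ l, frameCoeff X Y l t x * frameCoeff m Y l t x)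
            (fun t x => ∑ l, frameCoeff X Y l t x * frameCoeff m X l t x) t x k) := by
  have ht' := Ioo_subset_Icc_self ht
  rw [partialDeriv_temporalPotential hm hf ht, hm.inner_timeDeriv_X hf ht,
    hm.inner_timeDeriv_Y hf ht, inner_laplacian_X hm hf ht', inner_laplacian_Y hm hf ht']
  simp only [curvatureField]
  ring

end Geometry

/-! ### Hölder estimates and time continuity of the Newtonian potential. -/

theorem PiLp.norm_two_le_sum {ι E : Type*} [Fintype ι] [NormedAddCommGroup E]
    (v : PiLp 2 fun _ : ι => E) : ‖v‖ ≤ ∑ i, ‖v i‖ := by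
  rw [PiLp.norm_eq_of_L2]
  exact Real.sqrt_le_iff.2 ⟨Finset.sum_nonneg fun i _ => norm_nonneg _,
    Finset.sum_sq_le_sq_sum_of_nonneg fun i _ => norm_nonneg _⟩

theorem PiLp.norm_two_le_card_mul {n : ℕ} {v : Space n} {b : ℝ} (h : ∀ i, |v i| ≤ b) :
    ‖v‖ ≤ n * b := by
  refine (PiLp.norm_two_le_sum v).trans ((Finset.sum_le_sum fun i _ => h i).trans ?_)
  simp

theorem eLpNorm_le_mul_of_norm_le_mul {n : ℕ} {E F G : Type*} [NormedAddCommGroup E]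
    [NormedAddCommGroup F] [NormedAddCommGroup G] {f : Space n → E} {g : Space n → F}
    {h : Space n → G} (hg : AEStronglyMeasurable g volume) (hh : AEStronglyMeasurable h volume)
    {c : ℝ≥0} (hc : ∀ x, ‖f x‖ ≤ c * (‖g x‖ * ‖h x‖)) {p q r : ℝ} (hp : 0 < p) (hq : 0 < q)
    (hr : r⁻¹ = p⁻¹ + q⁻¹) :
    eLpNorm f (ENNReal.ofReal r) volume
      ≤ c * (eLpNorm g (ENNReal.ofReal p) volume * eLpNorm h (ENNReal.ofReal q) volume) := by
  have hr0 : 0 < r := inv_pos.1 (hr ▸ by positivity)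
  have : ENNReal.HolderTriple (ENNReal.ofReal p) (ENNReal.ofReal q) (ENNReal.ofReal r) := by
    constructor
    rw [← ENNReal.ofReal_inv_of_pos hp, ← ENNReal.ofReal_inv_of_pos hq,
      ← ENNReal.ofReal_inv_of_pos hr0, ← ENNReal.ofReal_add (by positivity) (by positivity), hr]
  have h1 := eLpNorm_le_mul_eLpNorm_of_ae_le_mul (μ := (volume : Measure (Space n))) (f := f)
    (g := fun x => ‖g x‖ * ‖h x‖) (c := c)
    (Eventually.of_forall fun x => by simpa using hc x) (ENNReal.ofReal r)
  have h2 := eLpNorm_le_eLpNorm_mul_eLpNorm'_of_norm (p := ENNReal.ofReal p)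
    (q := ENNReal.ofReal q) (r := ENNReal.ofReal r) hg hh (fun v w => ‖v‖ * ‖w‖) 1
    (Eventually.of_forall fun x => by simp)
  rw [ENNReal.ofReal_coe_nnreal] at h1
  refine h1.trans ?_
  gcongr
  simpa using h2

section ContInLp

variable {n : ℕ} {T : ℝ}

theorem ContInLp.toLp {ι E : Type*} [Fintype ι] [NormedAddCommGroup E] [NormedSpace ℝ E]
    {p : ℝ≥0∞} (hp : 1 ≤ p) {f : ι → ℝ → Space n → E} (hf : ∀ i, ContInLp T p (f i)) :
    ContInLp T p fun t x => (WithLp.toLp 2 fun i => f i t x : PiLp 2 fun _ : ι => E) := by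
  classical
  let L : ι → E →L[ℝ] PiLp 2 fun _ : ι => E := fun i =>
    ((PiLp.continuousLinearEquiv 2 ℝ fun _ : ι => E).symm : _ →L[ℝ] _).comp
      (ContinuousLinearMap.single ℝ (fun _ : ι => E) i)
  refine (ContInLp.sum hp Finset.univ fun i _ => (hf i).clm (L i)).congr fun t _ =>
    Eventually.of_forall fun x => ?_
  ext j
  simp [L, Pi.single_apply]

/-- By linearity the increment in time is the potential of the increment of the field, so one
inequality gives both membership and continuity. -/
theorem ContInLp.newtonConv (hn : 2 ≤ n) {p q : ℝ} (hp : 1 < p) (hpn : p < n) (hq : 0 < q)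
    (hpq : q⁻¹ = p⁻¹ - (n : ℝ)⁻¹) {F : ℝ → Space n → Space n}
    (hF : ContInLp T (ENNReal.ofReal p) F) (hFm : ∀ t ∈ Icc 0 T, Measurable (F t)) :
    ContInLp T (ENNReal.ofReal q) fun t => _root_.newtonConv (F t) := by
  obtain ⟨C, hC⟩ := exists_eLpNorm_newtonConv_le hn hp hpn hq hpq
  refine ⟨fun t ht => ⟨aestronglyMeasurable_newtonConv (hFm t ht), ?_⟩, fun t₀ ht₀ => ?_⟩
  · exact (hC _ (hFm t ht) _ (Eventually.of_forall (enorm_newtonConv_le (F t)))).trans_lt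
      (ENNReal.mul_lt_top ENNReal.coe_lt_top (hF.1 t ht).2)
  · have h1 := ENNReal.Tendsto.const_mul (a := (C : ℝ≥0∞)) (hF.2 t₀ ht₀)
      (Or.inr ENNReal.coe_ne_top)
    rw [mul_zero] at h1
    refine tendsto_of_tendsto_of_tendsto_of_le_of_le' tendsto_const_nhds h1
      (Eventually.of_forall fun _ => zero_le) ?_
    filter_upwards [self_mem_nhdsWithin] with t ht
    refine hC _ ((hFm t ht).sub (hFm t₀ ht₀)) _ ?_
    filter_upwards [ae_rieszPotential_ne_top hn hp hpn hq hpq (hFm t ht) (hF.1 t ht),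
      ae_rieszPotential_ne_top hn hp hpn hq hpq (hFm t₀ ht₀) (hF.1 t₀ ht₀)] with x hx hx0
    rw [newtonConv_sub (hFm t ht) (hFm t₀ ht₀) hx hx0]
    exact enorm_newtonConv_le _ x

end ContInLp

/-! ### Estimate of the spatial potential. -/

section Estimates

variable {n : ℕ} {lam T t : ℝ} {mInf : Vec} {m X Y : ℝ → Space n → Vec}

theorem derivField_apply (t : ℝ) (x : Space n) (k : Fin n) : derivField m X Y t x k
    = (frameCoeff m X k t x : ℂ) + Complex.I * (frameCoeff m Y k t x : ℂ) := rfl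

theorem abs_frameCoeff_X_le (t : ℝ) (x : Space n) (k : Fin n) :
    |frameCoeff m X k t x| ≤ ‖derivField m X Y t x‖ := by
  refine le_trans ?_ (PiLp.norm_apply_le (derivField m X Y t x) k)
  refine le_trans (le_of_eq ?_) (Complex.abs_re_le_norm _)
  simp [derivField_apply]

theorem abs_frameCoeff_Y_le (t : ℝ) (x : Space n) (k : Fin n) :
    |frameCoeff m Y k t x| ≤ ‖derivField m X Y t x‖ := by
  refine le_trans ?_ (PiLp.norm_apply_le (derivField m X Y t x) k)
  refine le_trans (le_of_eq ?_) (Complex.abs_im_le_norm _)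
  simp [derivField_apply]

theorem abs_frameCoeff_XY_le (t : ℝ) (x : Space n) (k : Fin n) :
    |frameCoeff X Y k t x| ≤ ‖spatialPotential X Y t x‖ :=
  PiLp.norm_apply_le (spatialPotential X Y t x) k

theorem vecGradient_derivField_apply (hn : 3 ≤ n) (hm : IsLLGSolution lam T mInf m)
    (hf : IsMovingFrame T m X Y) (ht : t ∈ Icc 0 T) (x : Space n) (l k : Fin n) :
    vecGradient (derivField m X Y t) x (l, k)
      = ((partialDeriv l (frameCoeff m X k t) x : ℝ) : ℂ)
        + Complex.I * ((partialDeriv l (frameCoeff m Y k t) x : ℝ) : ℂ) := by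
  have hp := (regLp_frameCoeff_X hn hm hf k 0).differentiable ht x
  have hq := (regLp_frameCoeff_Y hn hm hf k 0).differentiable ht x
  let L : ℝ →L[ℝ] ℂ := (ContinuousLinearMap.mul ℝ ℂ Complex.I).comp Complex.ofRealCLM
  have h1 := partialDeriv_clm Complex.ofRealCLM hp l
  have h2 := partialDeriv_clm L hq l
  have h3 := partialDeriv_add (Complex.ofRealCLM.differentiableAt.comp x hp)
    (L.differentiableAt.comp x hq) l
  -- u_k is read as a sum of real-linear images of two real functions, so that differentiation
  -- passes through each of them.
  change partialDeriv l (fun y => Complex.ofRealCLM (frameCoeff m X k t y)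
    + L (frameCoeff m Y k t y)) x = _
  refine h3.trans ?_
  change partialDeriv l (fun y => Complex.ofRealCLM (frameCoeff m X k t y)) x
    + partialDeriv l (fun y => L (frameCoeff m Y k t y)) x = _
  rw [h1, h2]
  rfl

theorem abs_partialDeriv_frameCoeff_X_le (hn : 3 ≤ n) (hm : IsLLGSolution lam T mInf m)
    (hf : IsMovingFrame T m X Y) (ht : t ∈ Icc 0 T) (x : Space n) (l k : Fin n) :
    |partialDeriv l (frameCoeff m X k t) x| ≤ ‖vecGradient (derivField m X Y t) x‖ := by
  refine le_trans ?_ (PiLp.norm_apply_le (vecGradient (derivField m X Y t) x) (l, k))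
  refine le_trans (le_of_eq ?_) (Complex.abs_re_le_norm _)
  simp [vecGradient_derivField_apply hn hm hf ht]

theorem abs_partialDeriv_frameCoeff_Y_le (hn : 3 ≤ n) (hm : IsLLGSolution lam T mInf m)
    (hf : IsMovingFrame T m X Y) (ht : t ∈ Icc 0 T) (x : Space n) (l k : Fin n) :
    |partialDeriv l (frameCoeff m Y k t) x| ≤ ‖vecGradient (derivField m X Y t) x‖ := by
  refine le_trans ?_ (PiLp.norm_apply_le (vecGradient (derivField m X Y t) x) (l, k))
  refine le_trans (le_of_eq ?_) (Complex.abs_im_le_norm _)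
  simp [vecGradient_derivField_apply hn hm hf ht]

theorem contInLp_derivField (hn : 3 ≤ n) (hm : IsLLGSolution lam T mInf m)
    (hf : IsMovingFrame T m X Y) {r : ℝ} (hr : 2 ≤ r) :
    ContInLp T (ENNReal.ofReal r) (derivField m X Y) :=
  ContInLp.toLp (one_le_ofReal hr) fun k =>
    (((regLp_frameCoeff_X hn hm hf k 0).contInLp hr).clm Complex.ofRealCLM).add (one_le_ofReal hr)
      (((regLp_frameCoeff_Y hn hm hf k 0).contInLp hr).clm
        ((ContinuousLinearMap.mul ℝ ℂ Complex.I).comp Complex.ofRealCLM))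

theorem contInLp_vecGradient (hn : 3 ≤ n) (hm : IsLLGSolution lam T mInf m)
    (hf : IsMovingFrame T m X Y) {r : ℝ} (hr : 2 ≤ r) :
    ContInLp T (ENNReal.ofReal r) fun t => vecGradient (derivField m X Y t) := by
  have h := ContInLp.toLp (one_le_ofReal hr) fun lk : Fin n × Fin n =>
    ((((regLp_frameCoeff_X hn hm hf lk.2 1).partialDeriv lk.1).contInLp hr).clm
      Complex.ofRealCLM).add (one_le_ofReal hr)
      ((((regLp_frameCoeff_Y hn hm hf lk.2 1).partialDeriv lk.1).contInLp hr).clm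
        ((ContinuousLinearMap.mul ℝ ℂ Complex.I).comp Complex.ofRealCLM))
  refine h.congr fun t ht => Eventually.of_forall fun x => ?_
  ext lk
  exact (vecGradient_derivField_apply hn hm hf ht x lk.1 lk.2).symm

theorem contInLp_spatialPotential (hn : 3 ≤ n) (hf : IsMovingFrame T m X Y) {r : ℝ}
    (hr : 2 ≤ r) : ContInLp T (ENNReal.ofReal r) (spatialPotential X Y) :=
  ((RegLp.toLp fun k => regLp_frameCoeff_XY hn hf k 0).contInLp hr :)

/-- The curvature `⟨∂ₗm, X⟩⟨∂ₖm, Y⟩ - ⟨∂ₖm, X⟩⟨∂ₗm, Y⟩` of the spatial connection. -/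
noncomputable def curlField (m X Y : ℝ → Space n → Vec) (l : Fin n) (t : ℝ) (x : Space n) :
    Space n :=
  WithLp.toLp 2 fun k => frameCoeff m X l t x * frameCoeff m Y k t x
    - frameCoeff m X k t x * frameCoeff m Y l t x

theorem regLp_curlField (hn : 3 ≤ n) (hm : IsLLGSolution lam T mInf m)
    (hf : IsMovingFrame T m X Y) (l : Fin n) : RegLp T 0 (curlField m X Y l) :=
  RegLp.toLp fun k => ((regLp_frameCoeff_X hn hm hf l 0).mul (regLp_frameCoeff_Y hn hm hf k 0)).sub
    ((regLp_frameCoeff_X hn hm hf k 0).mul (regLp_frameCoeff_Y hn hm hf l 0))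

theorem norm_curlField_le (l : Fin n) (t : ℝ) (x : Space n) :
    ‖curlField m X Y l t x‖ ≤ (2 * n : ℝ≥0) * (‖derivField m X Y t x‖ * ‖derivField m X Y t x‖) := by
  have hX := abs_frameCoeff_X_le (m := m) (X := X) (Y := Y) t x
  have hY := abs_frameCoeff_Y_le (m := m) (X := X) (Y := Y) t x
  refine (PiLp.norm_two_le_card_mul (b := 2 * (‖derivField m X Y t x‖ * ‖derivField m X Y t x‖))
    fun k => ?_).trans_eq (by push_cast; ring)
  refine (abs_sub _ _).trans ?_
  rw [abs_mul, abs_mul, two_mul]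
  exact add_le_add (mul_le_mul (hX l) (hY k) (abs_nonneg _) (norm_nonneg _))
    (mul_le_mul (hX k) (hY l) (abs_nonneg _) (norm_nonneg _))

/-- Representation of φ = a_l with V_k = ∂_l a_k and F the curvature. -/
theorem enorm_frameCoeff_XY_le (hn : 3 ≤ n) (hm : IsLLGSolution lam T mInf m)
    (hf : IsMovingFrame T m X Y) (hC : IsCoulombGauge T X Y) (ht : t ∈ Icc 0 T) (l : Fin n)
    (x : Space n) : ‖frameCoeff X Y l t x‖ₑ
      ≤ ‖(newtonConst n)⁻¹‖ₑ * rieszPotential (fun y => ‖curlField m X Y l t y‖ₑ) x := by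
  have ha := fun k => regLp_frameCoeff_XY hn hf k 2
  have hV : RegLp T 1 fun t y => (WithLp.toLp 2 fun k =>
      partialDeriv l (frameCoeff X Y k t) y : Space n) :=
    RegLp.toLp fun k => (ha k).partialDeriv l
  refine enorm_le_rieszPotential hn ((ha l).differentiable ht) ((ha l).memLp_two ht)
    (fun k => ((ha l).partialDeriv k).memLp_two ht) (hV.differentiable ht) (hV.memLp_two ht)
    (fun k => (((ha k).partialDeriv l).partialDeriv k).memLp_two ht) (fun y => ?_)
    ((regLp_curlField hn hm hf l).memLp_two ht)
    (fun y k => partialDeriv_frameCoeff_XY hm hf ht y k l) x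
  -- The divergence of V is ∂_l of div a, after exchanging ∂_k and ∂_l.
  have h1 := partialDeriv_sum Finset.univ (x := y)
    (fun k _ => ((ha k).partialDeriv k).differentiable ht y) l
  have h2 : (fun z => ∑ k, partialDeriv k (frameCoeff X Y k t) z) = fun _ => 0 :=
    funext (sum_partialDeriv_frameCoeff_XY hC ht)
  rw [h2] at h1
  calc ∑ k, partialDeriv k (partialDeriv l (frameCoeff X Y k t)) y
      = ∑ k, partialDeriv l (partialDeriv k (frameCoeff X Y k t)) y :=
        Finset.sum_congr rfl fun k _ => partialDeriv_comm ((ha k).smooth ht) k l y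
    _ = 0 := by rw [← h1]; simp [partialDeriv]

/-- Hölder puts the curvature in L^(n/2δ). Here 1 < 2δ < 2 < n, so the exponent is admissible for
the Riesz potential, and 2δ/n - 1/n is the reciprocal of the target exponent. -/
theorem exists_eLpNorm_spatialPotential_le (hn : 3 ≤ n) {δ : ℝ} (hδ : 1 / 2 < δ) (hδ' : δ < 1)
    (lam : ℝ) : ∃ c : ℝ≥0, ∀ {T : ℝ} {mInf : Vec} {m X Y : ℝ → Space n → Vec},
      IsLLGSolution lam T mInf m → IsMovingFrame T m X Y → IsCoulombGauge T X Y → ∀ t ∈ Icc 0 T,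
        eLpNorm (spatialPotential X Y t) (ENNReal.ofReal (n / (2 * δ - 1))) volume
          ≤ c * eLpNorm (derivField m X Y t) (ENNReal.ofReal (n / δ)) volume ^ 2 := by
  have hn' : (3 : ℝ) ≤ n := by exact_mod_cast hn
  have hd : 0 < 2 * δ - 1 := by linarith
  obtain ⟨C, hC⟩ := exists_eLpNorm_newtonConv_le (n := n) (p := n / (2 * δ)) (q := n / (2 * δ - 1))
    (by omega) (by rw [one_lt_div (by linarith)]; linarith)
    (div_lt_self (by linarith) (by linarith)) (by positivity)
    (by rw [inv_div, inv_div]; field_simp)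
  refine ⟨n * (C * (2 * n)), fun {T mInf m X Y} hm hf hG t ht => ?_⟩
  set U := eLpNorm (derivField m X Y t) (ENNReal.ofReal (n / δ)) volume
  have hu : AEStronglyMeasurable (derivField m X Y t) volume :=
    ((contInLp_derivField hn hm hf le_rfl).1 t ht).1
  have h1 : ∀ l, eLpNorm (frameCoeff X Y l t) (ENNReal.ofReal (n / (2 * δ - 1))) volume
      ≤ C * (2 * n) * U ^ 2 := by
    intro l
    refine (hC _ ((regLp_curlField hn hm hf l).smooth ht).continuous.measurable _
      (Eventually.of_forall (enorm_frameCoeff_XY_le hn hm hf hG ht l))).trans ?_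
    have h2 := eLpNorm_le_mul_of_norm_le_mul hu hu (norm_curlField_le l t) (p := n / δ)
      (q := n / δ) (r := n / (2 * δ)) (by positivity) (by positivity)
      (by rw [inv_div, inv_div]; ring)
    rw [mul_assoc, sq]
    gcongr
    simpa using h2
  have h3 : eLpNorm (spatialPotential X Y t) (ENNReal.ofReal (n / (2 * δ - 1))) volume
      ≤ eLpNorm (∑ l, fun x => ‖frameCoeff X Y l t x‖) (ENNReal.ofReal (n / (2 * δ - 1)))
        volume := by
    refine eLpNorm_mono fun x => (PiLp.norm_two_le_sum _).trans ?_
    rw [Finset.sum_apply, Real.norm_eq_abs]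
    exact le_abs_self _
  have hq1 : 1 ≤ ENNReal.ofReal (n / (2 * δ - 1)) := by
    rw [ENNReal.one_le_ofReal, one_le_div hd]; linarith
  refine h3.trans ((eLpNorm_sum_le (fun l _ => ((regLp_frameCoeff_XY hn hf l 0).memLp_two
    ht).1.norm) hq1).trans ?_)
  simp_rw [eLpNorm_norm]
  refine (Finset.sum_le_sum fun l _ => h1 l).trans_eq ?_
  simp [mul_assoc]

end Estimates

/-! ### Decomposition and estimates of the temporal potential. -/

section TemporalPotential

variable {n : ℕ} {lam T t : ℝ} {mInf : Vec} {m X Y : ℝ → Space n → Vec}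

theorem regLp_curvatureField (hn : 3 ≤ n) (hm : IsLLGSolution lam T mInf m)
    (hf : IsMovingFrame T m X Y) {w z : ℝ → Space n → ℝ} (hw : RegLp T 0 w) (hz : RegLp T 0 z) :
    RegLp T 0 (curvatureField lam m X Y w z) :=
  RegLp.toLp fun k =>
    (((hw.const_mul lam).add hz).mul (regLp_frameCoeff_Y hn hm hf k 0)).sub
      ((regLp_frameCoeff_X hn hm hf k 0).mul ((hz.const_mul lam).sub hw))

/-- The full range r ≥ 1 matters: the exponents n/(1+δ) and n/(4δ-1) used below may be smaller than
2. -/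
theorem contInLp_curvatureField (hn : 3 ≤ n) (hm : IsLLGSolution lam T mInf m)
    (hf : IsMovingFrame T m X Y) {w z : ℝ → Space n → ℝ} (hw : RegLp T 0 w) (hz : RegLp T 0 z)
    {r : ℝ} (hr : 1 ≤ r) : ContInLp T (ENNReal.ofReal r) (curvatureField lam m X Y w z) := by
  have hr' : 1 ≤ ENNReal.ofReal r := by simpa using hr
  refine (ContInLp.toLp hr' fun k => ContInLp.add hr'
    (((hw.const_mul lam).add hz).contInLp_bilin (regLp_frameCoeff_Y hn hm hf k 0)
      (ContinuousLinearMap.mul ℝ ℝ) hr)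
    ((regLp_frameCoeff_X hn hm hf k 0).contInLp_bilin ((hz.const_mul lam).sub hw)
      (-ContinuousLinearMap.mul ℝ ℝ) hr)).congr fun t _ => Eventually.of_forall fun x => ?_
  ext k
  simp [curvatureField, sub_eq_add_neg, add_mul]

theorem norm_curvatureField_le (hlam : 0 < lam) {w z : ℝ → Space n → ℝ} {x : Space n} {b : ℝ}
    (hw : |w t x| ≤ b) (hz : |z t x| ≤ b) : ‖curvatureField lam m X Y w z t x‖
      ≤ n * (2 * ((lam + 1) * b * ‖derivField m X Y t x‖)) := by
  refine PiLp.norm_two_le_card_mul fun k => ?_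
  have h1 : |lam * w t x + z t x| ≤ (lam + 1) * b := by
    refine (abs_add_le _ _).trans ?_
    rw [abs_mul, abs_of_pos hlam, add_mul, one_mul]
    gcongr
  have h2 : |lam * z t x - w t x| ≤ (lam + 1) * b := by
    refine (abs_sub _ _).trans ?_
    rw [abs_mul, abs_of_pos hlam, add_mul, one_mul]
    gcongr
  have hb : 0 ≤ (lam + 1) * b := (abs_nonneg _).trans h1
  refine (abs_sub _ _).trans ?_
  rw [abs_mul, abs_mul, two_mul]
  refine add_le_add (mul_le_mul h1 (abs_frameCoeff_Y_le t x k) (abs_nonneg _) hb) ?_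
  rw [mul_comm |frameCoeff m X k t x|]
  exact mul_le_mul h2 (abs_frameCoeff_X_le t x k) (abs_nonneg _) hb

theorem abs_sum_le_card_mul {f : Fin n → ℝ} {b : ℝ} (h : ∀ k, |f k| ≤ b) : |∑ k, f k| ≤ n * b :=
  (Finset.abs_sum_le_sum_abs _ _).trans ((Finset.sum_le_sum fun k _ => h k).trans (by simp))

/-- The curvature produced by the divergence of the derivative fields. -/
noncomputable def derivCurvature (lam : ℝ) (m X Y : ℝ → Space n → Vec) : ℝ → Space n → Space n :=
  curvatureField lam m X Y (fun t x => ∑ l, partialDeriv l (frameCoeff m X l t) x)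
    (fun t x => ∑ l, partialDeriv l (frameCoeff m Y l t) x)

/-- The curvature produced by the connection term of the tension field. -/
noncomputable def cubicCurvature (lam : ℝ) (m X Y : ℝ → Space n → Vec) : ℝ → Space n → Space n :=
  curvatureField lam m X Y (fun t x => -∑ l, frameCoeff X Y l t x * frameCoeff m Y l t x)
    (fun t x => ∑ l, frameCoeff X Y l t x * frameCoeff m X l t x)

theorem regLp_derivCurvature (hn : 3 ≤ n) (hm : IsLLGSolution lam T mInf m)
    (hf : IsMovingFrame T m X Y) : RegLp T 0 (derivCurvature lam m X Y) :=
  regLp_curvatureField hn hm hf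
    (RegLp.sum _ fun l _ => (regLp_frameCoeff_X hn hm hf l 1).partialDeriv l)
    (RegLp.sum _ fun l _ => (regLp_frameCoeff_Y hn hm hf l 1).partialDeriv l)

theorem regLp_connection_X (hn : 3 ≤ n) (hm : IsLLGSolution lam T mInf m)
    (hf : IsMovingFrame T m X Y) :
    RegLp T 0 fun t x => ∑ l, frameCoeff X Y l t x * frameCoeff m X l t x :=
  RegLp.sum _ fun l _ => (regLp_frameCoeff_XY hn hf l 0).mul (regLp_frameCoeff_X hn hm hf l 0)

theorem regLp_connection_Y (hn : 3 ≤ n) (hm : IsLLGSolution lam T mInf m)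
    (hf : IsMovingFrame T m X Y) :
    RegLp T 0 fun t x => -∑ l, frameCoeff X Y l t x * frameCoeff m Y l t x :=
  (RegLp.sum _ fun l _ =>
    (regLp_frameCoeff_XY hn hf l 0).mul (regLp_frameCoeff_Y hn hm hf l 0)).neg

theorem regLp_cubicCurvature (hn : 3 ≤ n) (hm : IsLLGSolution lam T mInf m)
    (hf : IsMovingFrame T m X Y) : RegLp T 0 (cubicCurvature lam m X Y) :=
  regLp_curvatureField hn hm hf (regLp_connection_Y hn hm hf) (regLp_connection_X hn hm hf)

theorem contInLp_cubicCurvature (hn : 3 ≤ n) (hm : IsLLGSolution lam T mInf m)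
    (hf : IsMovingFrame T m X Y) {r : ℝ} (hr : 1 ≤ r) :
    ContInLp T (ENNReal.ofReal r) (cubicCurvature lam m X Y) :=
  contInLp_curvatureField hn hm hf (regLp_connection_Y hn hm hf) (regLp_connection_X hn hm hf) hr

theorem norm_derivCurvature_le (hn : 3 ≤ n) (hlam : 0 < lam) (hm : IsLLGSolution lam T mInf m)
    (hf : IsMovingFrame T m X Y) (ht : t ∈ Icc 0 T) (x : Space n) :
    ‖derivCurvature lam m X Y t x‖ ≤ (2 * n ^ 2 * (lam.toNNReal + 1) : ℝ≥0)
      * (‖derivField m X Y t x‖ * ‖vecGradient (derivField m X Y t) x‖) := by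
  refine (norm_curvatureField_le hlam
    (abs_sum_le_card_mul fun l => abs_partialDeriv_frameCoeff_X_le hn hm hf ht x l l)
    (abs_sum_le_card_mul fun l => abs_partialDeriv_frameCoeff_Y_le hn hm hf ht x l l)).trans_eq ?_
  push_cast
  rw [Real.coe_toNNReal lam hlam.le]
  ring

/-- The outer norm around |u|² makes it the second factor in `eLpNorm_le_mul_of_norm_le_mul`. -/
theorem norm_cubicCurvature_le (hlam : 0 < lam) (t : ℝ) (x : Space n) :
    ‖cubicCurvature lam m X Y t x‖ ≤ (2 * n ^ 2 * (lam.toNNReal + 1) : ℝ≥0)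
      * (‖spatialPotential X Y t x‖ * ‖‖derivField m X Y t x‖ * ‖derivField m X Y t x‖‖) := by
  refine (norm_curvatureField_le hlam
    (b := n * (‖spatialPotential X Y t x‖ * ‖derivField m X Y t x‖)) ?_ ?_).trans_eq ?_
  · rw [abs_neg]
    refine abs_sum_le_card_mul fun l => ?_
    rw [abs_mul]
    exact mul_le_mul (abs_frameCoeff_XY_le t x l) (abs_frameCoeff_Y_le t x l) (abs_nonneg _)
      (norm_nonneg _)
  · refine abs_sum_le_card_mul fun l => ?_
    rw [abs_mul]
    exact mul_le_mul (abs_frameCoeff_XY_le t x l) (abs_frameCoeff_X_le t x l) (abs_nonneg _)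
      (norm_nonneg _)
  · push_cast
    rw [Real.coe_toNNReal lam hlam.le, Real.norm_of_nonneg (by positivity)]
    ring

/-- Representation of φ = a_0 with V_k = ∂_t a_k, the cubic curvature as G and the derivative
curvature as F. -/
theorem enorm_temporalPotential_sub_le (hn : 3 ≤ n) (hm : IsLLGSolution lam T mInf m)
    (hf : IsMovingFrame T m X Y) (hC : IsCoulombGauge T X Y) (ht : t ∈ Ioo 0 T) {x : Space n}
    (hx : rieszPotential (fun y => ‖cubicCurvature lam m X Y t y‖ₑ) x ≠ ⊤) :
    ‖temporalPotential T X Y t x - newtonConv (cubicCurvature lam m X Y t) x‖ₑ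
      ≤ ‖(newtonConst n)⁻¹‖ₑ
        * rieszPotential (fun y => ‖derivCurvature lam m X Y t y‖ₑ) x := by
  have ht' := Ioo_subset_Icc_self ht
  have ha := regLp_temporalPotential hn hf 1
  have hV : RegLp T 1 fun t y => (WithLp.toLp 2 fun k => mixedCoeff T X Y k t y : Space n) :=
    RegLp.toLp fun k => regLp_mixedCoeff hn hf k 1
  have hG := regLp_cubicCurvature hn hm hf
  exact enorm_sub_newtonConv_le hn (ha.differentiable ht') (ha.memLp_two ht')
    (fun k => (ha.partialDeriv k).memLp_two ht') (hV.differentiable ht') (hV.memLp_two ht')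
    (fun k => ((regLp_mixedCoeff hn hf k 1).partialDeriv k).memLp_two ht')
    (sum_partialDeriv_mixedCoeff hf hC ht) ((regLp_derivCurvature hn hm hf).memLp_two ht')
    (hG.memLp_two ht') (hG.smooth ht').continuous.measurable
    (partialDeriv_temporalPotential_eq hm hf ht) hx

/-- Two powers of u come from the bound on a and two from |u|²; the reciprocal exponents (2δ-1)/n
and 2δ/n add up to (4δ-1)/n, from which the Riesz potential subtracts 1/n. No time derivative
enters, so the end points need no limit. -/
theorem exists_eLpNorm_newtonConv_cubicCurvature_le (hn : 3 ≤ n) {δ : ℝ} (hδ : 1 / 2 < δ)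
    (hδ' : δ < 1) (hlam : 0 < lam) :
    ∃ c : ℝ≥0, ∀ {T : ℝ} {mInf : Vec} {m X Y : ℝ → Space n → Vec},
      IsLLGSolution lam T mInf m → IsMovingFrame T m X Y → IsCoulombGauge T X Y → ∀ t ∈ Icc 0 T,
        eLpNorm (newtonConv (cubicCurvature lam m X Y t)) (ENNReal.ofReal (n / (4 * δ - 2))) volume
          ≤ c * eLpNorm (derivField m X Y t) (ENNReal.ofReal (n / δ)) volume ^ 4 := by
  have hn' : (3 : ℝ) ≤ n := by exact_mod_cast hn
  have hd : 0 < 2 * δ - 1 := by linarith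
  have hd2 : 0 < 4 * δ - 2 := by linarith
  have hd3 : 0 < 4 * δ - 1 := by linarith
  have hδ0 : 0 < δ := by linarith
  obtain ⟨C, hC⟩ := exists_eLpNorm_newtonConv_le (n := n) (p := n / (4 * δ - 1))
    (q := n / (4 * δ - 2)) (by omega) (by rw [one_lt_div hd3]; linarith)
    (div_lt_self (by linarith) (by linarith)) (by positivity)
    (by rw [inv_div, inv_div]; field_simp; ring)
  obtain ⟨C', hC'⟩ := exists_eLpNorm_spatialPotential_le hn hδ hδ' lam
  refine ⟨C * (2 * n ^ 2 * (lam.toNNReal + 1)) * C', fun {T mInf m X Y} hm hf hG t ht => ?_⟩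
  set U := eLpNorm (derivField m X Y t) (ENNReal.ofReal (n / δ)) volume
  have hu : AEStronglyMeasurable (derivField m X Y t) volume :=
    ((contInLp_derivField hn hm hf le_rfl).1 t ht).1
  have ha : AEStronglyMeasurable (spatialPotential X Y t) volume :=
    ((contInLp_spatialPotential hn hf le_rfl).1 t ht).1
  have h1 := hC _ ((regLp_cubicCurvature hn hm hf).smooth ht).continuous.measurable _
    (Eventually.of_forall (enorm_newtonConv_le (cubicCurvature lam m X Y t)))
  have h2 := eLpNorm_le_mul_of_norm_le_mul (h := fun x =>
      ‖derivField m X Y t x‖ * ‖derivField m X Y t x‖) ha (hu.norm.mul hu.norm)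
    (norm_cubicCurvature_le hlam t) (p := n / (2 * δ - 1)) (q := n / (2 * δ))
    (r := n / (4 * δ - 1)) (by positivity) (by positivity)
    (by rw [inv_div, inv_div, inv_div]; ring)
  have h3 : eLpNorm (fun x => ‖derivField m X Y t x‖ * ‖derivField m X Y t x‖)
      (ENNReal.ofReal (n / (2 * δ))) volume ≤ U * U := by
    simpa using eLpNorm_le_mul_of_norm_le_mul (c := 1) hu hu (fun x => by simp) (p := n / δ)
      (q := n / δ) (r := n / (2 * δ)) (by positivity) (by positivity)
      (by rw [inv_div, inv_div]; ring)
  refine h1.trans ?_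
  calc _ ≤ (C : ℝ≥0∞) * ((2 * n ^ 2 * (lam.toNNReal + 1) : ℝ≥0) * (C' * U ^ 2 * (U * U))) := by
        gcongr
        exact h2.trans (by gcongr; exact hC' hm hf hG t ht)
    _ = _ := by push_cast; ring

theorem contInLp_newtonConv_cubicCurvature (hn : 3 ≤ n) {δ : ℝ} (hδ : 1 / 2 < δ)
    (hδ' : δ < 1) (hm : IsLLGSolution lam T mInf m) (hf : IsMovingFrame T m X Y) :
    ContInLp T (ENNReal.ofReal (n / (4 * δ - 2)))
      fun t => newtonConv (cubicCurvature lam m X Y t) := by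
  have hn' : (3 : ℝ) ≤ n := by exact_mod_cast hn
  have hd2 : 0 < 4 * δ - 2 := by linarith
  have hd3 : 0 < 4 * δ - 1 := by linarith
  have hp : 1 < n / (4 * δ - 1) := by rw [one_lt_div hd3]; linarith
  exact (contInLp_cubicCurvature hn hm hf hp.le).newtonConv (by omega) hp
    (div_lt_self (by linarith) (by linarith)) (by positivity)
    (by rw [inv_div, inv_div]; field_simp; ring)
    fun t ht => ((regLp_cubicCurvature hn hm hf).smooth ht).continuous.measurable

/-- The two terms are separately continuous with values in L^(n/δ): a_0 by its regularity, and the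
potential because the cubic curvature also lies in L^(n/(1+δ)). No estimate is involved here, only
regularity. -/
theorem contInLp_temporalPotential_sub (hn : 3 ≤ n) {δ : ℝ} (hδ : 1 / 2 < δ)
    (hδ' : δ < 1) (hm : IsLLGSolution lam T mInf m) (hf : IsMovingFrame T m X Y) :
    ContInLp T (ENNReal.ofReal (n / δ)) fun t x =>
      temporalPotential T X Y t x - newtonConv (cubicCurvature lam m X Y t) x := by
  have hn' : (3 : ℝ) ≤ n := by exact_mod_cast hn
  have hδ0 : 0 < δ := by linarith
  have hp : 1 < n / (1 + δ) := by rw [one_lt_div (by linarith)]; linarith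
  have hq : 2 ≤ n / δ := by rw [le_div_iff₀ hδ0]; linarith
  have h1 : ContInLp T (ENNReal.ofReal (n / δ)) fun t =>
      newtonConv (cubicCurvature lam m X Y t) :=
    (contInLp_cubicCurvature hn hm hf hp.le).newtonConv (by omega) hp
      (div_lt_self (by linarith) (by linarith)) (by positivity)
      (by rw [inv_div, inv_div]; field_simp; ring)
      fun t ht => ((regLp_cubicCurvature hn hm hf).smooth ht).continuous.measurable
  refine (((regLp_temporalPotential hn hf 0).contInLp hq).add (one_le_ofReal hq)
    (h1.clm (-ContinuousLinearMap.id ℝ ℝ))).congr fun t _ => Eventually.of_forall fun x => ?_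
  simp [sub_eq_add_neg]

/-- Hölder gives (1+δ)/n as the reciprocal exponent of |u||∇u|, and the Riesz potential lowers it to
δ/n. This proves the bound at interior times. -/
theorem exists_eLpNorm_temporalPotential_sub_le (hn : 3 ≤ n) {δ : ℝ} (hδ : 1 / 2 < δ)
    (hδ' : δ < 1) (hlam : 0 < lam) :
    ∃ c : ℝ≥0, ∀ {T : ℝ} {mInf : Vec} {m X Y : ℝ → Space n → Vec}, 0 < T →
      IsLLGSolution lam T mInf m → IsMovingFrame T m X Y → IsCoulombGauge T X Y → ∀ t ∈ Icc 0 T,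
        eLpNorm (fun x => temporalPotential T X Y t x
            - newtonConv (cubicCurvature lam m X Y t) x) (ENNReal.ofReal (n / δ)) volume
          ≤ c * eLpNorm (derivField m X Y t) (ENNReal.ofReal (n / δ)) volume
            * eLpNorm (vecGradient (derivField m X Y t)) n volume := by
  have hn' : (3 : ℝ) ≤ n := by exact_mod_cast hn
  have hδ0 : 0 < δ := by linarith
  have hp : 1 < n / (1 + δ) := by rw [one_lt_div (by linarith)]; linarith
  have hpn : n / (1 + δ) < n := div_lt_self (by linarith) (by linarith)
  have hpq : (n / δ : ℝ)⁻¹ = (n / (1 + δ) : ℝ)⁻¹ - (n : ℝ)⁻¹ := by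
    rw [inv_div, inv_div]; field_simp; ring
  have hq : 2 ≤ n / δ := by rw [le_div_iff₀ hδ0]; linarith
  obtain ⟨C, hC⟩ := exists_eLpNorm_newtonConv_le (by omega) hp hpn (by positivity) hpq
  refine ⟨C * (2 * n ^ 2 * (lam.toNNReal + 1)), fun {T mInf m X Y} hT hm hf hG t ht => ?_⟩
  rw [← ENNReal.ofReal_natCast n]
  have hu := contInLp_derivField hn hm hf hq
  have hg := contInLp_vecGradient hn hm hf (r := n) (by linarith)
  have h1 : ∀ s ∈ Ioo 0 T, eLpNorm (fun x => temporalPotential T X Y s x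
            - newtonConv (cubicCurvature lam m X Y s) x) (ENNReal.ofReal (n / δ)) volume
          ≤ (C * (2 * n ^ 2 * (lam.toNNReal + 1)) : ℝ≥0)
            * eLpNorm (derivField m X Y s) (ENNReal.ofReal (n / δ)) volume
            * eLpNorm (vecGradient (derivField m X Y s)) (ENNReal.ofReal n) volume := by
    intro s hs
    have hs' := Ioo_subset_Icc_self hs
    refine (hC _ ((regLp_derivCurvature hn hm hf).smooth hs').continuous.measurable _ ?_).trans ?_
    · filter_upwards [ae_rieszPotential_ne_top (by omega) hp hpn (by positivity) hpq
        ((regLp_cubicCurvature hn hm hf).smooth hs').continuous.measurable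
        ((contInLp_cubicCurvature hn hm hf hp.le).1 s hs')] with x hx
      exact enorm_temporalPotential_sub_le hn hm hf hG hs hx
    · rw [ENNReal.coe_mul, mul_assoc, mul_assoc]
      gcongr
      exact eLpNorm_le_mul_of_norm_le_mul (hu.1 s hs').1 (hg.1 s hs').1
        (norm_derivCurvature_le hn hlam hm hf hs') (by positivity) (by positivity)
        (by rw [inv_div, inv_div]; field_simp; ring)
  -- Since T > 0, every t in the closed interval is a limit of interior times, and the inequality of
  -- continuous norms passes to the limit.
  have hne : (𝓝[Ioo 0 T] t).NeBot := by
    rw [← mem_closure_iff_nhdsWithin_neBot, closure_Ioo hT.ne]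
    exact ht
  have hle : 𝓝[Ioo 0 T] t ≤ 𝓝[Icc 0 T] t := nhdsWithin_mono _ Ioo_subset_Icc_self
  have hq1 := one_le_ofReal hq
  have hl := ((contInLp_temporalPotential_sub hn hδ hδ' hm hf).tendsto_eLpNorm hq1 ht).mono_left hle
  have hr1 := (hu.tendsto_eLpNorm hq1 ht).mono_left hle
  have hr2 := (hg.tendsto_eLpNorm (one_le_ofReal (by linarith)) ht).mono_left hle
  refine le_of_tendsto_of_tendsto hl (ENNReal.Tendsto.mul
    (ENNReal.Tendsto.const_mul hr1 (Or.inr ENNReal.coe_ne_top))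
    (Or.inr (hg.1 t ht).2.ne) hr2
    (Or.inr (ENNReal.mul_ne_top ENNReal.coe_ne_top (hu.1 t ht).2.ne))) ?_
  filter_upwards [self_mem_nhdsWithin] with s hs using h1 s hs

end TemporalPotential

/-! ### The theorem. -/

theorem mainTheorem6 (n : ℕ) (hn : 3 ≤ n) (δ lam : ℝ) (hδ : 1 / 2 < δ) (hδ' : δ < 1)
    (hlam : 0 < lam) :
    ∃ c : ℝ≥0, ∀ (T : ℝ), 0 < T →
      ∀ (mInf : Vec) (m X Y : ℝ → Space n → Vec),
        IsLLGSolution lam T mInf m → IsMovingFrame T m X Y → IsCoulombGauge T X Y →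
        (∀ t ∈ Icc 0 T,
          MemLp (spatialPotential X Y t) (ENNReal.ofReal (n / (2 * δ - 1))) volume ∧
          eLpNorm (spatialPotential X Y t) (ENNReal.ofReal (n / (2 * δ - 1))) volume
            ≤ c * eLpNorm (derivField m X Y t) (ENNReal.ofReal (n / δ)) volume ^ 2) ∧
        ∃ a₁ a₂ : ℝ → Space n → ℝ,
          (∀ t ∈ Icc 0 T, ∀ x, temporalPotential T X Y t x = a₁ t x + a₂ t x) ∧
          ContInLp T (ENNReal.ofReal (n / δ)) a₁ ∧
          ContInLp T (ENNReal.ofReal (n / (4 * δ - 2))) a₂ ∧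
          (∀ t ∈ Icc 0 T,
            eLpNorm (a₁ t) (ENNReal.ofReal (n / δ)) volume
              ≤ c * eLpNorm (derivField m X Y t) (ENNReal.ofReal (n / δ)) volume
                  * eLpNorm (vecGradient (derivField m X Y t)) n volume) ∧
          (∀ t ∈ Icc 0 T,
            eLpNorm (a₂ t) (ENNReal.ofReal (n / (4 * δ - 2))) volume
              ≤ c * eLpNorm (derivField m X Y t) (ENNReal.ofReal (n / δ)) volume ^ 4) := by
  have hn' : (3 : ℝ) ≤ n := by exact_mod_cast hn
  obtain ⟨c₀, h₀⟩ := exists_eLpNorm_spatialPotential_le hn hδ hδ' lam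
  obtain ⟨c₁, h₁⟩ := exists_eLpNorm_temporalPotential_sub_le hn hδ hδ' hlam
  obtain ⟨c₂, h₂⟩ := exists_eLpNorm_newtonConv_cubicCurvature_le hn hδ hδ' hlam
  have hc₀ : (c₀ : ℝ≥0∞) ≤ (max c₀ (max c₁ c₂) : ℝ≥0) := by
    exact_mod_cast le_max_left _ _
  have hc₁ : (c₁ : ℝ≥0∞) ≤ (max c₀ (max c₁ c₂) : ℝ≥0) := by
    exact_mod_cast (le_max_left _ _).trans (le_max_right _ _)
  have hc₂ : (c₂ : ℝ≥0∞) ≤ (max c₀ (max c₁ c₂) : ℝ≥0) := by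
    exact_mod_cast (le_max_right _ _).trans (le_max_right _ _)
  refine ⟨max c₀ (max c₁ c₂), fun T hT mInf m X Y hm hf hG =>
    ⟨fun t ht => ⟨?_, (h₀ hm hf hG t ht).trans (by gcongr)⟩,
      fun t x => temporalPotential T X Y t x - newtonConv (cubicCurvature lam m X Y t) x,
      fun t => newtonConv (cubicCurvature lam m X Y t), fun t _ x => (sub_add_cancel _ _).symm,
      contInLp_temporalPotential_sub hn hδ hδ' hm hf,
      contInLp_newtonConv_cubicCurvature hn hδ hδ' hm hf,
      fun t ht => (h₁ hT hm hf hG t ht).trans (by gcongr),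
      fun t ht => (h₂ hm hf hG t ht).trans (by gcongr)⟩⟩
  exact (contInLp_spatialPotential hn hf (by rw [le_div_iff₀ (by linarith)]; linarith)).1 t ht
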